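/- **Setting.** Let $N,M\ge 1$, let $\Omega\subset\mathbb R^N$ be open and bounded, and let $Q=(-1/2,1/2)^N$. Let $W:\mathbb R^N\times\mathbb R^M\to[0,\infty)$ and $a,b:\mathbb R^N\to\mathbb R^M$ be measurable and $Q$-periodic (that is, $\mathbb Z^N$-periodic) in the space variable. Let $E_1,\dots,E_k\subset Q$ be pairwise disjoint open sets with piecewise affine boundary (each $\partial E_i$ is a finite union of polytopes), with $Q=\bigcup_i(\overline{E_i}\cap Q)$. Assume: * for a.e. $y\in Q$ and all $p$, $W(y,p)=\sum_i\chi_{E_i}(y)W_i(y,p)$, with $W_i:\overline{E_i}\times\mathbb R^M\to[0,\infty)$ locally Lipschitz; * for a.e. $y\in Q$, $a(y)=\sum_i\chi_{E_i}(y)a_i(y)$ and $b(y)=\sum_i\chi_{E_i}(y)b_i(y)$, with $a_i,b_i:\overline{E_i}\to\mathbb R^M$ Lipschitz; and, for a.e. $y\in Q$, $W(y,p)=0$ if and only if $p\in\{a(y),b(y)\}$; * for every $i$ and a.e. $y_0\in E_i$ with $a_i(y_0)\ne b_i(y_0)$ there are $r,R,c_1>0$ such that, for all $y\in B(y_0,r)\cap\overline{E_i}$,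 $\frac1{c_1}|p-a_i(y)|^2\le W_i(y,p)\le c_1|p-a_i(y)|^2$ if $|p-a_i(y)|\le R$, and $\frac1{c_1}|p-b_i(y)|^2\le W_i(y,p)\le c_1|p-b_i(y)|^2$ if $|p-b_i(y)|\le R$; * there is $c_2>0$ such that, for a.e. $y\in Q$, $W(y,p)\ge\frac1{c_2}|p|^2$ if $|p|\ge c_2$, and $W(y,p)\le c_2(1+|p|^2)$ for all $p$. Let $\varepsilon_n,\delta_n>0$ with $\varepsilon_n\to0$, $\delta_n\to0$ and $\varepsilon_n/\delta_n\to0$. For $u\in L^2(\Omega;\mathbb R^M)$ let $$G_n(u)=\int_\Omega\Big[W\Big(\frac x{\delta_n},u(x)\Big)+\varepsilon_n^2|\nabla u(x)|^2\Big]dx\ \text{ if }u\in W^{1,2}(\Omega;\mathbb R^M),\qquad G_n(u)=+\infty\ \text{ otherwise,}$$ $$G^0(u)=\int_\Omega W^{\rm hom}(u(x))\,dx,\qquad W^{\rm hom}(p)=\inf\Big\{\int_Q W^{**}(y,p+\varphi(y))\,dy:\ \varphi\in L^2(Q;\mathbb R^M),\ \int_Q\varphi\,dy=0\Big\},$$ where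 $W^{**}(y,\cdot)$ is the convex envelope of $W(y,\cdot)$. For $\overline m\in\mathbb R^M$ let $\mathcal G_n(u;\overline m)=G_n(u)$ and $\mathcal G^0(u;\overline m)=G^0(u)$ if $\int_\Omega u\,dx=\overline m$, and let both be $+\infty$ otherwise. **Theorem.** Fix $\overline m\in\mathbb R^M$. 1. If $\sup_n\mathcal G_n(u_n;\overline m)<+\infty$, then, up to a subsequence, $u_n\rightharpoonup u$ weakly in $L^2(\Omega;\mathbb R^M)$ for some $u\in L^2(\Omega;\mathbb R^M)$ with $\mathcal G^0(u;\overline m)<\infty$. 2. $\mathcal G_n(\cdot;\overline m)$ $\Gamma$-converges to $\mathcal G^0(\cdot;\overline m)$ with respect to weak $L^2$ convergence: whenever $u_n\rightharpoonup u$, $\mathcal G^0(u;\overline m)\le\liminf_n\mathcal G_n(u_n;\overline m)$; and for every $u\in L^2(\Omega;\mathbb R^M)$ there are $u_n\rightharpoonup u$ with $\limsup_n\mathcal G_n(u_n;\overline m)\le\mathcal G^0(u;\overline m)$. 3. $\mathcal G^0(\cdot;\overline m)$ attains its minimum over $L^2(\Omega;\mathbb R^M)$, and $$\min\{\mathcal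 G^0(u;\overline m):u\in L^2(\Omega;\mathbb R^M)\}=0$$ if and only if $\overline m$ is compatible with the wells, in the sense that $\overline m=|\Omega|\big(\int_Q\theta(y)a(y)\,dy+\int_Q[1-\theta(y)]b(y)\,dy\big)$ for some measurable $\theta:Q\to[0,1]$. 4. A function $u\in L^2(\Omega;\mathbb R^M)$ satisfies $\mathcal G^0(u;\overline m)=0$ if and only if $\int_\Omega u\,dx=\overline m$ and there is $\mu\in L^2(\Omega\times Q;[0,1])$ such that, for a.e. $x\in\Omega$, $$u(x)=\int_Q\mu(x,y)a(y)\,dy+\int_Q[1-\mu(x,y)]b(y)\,dy.$$ -/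

import Mathlib

open MeasureTheory Filter Topology
open scoped ENNReal ContDiff

noncomputable section

namespace PhaseHomogenization

/-- The Euclidean space `ℝⁿ`. -/
abbrev E (n : ℕ) : Type := EuclideanSpace ℝ (Fin n)

/-- The open unit cube `Q = (-1/2, 1/2)^N`. -/
def unitCube (N : ℕ) : Set (E N) :=
  {y | ∀ i, y i ∈ Set.Ioo (-(1 / 2) : ℝ) (1 / 2)}

/-- The space `L²(s; ℝ^M)`, for `s ⊆ ℝ^N` with Lebesgue measure. -/
abbrev VecL2 {N : ℕ} (s : Set (E N)) (M : ℕ) : Type :=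
  Lp (E M) 2 ((volume : Measure (E N)).restrict s)

/-- The translation vector in `ℝ^N` given by a point of `ℤ^N`. -/
def latticePoint {N : ℕ} (z : Fin N → ℤ) : E N :=
  WithLp.toLp 2 fun i => (z i : ℝ)

/-- `Q`-periodicity of a function on `ℝ^N`: invariance under translations in `ℤ^N`. -/
def IsCubePeriodic {N : ℕ} {α : Type*} (f : E N → α) : Prop :=
  ∀ (x : E N) (z : Fin N → ℤ), f (x + latticePoint z) = f x

/-- The boundary of `s` is piecewise affine: it is a finite union of polytopes
(convex hulls of finitely many points). If `s` is open, its boundary has empty interior,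
hence all these polytopes have dimension at most `N - 1`. -/
def HasPiecewiseAffineBoundary {N : ℕ} (s : Set (E N)) : Prop :=
  ∃ T : Finset (Finset (E N)), frontier s = ⋃ F ∈ T, convexHull ℝ (F : Set (E N))

/-- A `Q`-periodic double well potential `W` with wells `a`, `b`, whose dependence on the space
variable is regular on each piece of a partition `E₁, …, E_k` of `Q`, up to jumps across the
boundaries of the pieces. Conditions holding almost everywhere are imposed on `Q`;
by periodicity they hold almost everywhere in `ℝ^N`. -/
structure PeriodicDoubleWell (N M : ℕ) where
  /-- the potential -/
  W : E N → E M → ℝ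
  /-- the first well -/
  a : E N → E M
  /-- the second well -/
  b : E N → E M
  /-- the number of pieces -/
  k : ℕ
  /-- the pieces of the partition of `Q` -/
  piece : Fin k → Set (E N)
  /-- the potential on each (closed) piece -/
  Wi : Fin k → E N → E M → ℝ
  /-- the first well on each (closed) piece -/
  ai : Fin k → E N → E M
  /-- the second well on each (closed) piece -/
  bi : Fin k → E N → E M
  W_nonneg : ∀ x p, 0 ≤ W x p
  W_measurable : AEMeasurable (fun z : E N × E M => W z.1 z.2) (volume.prod volume)
  a_measurable : AEMeasurable a volume
  b_measurable : AEMeasurable b volume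
  a_periodic : IsCubePeriodic a
  b_periodic : IsCubePeriodic b
  piece_open : ∀ i, IsOpen (piece i)
  piece_subset : ∀ i, piece i ⊆ unitCube N
  piece_disjoint : Pairwise fun i j => Disjoint (piece i) (piece j)
  piece_boundary : ∀ i, HasPiecewiseAffineBoundary (piece i)
  piece_cover : unitCube N = ⋃ i, closure (piece i) ∩ unitCube N
  /-- periodicity of the potential -/
  W_periodic : ∀ p, IsCubePeriodic fun x => W x p
  /-- piecewise representation of the potential -/
  W_eq : ∀ᵐ y ∂(volume.restrict (unitCube N)), ∀ p,
    W y p = ∑ i, (piece i).indicator (fun y' => Wi i y' p) y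
  Wi_nonneg : ∀ i, ∀ y ∈ closure (piece i), ∀ p, 0 ≤ Wi i y p
  Wi_locallyLipschitz : ∀ i,
    LocallyLipschitzOn (closure (piece i) ×ˢ Set.univ) fun z : E N × E M => Wi i z.1 z.2
  /-- piecewise representation of the wells -/
  a_eq : ∀ᵐ y ∂(volume.restrict (unitCube N)), a y = ∑ i, (piece i).indicator (ai i) y
  b_eq : ∀ᵐ y ∂(volume.restrict (unitCube N)), b y = ∑ i, (piece i).indicator (bi i) y
  ai_lipschitz : ∀ i, ∃ K, LipschitzOnWith K (ai i) (closure (piece i))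
  bi_lipschitz : ∀ i, ∃ K, LipschitzOnWith K (bi i) (closure (piece i))
  /-- the potential vanishes exactly at the wells -/
  W_eq_zero_iff : ∀ᵐ y ∂(volume.restrict (unitCube N)), ∀ p, W y p = 0 ↔ p = a y ∨ p = b y
  /-- quadratic behaviour close to the wells, locally, away from the points where they merge -/
  quadratic_near_wells : ∀ i, ∀ᵐ y₀ ∂(volume.restrict (piece i)), ai i y₀ ≠ bi i y₀ →
    ∃ r > 0, ∃ R > 0, ∃ c₁ > 0, ∀ y ∈ Metric.ball y₀ r ∩ closure (piece i), ∀ p,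
      (‖p - ai i y‖ ≤ R →
        1 / c₁ * ‖p - ai i y‖ ^ 2 ≤ Wi i y p ∧ Wi i y p ≤ c₁ * ‖p - ai i y‖ ^ 2) ∧
      (‖p - bi i y‖ ≤ R →
        1 / c₁ * ‖p - bi i y‖ ^ 2 ≤ Wi i y p ∧ Wi i y p ≤ c₁ * ‖p - bi i y‖ ^ 2)
  /-- quadratic growth at infinity -/
  quadratic_growth : ∃ c₂ > 0, ∀ᵐ y ∂(volume.restrict (unitCube N)), ∀ p,
    (c₂ ≤ ‖p‖ → 1 / c₂ * ‖p‖ ^ 2 ≤ W y p) ∧ W y p ≤ c₂ * (1 + ‖p‖ ^ 2)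

variable {N M : ℕ}

/-- `g = (g₁, …, g_N)` is the weak gradient in `Ω` of `u`: for all `φ ∈ C_c^∞(Ω)` and all `j`,
`∫_Ω ∂_j φ u dx = - ∫_Ω φ g_j dx`. -/
def IsWeakGradient {Ω : Set (E N)} (u : VecL2 Ω M) (g : Fin N → VecL2 Ω M) : Prop :=
  ∀ φ : E N → ℝ, ContDiff ℝ ∞ φ → HasCompactSupport φ → tsupport φ ⊆ Ω → ∀ j : Fin N,
    ∫ x in Ω, (fderiv ℝ φ x (EuclideanSpace.single j 1)) • u x = - ∫ x in Ω, φ x • g j x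

/-- The functional `G_{ε,δ}` on `L²(Ω; ℝ^M)`, with values in `[0, ∞]`:
`∫_Ω [W(x/δ, u) + ε² |∇u|²] dx` if `u ∈ W^{1,2}(Ω; ℝ^M)`, that is, if `u` has a weak gradient
in `L²`, and `+∞` otherwise. The weak gradient is unique when it exists, so the infimum below has
at most one term; it is `+∞` when there is none. -/
def energy (W : E N → E M → ℝ) (Ω : Set (E N)) (ε δ : ℝ) (u : VecL2 Ω M) : ℝ≥0∞ :=
  ⨅ (g : Fin N → VecL2 Ω M) (_ : IsWeakGradient u g),
    ∫⁻ x in Ω, ENNReal.ofReal (W (δ⁻¹ • x) (u x) + ε ^ 2 * ∑ j, ‖g j x‖ ^ 2)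

/-- The convex envelope of a nonnegative function: its largest convex minorant. -/
def convexEnvelope (f : E M → ℝ) (p : E M) : ℝ :=
  ⨆ h : {h : E M → ℝ // ConvexOn ℝ Set.univ h ∧ ∀ q, h q ≤ f q}, h.1 p

/-- The homogenized potential: the infimum of `∫_Q W**(y, p + φ(y)) dy` over
`φ ∈ L²(Q; ℝ^M)` with zero average. -/
def homogenizedPotential (W : E N → E M → ℝ) (p : E M) : ℝ≥0∞ :=
  ⨅ (φ : VecL2 (unitCube N) M) (_ : ∫ y in unitCube N, φ y = 0),
    ∫⁻ y in unitCube N, ENNReal.ofReal (convexEnvelope (W y) (p + φ y))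

/-- The functional `G⁰(u) = ∫_Ω W^hom(u(x)) dx`. -/
def limitEnergy (W : E N → E M → ℝ) (Ω : Set (E N)) (u : VecL2 Ω M) : ℝ≥0∞ :=
  ∫⁻ x in Ω, homogenizedPotential W (u x)

open Classical in
/-- Restriction of a functional to the functions of mass `m`, with value `+∞` elsewhere. -/
def massConstrained {Ω : Set (E N)} (F : VecL2 Ω M → ℝ≥0∞) (m : E M) (u : VecL2 Ω M) : ℝ≥0∞ :=
  if ∫ x in Ω, u x = m then F u else ⊤

/-- Weak convergence of a sequence in a Hilbert space. -/
def WeaklyConverges {H : Type*} [NormedAddCommGroup H] [InnerProductSpace ℝ H]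
    (u : ℕ → H) (v : H) : Prop :=
  ∀ w : H, Tendsto (fun n => inner ℝ (u n) w) atTop (𝓝 (inner ℝ v w))

/-- (Sequential) `Γ`-convergence of functionals with respect to weak convergence: the liminf
inequality along weakly convergent sequences, and the existence of recovery sequences. -/
def WeaklyGammaConverges {H : Type*} [NormedAddCommGroup H] [InnerProductSpace ℝ H]
    (F : ℕ → H → ℝ≥0∞) (F₀ : H → ℝ≥0∞) : Prop :=
  (∀ (v : H) (u : ℕ → H), WeaklyConverges u v →
    F₀ v ≤ liminf (fun n => F n (u n)) atTop) ∧
  (∀ v : H, ∃ u : ℕ → H, WeaklyConverges u v ∧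
    limsup (fun n => F n (u n)) atTop ≤ F₀ v)

/-- `u` is an averaged mixture of the wells: for a.e. `x ∈ Ω`,
`u(x) = ∫_Q μ(x,y) a(y) dy + ∫_Q (1 - μ(x,y)) b(y) dy`, for some `μ ∈ L²(Ω × Q; [0,1])`. -/
def IsAveragedMixture (a b : E N → E M) {Ω : Set (E N)} (u : VecL2 Ω M) : Prop :=
  ∃ μ : E N × E N → ℝ,
    MemLp μ 2 ((volume.restrict Ω).prod (volume.restrict (unitCube N))) ∧
    (∀ᵐ z ∂((volume.restrict Ω).prod (volume.restrict (unitCube N))), μ z ∈ Set.Icc (0 : ℝ) 1) ∧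
    ∀ᵐ x ∂(volume.restrict Ω),
      u x = (∫ y in unitCube N, μ (x, y) • a y) + ∫ y in unitCube N, (1 - μ (x, y)) • b y

/-- The mass `m` is compatible with the wells: the average `m / |Ω|` is an average over the unit
cube of a mixture of the wells, that is, `m = |Ω| (∫_Q θ a dy + ∫_Q (1 - θ) b dy)` for some
measurable `θ : Q → [0,1]`. -/
def IsCompatibleMass (a b : E N → E M) (Ω : Set (E N)) (m : E M) : Prop :=
  ∃ θ : E N → ℝ, Measurable θ ∧ (∀ y, θ y ∈ Set.Icc (0 : ℝ) 1) ∧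
    m = (volume Ω).toReal •
      ((∫ y in unitCube N, θ y • a y) + ∫ y in unitCube N, (1 - θ y) • b y)

end PhaseHomogenization

end

noncomputable section

namespace PhaseHomogenization

open scoped Pointwise

section Periodic

variable {N : ℕ}

/-! ### The unit cube and periodic functions -/

/-! All the functionals see `W`, `a`, `b` only up to null sets. The potential is therefore replaced
by a Borel one, periodic everywhere, with quadratic growth and with continuity in `p` that is
uniform in `y` on bounded sets (`IsRegularIntegrand`, `exists_isRegularIntegrand`).

The central object is the least cell energy H(p), the infimum of ∫_Q W(y, ψ(y)) dy over bounded
periodic ψ of mean p (`relaxedPotential`). No convexification appears in it: H is convex because two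
competitors can be mixed by fine lamination (`convexOn_relaxedPotential`). Being finite and convex,
H has affine minorants that are almost exact at a given point. Supremum and integral can be
exchanged in ∫_Q sup_q (ξ·q − W(y,q)) dy, so that H(p) = sup_ξ (ξ·p − ∫_Q W*(y,ξ) dy)
(`exists_slope`, `inner_sub_meanConjugate_le`). This duality identifies H with W^hom
(`homogenizedPotential_eq`), since W** lies between ξ·q − W*(y,ξ) and W.

Lower bound: W(x/δ, u_n) ≥ Ξ(x)·u_n − W*(x/δ, Ξ(x)) for a simple field of slopes Ξ. The right side
is linear in u_n, and its oscillating term converges to its cell average, so weak convergence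
suffices (`le_liminf_lintegral`). Upper bound: for a simple function s, near-optimal cell functions
give ψ_{s(x)}(x/δ). Smoothing makes the gradient of order 1/δ, so the singular term is of order
(ε/δ)² and vanishes. A small additive constant restores the mass (`exists_recovery_simpleFunc`);
density and a diagonal argument conclude. Compactness is the quadratic coercivity of W, and Jensen's
inequality makes the constant m/|Ω| a minimizer.

Zeros: mixtures of the wells annihilate every convex minorant of W up to sign, so W^hom vanishes at
their averages. Conversely, if H(p) = 0, near-minimizers approach the wells in L¹, and p is a limit
of averages of mixtures (`mem_closure_mixtureSet`). The densities μ(x,y) are then obtained as a weak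
limit in L²(Ω × Q) of densities attached to simple functions, which also provides their joint
measurability (`isAveragedMixture`). For the mass, Jensen reduces a function of zero energy to a
constant one, and a single fibre of its density gives θ. -/

lemma latticePoint_apply (z : Fin N → ℤ) (i : Fin N) : latticePoint z i = z i := rfl

lemma unitCube_eq_preimage (N : ℕ) : unitCube N = (fun x : E N => x.ofLp) ⁻¹'
    (Set.univ.pi fun _ => Set.Ioo (-(1 / 2) : ℝ) (1 / 2)) := by
  ext x; simp [unitCube]

lemma isOpen_unitCube (N : ℕ) : IsOpen (unitCube N) := by
  rw [unitCube_eq_preimage]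
  exact (isOpen_set_pi Set.finite_univ fun _ _ => isOpen_Ioo).preimage (PiLp.continuous_ofLp 2 _)

lemma measurableSet_unitCube (N : ℕ) : MeasurableSet (unitCube N) :=
  (isOpen_unitCube N).measurableSet

lemma volume_unitCube (N : ℕ) : volume (unitCube N) = 1 := by
  rw [unitCube_eq_preimage, (PiLp.volume_preserving_ofLp (Fin N)).measure_preimage
    (MeasurableSet.univ_pi fun _ => measurableSet_Ioo).nullMeasurableSet, Real.volume_pi_Ioo]
  norm_num

instance isProbabilityMeasure_unitCube (N : ℕ) :
    IsProbabilityMeasure ((volume : Measure (E N)).restrict (unitCube N)) :=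
  ⟨by simp [volume_unitCube]⟩

lemma norm_le_of_mem_unitCube {y : E N} (hy : y ∈ unitCube N) : ‖y‖ ≤ N := by
  calc ‖y‖ ≤ ∑ i, ‖y i‖ := by
        rw [EuclideanSpace.norm_eq]
        refine Real.sqrt_le_iff.2 ⟨by positivity, ?_⟩
        exact Finset.sum_sq_le_sq_sum_of_nonneg fun i _ => norm_nonneg _
    _ ≤ ∑ _i : Fin N, (1 : ℝ) := by
        refine Finset.sum_le_sum fun i _ => ?_
        have := hy i
        rw [Real.norm_eq_abs, abs_le]
        constructor <;> linarith [this.1, this.2]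
    _ = N := by simp

/-- The centre of the cube `[0,1)^N`. -/
def cubeCenter (N : ℕ) : E N := WithLp.toLp 2 fun _ => (1 / 2 : ℝ)

/-- The half-open cube `[-1/2, 1/2)^N`. -/
def halfOpenCube (N : ℕ) : Set (E N) :=
  -cubeCenter N +ᵥ ZSpan.fundamentalDomain (EuclideanSpace.basisFun (Fin N) ℝ).toBasis

lemma halfOpenCube_eq_preimage (N : ℕ) : halfOpenCube N = (fun x : E N => x.ofLp) ⁻¹'
    (Set.univ.pi fun _ => Set.Ico (-(1 / 2) : ℝ) (1 / 2)) := by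
  ext x
  rw [halfOpenCube, Set.mem_vadd_set_iff_neg_vadd_mem, ZSpan.mem_fundamentalDomain]
  simp only [neg_neg, vadd_eq_add, OrthonormalBasis.coe_toBasis_repr_apply,
    EuclideanSpace.basisFun_repr, PiLp.add_apply, cubeCenter, Set.mem_Ico, Set.mem_preimage,
    Set.mem_pi, Set.mem_univ, true_imp_iff]
  refine forall_congr' fun i => ?_
  constructor <;> intro h <;> constructor <;> linarith [h.1, h.2]

lemma unitCube_ae_eq_halfOpenCube (N : ℕ) : unitCube N =ᵐ[volume] halfOpenCube N := by
  rw [unitCube_eq_preimage, halfOpenCube_eq_preimage]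
  exact (PiLp.volume_preserving_ofLp (Fin N)).quasiMeasurePreserving.preimage_ae_eq
    (Measure.univ_pi_Ioo_ae_eq_Icc.trans Measure.univ_pi_Ico_ae_eq_Icc.symm)

/-- The lattice `ℤ^N` of `ℝ^N`. -/
abbrev cubeLattice (N : ℕ) : AddSubgroup (E N) :=
  (Submodule.span ℤ (Set.range (EuclideanSpace.basisFun (Fin N) ℝ).toBasis)).toAddSubgroup

instance (N : ℕ) : Countable (cubeLattice N) :=
  inferInstanceAs (Countable (Submodule.span ℤ
    (Set.range (EuclideanSpace.basisFun (Fin N) ℝ).toBasis)))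

lemma exists_eq_latticePoint (g : cubeLattice N) : ∃ z : Fin N → ℤ, (g : E N) = latticePoint z := by
  have h := ((EuclideanSpace.basisFun (Fin N) ℝ).toBasis.mem_span_iff_repr_mem ℤ (g : E N)).1 g.2
  choose z hz using h
  refine ⟨z, ?_⟩
  ext i
  have := hz i
  simp only [algebraMap_int_eq, eq_intCast, OrthonormalBasis.coe_toBasis_repr_apply,
    EuclideanSpace.basisFun_repr] at this
  rw [latticePoint_apply, this]

lemma isAddFundamentalDomain_vadd_halfOpenCube (x : E N) :
    IsAddFundamentalDomain (cubeLattice N) (x +ᵥ halfOpenCube N) (volume : Measure (E N)) :=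
  ((ZSpan.isAddFundamentalDomain' (EuclideanSpace.basisFun (Fin N) ℝ).toBasis
    (volume : Measure (E N))).vadd_of_comm (-cubeCenter N)).vadd_of_comm x

lemma isAddFundamentalDomain_halfOpenCube (N : ℕ) :
    IsAddFundamentalDomain (cubeLattice N) (halfOpenCube N) (volume : Measure (E N)) := by
  simpa using isAddFundamentalDomain_vadd_halfOpenCube (0 : E N)

/-- The integral over the unit cube of a periodic function is invariant under translation. -/
lemma IsCubePeriodic.setIntegral_add {F : Type*} [NormedAddCommGroup F] [NormedSpace ℝ F]
    {f : E N → F} (hf : IsCubePeriodic f) (x : E N) :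
    ∫ s in unitCube N, f (x + s) = ∫ s in unitCube N, f s := by
  rw [setIntegral_congr_set (unitCube_ae_eq_halfOpenCube N),
    setIntegral_congr_set (unitCube_ae_eq_halfOpenCube N)]
  have hinv : ∀ (g : cubeLattice N) (y : E N), f (g +ᵥ y) = f y := by
    intro g y
    obtain ⟨z, hz⟩ := exists_eq_latticePoint g
    rw [AddSubgroup.vadd_def, hz, vadd_eq_add, add_comm, hf]
  -- Every translate of the half-open cube is a fundamental domain of the lattice, and an invariant
  -- function has the same integral over all of them.
  rw [← (isAddFundamentalDomain_vadd_halfOpenCube x).setIntegral_eq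
    (isAddFundamentalDomain_halfOpenCube N) hinv]
  rw [← (measurePreserving_add_left volume x).setIntegral_preimage_emb
    (MeasurableEquiv.addLeft x).measurableEmbedding f]
  congr 2
  ext y
  simp [Set.mem_vadd_set_iff_neg_vadd_mem]

/-- A periodic property that holds almost everywhere in the unit cube holds almost everywhere. -/
lemma ae_of_ae_unitCube {P : E N → Prop} (hP : IsCubePeriodic P)
    (h : ∀ᵐ y ∂(volume.restrict (unitCube N)), P y) : ∀ᵐ y : E N, P y := by
  rw [Measure.restrict_congr_set (unitCube_ae_eq_halfOpenCube N)] at h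
  refine (isAddFundamentalDomain_halfOpenCube N).measure_zero_of_invariant _ (fun g => ?_) ?_
  · ext y
    obtain ⟨z, hz⟩ := exists_eq_latticePoint (-g)
    rw [Set.mem_vadd_set_iff_neg_vadd_mem, AddSubgroup.vadd_def, hz, vadd_eq_add, add_comm]
    simp [hP y z]
  · have hm : MeasurableSet (halfOpenCube N) := by
      rw [halfOpenCube_eq_preimage]
      exact (PiLp.volume_preserving_ofLp (Fin N)).measurable
        (MeasurableSet.univ_pi fun _ => measurableSet_Ico)
    rw [ae_iff, Measure.restrict_apply' hm] at h
    exact h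

/-! ### Riemann–Lebesgue lemma for rescaled periodic functions. -/

/-- Translation is continuous in `L¹`, at `0`. -/
lemma tendsto_integral_norm_sub_translate {F : Type*} [NormedAddCommGroup F] [NormedSpace ℝ F]
    {f : E N → F} (hf : Integrable f) :
    Tendsto (fun v : E N => ∫ x, ‖f x - f (x - v)‖) (𝓝 0) (𝓝 0) := by
  let g : C(E N, C(E N, E N)) :=
    (ContinuousMap.mk (fun a : E N × E N => a.2 - a.1) (by fun_prop)).curry
  have hgm : ∀ a, MeasurePreserving (g a) (volume : Measure (E N)) volume := fun a =>
    measurePreserving_sub_right volume a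
  have hf1 : MemLp f 1 volume := memLp_one_iff_integrable.2 hf
  have h := Continuous.compMeasurePreservingLp (f := fun _ : E N => hf1.toLp f)
    continuous_const g.continuous hgm ENNReal.one_ne_top
  have h0 := ((h.sub continuous_const).norm (E := Lp F 1 (volume : Measure (E N)))).tendsto 0
    (f := fun v => ‖Lp.compMeasurePreserving (g v) (hgm v) (hf1.toLp f) - hf1.toLp f‖)
  have key : ∀ v, ‖Lp.compMeasurePreserving (g v) (hgm v) (hf1.toLp f) - hf1.toLp f‖
      = ∫ x, ‖f x - f (x - v)‖ := by
    intro v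
    rw [Lp.toLp_compMeasurePreserving, ← MemLp.toLp_sub, L1.norm_eq_integral_norm]
    refine integral_congr_ae ?_
    filter_upwards [MemLp.coeFn_toLp ((hf1.comp_measurePreserving (hgm v)).sub hf1)] with x hx
    rw [hx, Pi.sub_apply, norm_sub_rev]
    rfl
  simp only [key] at h0
  simpa using h0

/-- Periodic functions, rescaled by `δ → 0`, converge weakly to their average. -/
theorem tendsto_integral_inner_periodic {F : Type*} [NormedAddCommGroup F] [InnerProductSpace ℝ F]
    [CompleteSpace F] {h : E N → F} (hm : StronglyMeasurable h) (hp : IsCubePeriodic h) {C : ℝ}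
    (hC : ∀ y, ‖h y‖ ≤ C) {f : E N → F} (hf : Integrable f) {δ : ℕ → ℝ}
    (hδ : ∀ n, 0 < δ n) (hδ0 : Tendsto δ atTop (𝓝 0)) :
    Tendsto (fun n => ∫ x, inner ℝ (f x) (h ((δ n)⁻¹ • x))) atTop
      (𝓝 (∫ x, inner ℝ (f x) (∫ y in unitCube N, h y))) := by
  have hC0 : 0 ≤ C := (norm_nonneg _).trans (hC 0)
  have hint : ∀ {k : E N → F}, StronglyMeasurable k → (∀ y, ‖k y‖ ≤ C) →
      ∀ {f' : E N → F}, Integrable f' → Integrable fun x => inner ℝ (f' x) (k x) := by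
    intro k hk hkC f' hf'
    refine (hf'.norm.mul_const C).mono' (hf'.aestronglyMeasurable.inner hk.aestronglyMeasurable) ?_
    filter_upwards with x
    exact (norm_inner_le_norm _ _).trans (mul_le_mul_of_nonneg_left (hkC x) (norm_nonneg _))
  have hsm : ∀ d : ℝ, StronglyMeasurable fun x : E N => h (d • x) := fun d =>
    hm.comp_measurable (measurable_const_smul d)
  -- By periodicity the mean of `h` is the average over `s ∈ Q` of h(x/δ + s). The change of
  -- variables x ↦ x − δs moves the shift onto `f`, so the error is controlled by the L¹ modulus of
  -- continuity of `f` at scale δN, with no regularity of `h`.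
  have key : ∀ n, (∫ x, inner ℝ (f x) (h ((δ n)⁻¹ • x))) -
      ∫ x, inner ℝ (f x) (∫ y in unitCube N, h y) =
      ∫ s in unitCube N, ∫ x, inner ℝ (f x - f (x - δ n • s)) (h ((δ n)⁻¹ • x)) := by
    intro n
    have hprod : Integrable (Function.uncurry fun x s : E N => inner ℝ (f x) (h ((δ n)⁻¹ • x + s)))
        (volume.prod (volume.restrict (unitCube N))) := by
      have hk : StronglyMeasurable fun z : E N × E N => h ((δ n)⁻¹ • z.1 + z.2) :=
        hm.comp_measurable (by fun_prop)
      have hf' : Integrable (fun z : E N × E N => f z.1)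
          (volume.prod (volume.restrict (unitCube N))) := hf.comp_fst _
      refine (hf'.norm.mul_const C).mono'
        (hf'.aestronglyMeasurable.inner hk.aestronglyMeasurable) ?_
      filter_upwards with z
      exact (norm_inner_le_norm _ _).trans (mul_le_mul_of_nonneg_left (hC _) (norm_nonneg _))
    have hbd : ∀ x : E N, Integrable (fun s => h ((δ n)⁻¹ • x + s))
        (volume.restrict (unitCube N)) := fun x =>
      Integrable.of_bound (hm.comp_measurable (by fun_prop)).aestronglyMeasurable C
        (Eventually.of_forall fun _ => hC _)
    have h1 : ∫ x, inner ℝ (f x) (∫ y in unitCube N, h y) =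
        ∫ s in unitCube N, ∫ x, inner ℝ (f x) (h ((δ n)⁻¹ • x + s)) := by
      rw [← integral_integral_swap hprod]
      refine integral_congr_ae (Eventually.of_forall fun x => ?_)
      simp only
      rw [integral_inner (hbd x), hp.setIntegral_add]
    have h2 : ∀ s, ∫ x, inner ℝ (f x) (h ((δ n)⁻¹ • x + s)) =
        ∫ x, inner ℝ (f (x - δ n • s)) (h ((δ n)⁻¹ • x)) := by
      intro s
      rw [← integral_add_right_eq_self (fun x => inner ℝ (f (x - δ n • s)) (h ((δ n)⁻¹ • x)))
        (δ n • s)]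
      refine integral_congr_ae (Eventually.of_forall fun x => ?_)
      simp only [add_sub_cancel_right, smul_add, inv_smul_smul₀ (hδ n).ne']
    have h3 : ∫ x, inner ℝ (f x) (h ((δ n)⁻¹ • x)) =
        ∫ _s in unitCube N, ∫ x, inner ℝ (f x) (h ((δ n)⁻¹ • x)) := by simp
    rw [h1, h3, ← integral_sub (integrable_const _)]
    · refine integral_congr_ae (Eventually.of_forall fun s => ?_)
      simp only
      rw [h2, ← integral_sub (hint (hsm _) (fun _ => hC _) hf)
        (hint (hsm _) (fun _ => hC _) (hf.comp_sub_right _))]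
      simp only [inner_sub_left]
    · exact hprod.swap.integral_prod_left
  rw [Metric.tendsto_atTop]
  intro η hη
  have hτ := tendsto_integral_norm_sub_translate hf
  rw [Metric.tendsto_nhds_nhds] at hτ
  obtain ⟨ρ, hρ, hτρ⟩ := hτ (η / (C + 1)) (by positivity)
  have hev : ∀ᶠ n in atTop, δ n * N < ρ := by
    have : Tendsto (fun n => δ n * N) atTop (𝓝 (0 * N)) := hδ0.mul_const _
    rw [zero_mul] at this
    exact this.eventually (gt_mem_nhds hρ)
  obtain ⟨n₀, hn₀⟩ := eventually_atTop.1 hev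
  refine ⟨n₀, fun n hn => ?_⟩
  rw [Real.dist_eq, key n, ← Real.norm_eq_abs]
  have hb : ∀ s ∈ unitCube N,
      ‖∫ x, inner ℝ (f x - f (x - δ n • s)) (h ((δ n)⁻¹ • x))‖ ≤ C * (η / (C + 1)) := by
    intro s hs
    have hlt : ‖δ n • s‖ < ρ := by
      rw [norm_smul, Real.norm_of_nonneg (hδ n).le]
      exact (mul_le_mul_of_nonneg_left (norm_le_of_mem_unitCube hs) (hδ n).le).trans_lt (hn₀ n hn)
    have h1 := hτρ (x := δ n • s) (by simpa using hlt)
    rw [Real.dist_eq, sub_zero] at h1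
    have hfi : Integrable fun x => f x - f (x - δ n • s) := hf.sub (hf.comp_sub_right _)
    calc ‖∫ x, inner ℝ (f x - f (x - δ n • s)) (h ((δ n)⁻¹ • x))‖
        ≤ ∫ x, C * ‖f x - f (x - δ n • s)‖ := by
          refine norm_integral_le_of_norm_le (hfi.norm.const_mul C) (Eventually.of_forall fun x => ?_)
          rw [mul_comm C]
          exact (norm_inner_le_norm _ _).trans (mul_le_mul_of_nonneg_left (hC _) (norm_nonneg _))
      _ ≤ C * (η / (C + 1)) := by
          rw [integral_const_mul]
          exact mul_le_mul_of_nonneg_left ((le_abs_self _).trans h1.le) hC0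
  refine (norm_setIntegral_le_of_norm_le_const (by simp [volume_unitCube]) hb).trans_lt ?_
  rw [Measure.real, volume_unitCube, ENNReal.toReal_one, mul_one, mul_div_assoc', div_lt_iff₀ (by positivity)]
  nlinarith

/-- Periodic scalar functions, rescaled by `δ → 0`, converge weakly to their average. -/
theorem tendsto_setIntegral_periodic {h : E N → ℝ} (hm : Measurable h) (hp : IsCubePeriodic h)
    {C : ℝ} (hC : ∀ y, |h y| ≤ C) {A : Set (E N)} (hA : MeasurableSet A) (hAfin : volume A ≠ ⊤)
    {δ : ℕ → ℝ} (hδ : ∀ n, 0 < δ n) (hδ0 : Tendsto δ atTop (𝓝 0)) :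
    Tendsto (fun n => ∫ x in A, h ((δ n)⁻¹ • x)) atTop
      (𝓝 (volume.real A * ∫ y in unitCube N, h y)) := by
  have hf : Integrable (A.indicator fun _ => (1 : ℝ)) (volume : Measure (E N)) :=
    (integrable_indicator_iff hA).2 (integrableOn_const hAfin)
  have := tendsto_integral_inner_periodic hm.stronglyMeasurable hp hC hf hδ hδ0
  convert this using 2 with n
  · rw [← integral_indicator hA]
    congr 1 with x
    by_cases hx : x ∈ A <;> simp [hx]
  · rw [show (fun x : E N => inner ℝ (A.indicator (fun _ => (1 : ℝ)) x) (∫ y in unitCube N, h y)) =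
      A.indicator fun _ => ∫ y in unitCube N, h y by
        ext x; by_cases hx : x ∈ A <;> simp [hx], integral_indicator hA, setIntegral_const, smul_eq_mul]

end Periodic

section Relaxed

variable {N M : ℕ}

/-! ### Regular integrands and the cell problem -/

/-- A nonnegative periodic integrand with quadratic growth, uniformly continuous on bounded sets
in the second variable, uniformly in the first. -/
structure IsRegularIntegrand (W : E N → E M → ℝ) : Prop where
  measurable : ∀ p, Measurable fun y => W y p
  periodic : ∀ p, IsCubePeriodic fun y => W y p
  nonneg : ∀ y p, 0 ≤ W y p
  growth : ∃ C > 0, ∀ y p, ‖p‖ ^ 2 ≤ C * (1 + W y p) ∧ W y p ≤ C * (1 + ‖p‖ ^ 2)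
  modulus : ∀ R : ℝ, ∀ η > 0, ∃ K ≥ 0, ∀ y p q, ‖p‖ ≤ R → ‖q‖ ≤ R →
    W y p ≤ W y q + η + K * ‖p - q‖

variable {W : E N → E M → ℝ}

namespace IsRegularIntegrand

lemma continuous (hW : IsRegularIntegrand W) (y : E N) : Continuous (W y) := by
  rw [continuous_iff_continuousAt]
  intro p
  rw [Metric.continuousAt_iff]
  intro η hη
  obtain ⟨K, hK, h⟩ := hW.modulus (‖p‖ + 1) (η / 2) (by positivity)
  refine ⟨min 1 (η / (2 * (K + 1))), by positivity, fun {q} hq => ?_⟩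
  rw [dist_eq_norm, lt_min_iff] at hq
  have hqR : ‖q‖ ≤ ‖p‖ + 1 := by
    have := norm_add_le p (q - p)
    rw [add_sub_cancel] at this
    linarith [hq.1]
  have hKb : K * ‖q - p‖ < η / 2 := by
    have h2 := hq.2
    rw [lt_div_iff₀ (by positivity)] at h2
    rcases hK.eq_or_lt with h0 | h0
    · rw [← h0, zero_mul]; positivity
    · nlinarith [norm_nonneg (q - p)]
  have h1 := h y q p hqR (by linarith)
  have h2 := h y p q (by linarith) hqR
  rw [norm_sub_rev] at h2
  rw [Real.dist_eq, abs_lt]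
  constructor <;> linarith

/-- Carathéodory's argument: continuity in `p` and measurability in `y` for each `p` give joint
measurability. -/
lemma measurable_comp (hW : IsRegularIntegrand W) {X : Type*} [MeasurableSpace X] {τ : X → E N}
    (hτ : Measurable τ) {ψ : X → E M} (hψ : Measurable ψ) :
    Measurable fun x => W (τ x) (ψ x) := by
  have h : Measurable (Function.uncurry fun (p : E M) (y : E N) => W y p) :=
    measurable_uncurry_of_continuous_of_measurable hW.continuous hW.measurable
  exact h.comp (hψ.prodMk hτ)

lemma aestronglyMeasurable_comp (hW : IsRegularIntegrand W) {X : Type*} [MeasurableSpace X]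
    {μ : Measure X} {τ : X → E N} (hτ : Measurable τ) {ψ : X → E M} (hψ : AEMeasurable ψ μ) :
    AEStronglyMeasurable (fun x => W (τ x) (ψ x)) μ := by
  refine ⟨fun x => W (τ x) (hψ.mk ψ x),
    (hW.measurable_comp hτ hψ.measurable_mk).stronglyMeasurable, ?_⟩
  filter_upwards [hψ.ae_eq_mk] with x hx
  rw [hx]

lemma exists_bound (hW : IsRegularIntegrand W) (R : ℝ) :
    ∃ C, ∀ y p, ‖p‖ ≤ R → |W y p| ≤ C := by
  obtain ⟨C, hC, h⟩ := hW.growth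
  refine ⟨C * (1 + R ^ 2), fun y p hp => ?_⟩
  rw [abs_of_nonneg (hW.nonneg y p)]
  refine (h y p).2.trans (mul_le_mul_of_nonneg_left ?_ hC.le)
  gcongr

lemma integrable_comp (hW : IsRegularIntegrand W) {X : Type*} [MeasurableSpace X]
    {μ : Measure X} [IsFiniteMeasure μ] {τ : X → E N} (hτ : Measurable τ) {ψ : X → E M}
    (hψ : AEMeasurable ψ μ) {R : ℝ} (hR : ∀ᵐ x ∂μ, ‖ψ x‖ ≤ R) :
    Integrable (fun x => W (τ x) (ψ x)) μ := by
  obtain ⟨C, hC⟩ := hW.exists_bound R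
  refine Integrable.of_bound (hW.aestronglyMeasurable_comp hτ hψ) C ?_
  filter_upwards [hR] with x hx using hC _ _ hx

/-- Comparison of the energies of two bounded functions, in terms of their `L¹` distance. -/
lemma integral_comp_le (hW : IsRegularIntegrand W) (R : ℝ) {η : ℝ} (hη : 0 < η) :
    ∃ K ≥ 0, ∀ {X : Type} [MeasurableSpace X] (μ : Measure X) [IsFiniteMeasure μ] (τ : X → E N)
      (φ ψ : X → E M), Measurable τ → AEMeasurable φ μ → AEMeasurable ψ μ →
      (∀ᵐ x ∂μ, ‖φ x‖ ≤ R) → (∀ᵐ x ∂μ, ‖ψ x‖ ≤ R) →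
      ∫ x, W (τ x) (φ x) ∂μ ≤ ∫ x, W (τ x) (ψ x) ∂μ + η * μ.real Set.univ +
        K * ∫ x, ‖φ x - ψ x‖ ∂μ := by
  -- `K` is fixed before the measure space and the functions, so one constant serves a whole
  -- sequence, both in the cell and on Ω.
  obtain ⟨K, hK, h⟩ := hW.modulus R η hη
  refine ⟨K, hK, fun {X} _ μ _ τ φ ψ hτ hφ hψ hφR hψR => ?_⟩
  have h1 := hW.integrable_comp hτ hφ hφR
  have h2 := hW.integrable_comp hτ hψ hψR
  have h3 : Integrable (fun x => φ x - ψ x) μ :=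
    (Integrable.of_bound hφ.aestronglyMeasurable R hφR).sub
      (Integrable.of_bound hψ.aestronglyMeasurable R hψR)
  have : ∫ x, W (τ x) (ψ x) ∂μ + η * μ.real Set.univ + K * ∫ x, ‖φ x - ψ x‖ ∂μ =
      ∫ x, (W (τ x) (ψ x) + η + K * ‖φ x - ψ x‖) ∂μ := by
    rw [integral_add (f := fun x => W (τ x) (ψ x) + η) (h2.add (integrable_const _))
      (h3.norm.const_mul K), integral_add h2 (integrable_const _), integral_const_mul, integral_const, smul_eq_mul,
      mul_comm η]
  rw [this]
  refine integral_mono_ae h1 ((h2.add (integrable_const _)).add (h3.norm.const_mul K)) ?_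
  filter_upwards [hφR, hψR] with x hx hx' using h _ _ _ hx hx'

end IsRegularIntegrand

/-! ### The cell problem and its infimum. -/

/-- A bounded measurable periodic function. -/
structure IsCellFunction (ψ : E N → E M) : Prop where
  measurable : Measurable ψ
  periodic : IsCubePeriodic ψ
  bounded : ∃ R, ∀ y, ‖ψ y‖ ≤ R

lemma IsCellFunction.const (p : E M) : IsCellFunction fun _ : E N => p :=
  ⟨measurable_const, fun _ _ => rfl, ‖p‖, fun _ => le_rfl⟩

lemma IsCellFunction.add_const {ψ : E N → E M} (hψ : IsCellFunction ψ) (p : E M) :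
    IsCellFunction fun y => ψ y + p := by
  obtain ⟨R, hR⟩ := hψ.bounded
  exact ⟨hψ.measurable.add_const p, fun x z => by rw [hψ.periodic], R + ‖p‖, fun y =>
    (norm_add_le _ _).trans (add_le_add_left (hR y) _)⟩

lemma IsCellFunction.integrable {ψ : E N → E M} (hψ : IsCellFunction ψ) (μ : Measure (E N))
    [IsFiniteMeasure μ] : Integrable ψ μ := by
  obtain ⟨R, hR⟩ := hψ.bounded
  exact Integrable.of_bound hψ.measurable.aestronglyMeasurable R (Eventually.of_forall hR)

lemma IsRegularIntegrand.integrable_cell (hW : IsRegularIntegrand W) {ψ : E N → E M}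
    (hψ : IsCellFunction ψ) (μ : Measure (E N)) [IsFiniteMeasure μ] :
    Integrable (fun y => W y (ψ y)) μ := by
  obtain ⟨R, hR⟩ := hψ.bounded
  exact hW.integrable_comp measurable_id hψ.measurable.aemeasurable (Eventually.of_forall hR)

lemma IsRegularIntegrand.periodic_comp (hW : IsRegularIntegrand W) {ψ : E N → E M}
    (hψ : IsCubePeriodic ψ) : IsCubePeriodic fun y => W y (ψ y) := by
  intro x z
  simp only [hψ x z]
  exact hW.periodic _ x z

/-- The average of a periodic function. -/
def cellMean (ψ : E N → E M) : E M := ∫ y in unitCube N, ψ y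

/-- The energy of a periodic function in the unit cell. -/
def cellEnergy (W : E N → E M → ℝ) (ψ : E N → E M) : ℝ := ∫ y in unitCube N, W y (ψ y)

/-- The least energy, in the unit cell, of a bounded periodic function with given average. -/
def relaxedPotential (W : E N → E M → ℝ) (p : E M) : ℝ :=
  sInf {t | ∃ ψ, IsCellFunction ψ ∧ cellMean ψ = p ∧ cellEnergy W ψ = t}

lemma cellMean_const (p : E M) : cellMean (fun _ : E N => p) = p := by
  simp [cellMean]

lemma IsRegularIntegrand.cellEnergy_nonneg (hW : IsRegularIntegrand W) (ψ : E N → E M) :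
    0 ≤ cellEnergy W ψ :=
  integral_nonneg fun _ => hW.nonneg _ _

lemma IsRegularIntegrand.relaxedPotential_le (hW : IsRegularIntegrand W) {ψ : E N → E M}
    (hψ : IsCellFunction ψ) : relaxedPotential W (cellMean ψ) ≤ cellEnergy W ψ :=
  csInf_le ⟨0, by rintro _ ⟨φ, -, -, rfl⟩; exact hW.cellEnergy_nonneg φ⟩ ⟨ψ, hψ, rfl, rfl⟩

lemma exists_cellEnergy_lt (W : E N → E M → ℝ) (p : E M) {η : ℝ} (hη : 0 < η) :
    ∃ ψ, IsCellFunction ψ ∧ cellMean ψ = p ∧ cellEnergy W ψ < relaxedPotential W p + η := by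
  obtain ⟨_, ⟨ψ, h1, h2, rfl⟩, h3⟩ := exists_lt_of_csInf_lt
    (⟨_, _, IsCellFunction.const p, cellMean_const p, rfl⟩ : Set.Nonempty
      {t | ∃ ψ : E N → E M, IsCellFunction ψ ∧ cellMean ψ = p ∧ cellEnergy W ψ = t})
    (lt_add_of_pos_right (relaxedPotential W p) hη)
  exact ⟨ψ, h1, h2, h3⟩

lemma IsRegularIntegrand.relaxedPotential_nonneg (hW : IsRegularIntegrand W) (p : E M) :
    0 ≤ relaxedPotential W p :=
  Real.sInf_nonneg (by rintro _ ⟨ψ, -, -, rfl⟩; exact hW.cellEnergy_nonneg ψ)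

lemma IsRegularIntegrand.exists_relaxedPotential_le (hW : IsRegularIntegrand W) :
    ∃ C > 0, ∀ p, relaxedPotential W p ≤ C * (1 + ‖p‖ ^ 2) := by
  obtain ⟨C, hC, h⟩ := hW.growth
  refine ⟨C, hC, fun p => ?_⟩
  have h1 := hW.relaxedPotential_le (IsCellFunction.const (N := N) p)
  rw [cellMean_const] at h1
  refine h1.trans ?_
  calc cellEnergy W (fun _ => p) ≤ ∫ _y in unitCube N, C * (1 + ‖p‖ ^ 2) :=
        integral_mono (hW.integrable_cell (IsCellFunction.const p) _) (integrable_const _)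
          fun y => (h y p).2
    _ = C * (1 + ‖p‖ ^ 2) := by simp

/-! ### Convexity of the relaxed potential -/

/-- In finite dimension, convergence of the pairings with the coordinate vectors is convergence.
Vector-valued limits below are deduced from scalar ones in this way. -/
lemma tendsto_of_forall_inner {ι : Type*} {l : Filter ι} {x : ι → E M} {x₀ : E M}
    (h : ∀ v, Tendsto (fun i => inner ℝ v (x i)) l (𝓝 (inner ℝ v x₀))) : Tendsto x l (𝓝 x₀) := by
  have h1 : Tendsto (fun i => (x i).ofLp) l (𝓝 x₀.ofLp) := by
    rw [tendsto_pi_nhds]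
    intro j
    simpa only [EuclideanSpace.inner_single_left, map_one, one_mul] using
      h (EuclideanSpace.single j 1)
  exact ((PiLp.continuous_toLp 2 _).tendsto _).comp h1

/-- The indicator function of a periodic laminate with volume fraction `t`. -/
def laminate (i : Fin N) (t : ℝ) (x : E N) : ℝ := if Int.fract (x i + 1 / 2) < t then 1 else 0

lemma laminate_measurable (i : Fin N) (t : ℝ) : Measurable (laminate i t) := by
  refine Measurable.ite (measurableSet_lt ?_ measurable_const) measurable_const measurable_const
  exact measurable_fract.comp (by fun_prop)

lemma laminate_periodic (i : Fin N) (t : ℝ) : IsCubePeriodic (laminate i t) := by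
  intro x z
  have : x i + (z i : ℝ) + 1 / 2 = x i + 1 / 2 + (z i : ℝ) := by ring
  simp only [laminate, PiLp.add_apply, latticePoint_apply, this, Int.fract_add_intCast]

lemma laminate_eq_zero_or_one (i : Fin N) (t : ℝ) (x : E N) :
    laminate i t x = 0 ∨ laminate i t x = 1 := by
  unfold laminate; split_ifs <;> simp

lemma abs_laminate_le (i : Fin N) (t : ℝ) (x : E N) : |laminate i t x| ≤ 1 := by
  rcases laminate_eq_zero_or_one i t x with h | h <;> simp [h]

/-- On `Q` the shift by 1/2 puts `y i + 1/2` in (0,1), where the fractional part is the identity;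
the laminate is there the indicator of a slab of width `t`. -/
lemma setIntegral_laminate (i : Fin N) {t : ℝ} (h0 : 0 ≤ t) (h1 : t ≤ 1) :
    ∫ y in unitCube N, laminate i t y = t := by
  classical
  let A : Set (E N) := (fun x : E N => x.ofLp) ⁻¹' (Set.univ.pi fun j =>
    Set.Ioo (-(1 / 2) : ℝ) (if j = i then t - 1 / 2 else 1 / 2))
  have hAm : MeasurableSet A := (PiLp.volume_preserving_ofLp (Fin N)).measurable
    (MeasurableSet.univ_pi fun _ => measurableSet_Ioo)
  have hA : ∀ y ∈ unitCube N, laminate i t y = A.indicator (fun _ => (1 : ℝ)) y := by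
    intro y hy
    have hf : Int.fract (y i + 1 / 2) = y i + 1 / 2 :=
      Int.fract_eq_self.2 ⟨by linarith [(hy i).1], by linarith [(hy i).2]⟩
    have : y ∈ A ↔ y i + 1 / 2 < t := by
      simp only [A, Set.mem_preimage, Set.mem_pi, Set.mem_univ, true_imp_iff]
      constructor
      · intro h
        have := (h i).2
        rw [if_pos rfl] at this
        linarith
      · intro h j
        refine ⟨(hy j).1, ?_⟩
        split_ifs with hj
        · subst hj; linarith
        · exact (hy j).2
    rw [laminate, hf, Set.indicator_apply]
    simp only [this]
  have hsub : A ∩ unitCube N = A := by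
    refine Set.inter_eq_left.2 fun y hy j => ?_
    have := hy j (Set.mem_univ j)
    refine ⟨this.1, this.2.trans_le ?_⟩
    split_ifs <;> linarith
  rw [setIntegral_congr_fun (measurableSet_unitCube N) hA, integral_indicator hAm,
    Measure.restrict_restrict hAm, hsub, setIntegral_const, smul_eq_mul, mul_one, Measure.real,
    (PiLp.volume_preserving_ofLp (Fin N)).measure_preimage
    (MeasurableSet.univ_pi fun _ => measurableSet_Ioo).nullMeasurableSet, Real.volume_pi_Ioo,
    ENNReal.toReal_prod, Finset.prod_eq_single i]
  · rw [if_pos rfl, ENNReal.toReal_ofReal (by linarith)]; ring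
  · intro j _ hj
    rw [if_neg hj]; norm_num
  · simp

/-- Convex combinations of periodic functions are reached, in average and in energy, by finely
laminated mixtures. -/
lemma tendsto_integral_laminate_mul (i : Fin N) {t : ℝ} (h0 : 0 ≤ t) (h1 : t ≤ 1) {f : E N → ℝ}
    (hf : IntegrableOn f (unitCube N)) :
    Tendsto (fun n : ℕ => ∫ y in unitCube N, laminate i t (((n : ℝ) + 1) • y) * f y) atTop
      (𝓝 (t * ∫ y in unitCube N, f y)) := by
  have hδ0 : Tendsto (fun n : ℕ => 1 / ((n : ℝ) + 1)) atTop (𝓝 0) :=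
    tendsto_one_div_add_atTop_nhds_zero_nat
  -- The laminate plays the oscillating function and `f`, extended by zero outside `Q`, the
  -- integrable test function.
  have h := tendsto_integral_inner_periodic (laminate_measurable i t).stronglyMeasurable
    (laminate_periodic i t) (abs_laminate_le i t) (hf.integrable_indicator (measurableSet_unitCube N))
    (fun n => by positivity) hδ0
  have hind : ∀ k : E N → ℝ, ∫ x, inner ℝ ((unitCube N).indicator f x) (k x) =
      ∫ x in unitCube N, k x * f x := by
    intro k
    rw [← integral_indicator (measurableSet_unitCube N)]
    congr 1 with x
    by_cases hx : x ∈ unitCube N <;> simp [hx]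
  simp only [hind, setIntegral_laminate i h0 h1, integral_const_mul] at h
  simpa using h

/-- The relaxed potential is convex. -/
theorem IsRegularIntegrand.convexOn_relaxedPotential (hN : 1 ≤ N) (hW : IsRegularIntegrand W) :
    ConvexOn ℝ Set.univ (relaxedPotential W) := by
  refine ⟨convex_univ, fun p _ q _ t s ht hs hts => ?_⟩
  refine le_of_forall_pos_le_add fun η hη => ?_
  obtain ⟨φ, hφ, rfl, hφE⟩ := exists_cellEnergy_lt W p (η := η / 2) (by positivity)
  obtain ⟨ψ, hψ, rfl, hψE⟩ := exists_cellEnergy_lt W q (η := η / 2) (by positivity)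
  obtain ⟨R₁, hR₁⟩ := hφ.bounded
  obtain ⟨R₂, hR₂⟩ := hψ.bounded
  obtain rfl : s = 1 - t := by linarith
  have ht1 : t ≤ 1 := by linarith
  let i : Fin N := ⟨0, hN⟩
  let θ : ℕ → E N → ℝ := fun n y => laminate i t (((n : ℝ) + 1) • y)
  -- Since `θ n` only takes the values 0 and 1, `χ n` is pointwise `φ` or `ψ`, and W(y, χ) is
  -- exactly θ W(y, φ) + (1 − θ) W(y, ψ): the energy is mixed without any convexity of `W`.
  let χ : ℕ → E N → E M := fun n y => θ n y • φ y + (1 - θ n y) • ψ y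
  have hθ01 : ∀ n y, θ n y = 0 ∨ θ n y = 1 := fun n y => laminate_eq_zero_or_one _ _ _
  have hθm : ∀ n, Measurable (θ n) := fun n =>
    (laminate_measurable i t).comp (measurable_const_smul _)
  have hθp : ∀ n, IsCubePeriodic (θ n) := by
    intro n x z
    -- The integer factor n + 1 maps the lattice into itself, so the refined laminate keeps the
    -- period of the cell.
    have : latticePoint (fun j => ((n : ℤ) + 1) * z j) = ((n : ℝ) + 1) • latticePoint z := by
      ext j; simp [latticePoint]
    simp only [θ, smul_add, ← this]
    exact laminate_periodic i t _ _
  have hχ : ∀ n, IsCellFunction (χ n) := by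
    intro n
    refine ⟨((hθm n).smul hφ.measurable).add ((measurable_const.sub (hθm n)).smul hψ.measurable),
      fun x z => ?_, max R₁ R₂, fun y => ?_⟩
    · simp only [χ, hθp n x z, hφ.periodic x z, hψ.periodic x z]
    · rcases hθ01 n y with h | h
      · simpa [χ, h] using Or.inr (hR₂ y)
      · simpa [χ, h] using Or.inl (hR₁ y)
  have hlim : ∀ {f g : E N → ℝ}, IntegrableOn f (unitCube N) → IntegrableOn g (unitCube N) →
      Tendsto (fun n => ∫ y in unitCube N, (θ n y * f y + (1 - θ n y) * g y)) atTop
        (𝓝 (t * (∫ y in unitCube N, f y) + (1 - t) * ∫ y in unitCube N, g y)) := by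
    intro f g hf hg
    have hi : ∀ n {k : E N → ℝ}, IntegrableOn k (unitCube N) →
        IntegrableOn (fun y => θ n y * k y) (unitCube N) := fun n k hk =>
      hk.bdd_mul (hθm n).aestronglyMeasurable (Eventually.of_forall fun y => abs_laminate_le _ _ _)
    have h1 := tendsto_integral_laminate_mul i ht ht1 hf
    have h2 := tendsto_integral_laminate_mul i ht ht1 hg
    convert h1.add ((tendsto_const_nhds (x := ∫ y in unitCube N, g y)).sub h2) using 2 with n
    · rw [← integral_sub hg (hi n hg)]
      refine Eq.trans ?_ (integral_add (hi n hf) (hg.sub (hi n hg)))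
      congr 1 with y
      simp only [θ]
      ring
    · ring
  have hmean : Tendsto (fun n => cellMean (χ n)) atTop
      (𝓝 (t • cellMean φ + (1 - t) • cellMean ψ)) := by
    refine tendsto_of_forall_inner fun v => ?_
    have h := hlim ((hφ.integrable _).const_inner v) ((hψ.integrable _).const_inner v)
    convert h using 2 with n
    · rw [cellMean, ← integral_inner ((hχ n).integrable _)]
      simp only [χ, inner_add_right, inner_smul_right]
    · rw [integral_inner (hφ.integrable _), integral_inner (hψ.integrable _), inner_add_right,
        inner_smul_right, inner_smul_right]
      rfl
  have henergy : Tendsto (fun n => cellEnergy W (χ n)) atTop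
      (𝓝 (t * cellEnergy W φ + (1 - t) * cellEnergy W ψ)) := by
    refine (hlim (hW.integrable_cell hφ _) (hW.integrable_cell hψ _)).congr fun n => ?_
    refine integral_congr_ae (Eventually.of_forall fun y => ?_)
    rcases hθ01 n y with h | h <;> simp [χ, h]
  obtain ⟨K, hK, hcomp⟩ := hW.integral_comp_le (max R₁ R₂ + 1) (η := η / 2) (by positivity)
  -- The laminate has the right mean only in the limit. Adding the constant `c n` makes the mean
  -- exact, at an energy cost of at most η/2 + K‖c n‖.
  set c : ℕ → E M := fun n => t • cellMean φ + (1 - t) • cellMean ψ - cellMean (χ n) with hc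
  have hc0 : Tendsto (fun n => ‖c n‖) atTop (𝓝 0) := by
    have := (tendsto_const_nhds (x := t • cellMean φ + (1 - t) • cellMean ψ)).sub hmean
    rw [sub_self] at this
    simpa using this.norm
  have hle : ∀ᶠ n in atTop, relaxedPotential W (t • cellMean φ + (1 - t) • cellMean ψ) ≤
      cellEnergy W (χ n) + η / 2 + K * ‖c n‖ := by
    filter_upwards [hc0.eventually (gt_mem_nhds zero_lt_one)] with n hn
    have hm : cellMean (fun y => χ n y + c n) = t • cellMean φ + (1 - t) • cellMean ψ := by
      rw [cellMean, integral_add ((hχ n).integrable _) (integrable_const _)]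
      simp [c, cellMean]
    have hbd : ∀ y, ‖χ n y‖ ≤ max R₁ R₂ := by
      intro y
      rcases hθ01 n y with h | h
      · simpa [χ, h] using Or.inr (hR₂ y)
      · simpa [χ, h] using Or.inl (hR₁ y)
    rw [← hm]
    refine (hW.relaxedPotential_le ((hχ n).add_const _)).trans ?_
    have := hcomp (volume.restrict (unitCube N)) id (fun y => χ n y + c n) (χ n) measurable_id
      ((hχ n).add_const _).measurable.aemeasurable (hχ n).measurable.aemeasurable
      (Eventually.of_forall fun y => (norm_add_le _ _).trans (add_le_add (hbd y) hn.le))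
      (Eventually.of_forall fun y => (hbd y).trans (by linarith))
    simpa [cellEnergy] using this
  have hfin := ge_of_tendsto ((henergy.add_const (η / 2)).add (hc0.const_mul K)) hle
  have e1 : t * cellEnergy W φ ≤ t * (relaxedPotential W (cellMean φ) + η / 2) :=
    mul_le_mul_of_nonneg_left hφE.le ht
  have e2 : (1 - t) * cellEnergy W ψ ≤ (1 - t) * (relaxedPotential W (cellMean ψ) + η / 2) :=
    mul_le_mul_of_nonneg_left hψE.le hs
  simp only [smul_eq_mul]
  linarith

lemma IsRegularIntegrand.continuous_relaxedPotential (hN : 1 ≤ N) (hW : IsRegularIntegrand W) :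
    Continuous (relaxedPotential W) :=
  (hW.convexOn_relaxedPotential hN).locallyLipschitz.continuous

end Relaxed

section Duality

variable {N M : ℕ} {W : E N → E M → ℝ}

/-! ### Duality -/

/-- The right side drops the negative part of `f`. Affine lower bounds, which may change sign, can
thus be compared with energies in [0, ∞]. -/
lemma ofReal_integral_le_lintegral {X : Type*} [MeasurableSpace X] {μ : Measure X} {f : X → ℝ}
    (hf : Integrable f μ) : ENNReal.ofReal (∫ x, f x ∂μ) ≤ ∫⁻ x, ENNReal.ofReal (f x) ∂μ := by
  rw [integral_eq_lintegral_pos_part_sub_lintegral_neg_part hf]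
  refine ENNReal.ofReal_le_of_le_toReal ?_
  exact sub_le_self _ ENNReal.toReal_nonneg

/-- The convex conjugate of `W y`. -/
def conjugate (W : E N → E M → ℝ) (y : E N) (ξ : E M) : ℝ :=
  ⨆ k : ℕ, (inner ℝ ξ (TopologicalSpace.denseSeq (E M) k) - W y (TopologicalSpace.denseSeq (E M) k))

/-- The average of the conjugate over the unit cell. -/
def meanConjugate (W : E N → E M → ℝ) (ξ : E M) : ℝ := ∫ y in unitCube N, conjugate W y ξ

namespace IsRegularIntegrand

/-- Young's inequality against the coercivity ‖q‖² ≤ C(1 + W). The bound is uniform in `y`, which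
makes the conjugate a bounded function on the cell. -/
lemma exists_inner_sub_le (hW : IsRegularIntegrand W) (ξ : E M) :
    ∃ C, ∀ y q, inner ℝ ξ q - W y q ≤ C := by
  obtain ⟨C, hC, h⟩ := hW.growth
  refine ⟨1 + C * ‖ξ‖ ^ 2, fun y q => ?_⟩
  have h1 := (h y q).1
  have h2 : inner ℝ ξ q ≤ ‖ξ‖ * ‖q‖ := real_inner_le_norm _ _
  have h3 : C * (‖ξ‖ * ‖q‖) ≤ C * (W y q + 1 + C * ‖ξ‖ ^ 2) := by
    nlinarith [sq_nonneg (C * ‖ξ‖ - ‖q‖), sq_nonneg (C * ‖ξ‖)]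
  have h4 := le_of_mul_le_mul_left h3 hC
  linarith

lemma bddAbove_conjugate (hW : IsRegularIntegrand W) (y : E N) (ξ : E M) :
    BddAbove (Set.range fun k : ℕ => inner ℝ ξ (TopologicalSpace.denseSeq (E M) k) -
      W y (TopologicalSpace.denseSeq (E M) k)) := by
  obtain ⟨C, hC⟩ := hW.exists_inner_sub_le ξ
  exact ⟨C, by rintro _ ⟨k, rfl⟩; exact hC _ _⟩

lemma inner_le_add_conjugate (hW : IsRegularIntegrand W) (y : E N) (ξ p : E M) :
    inner ℝ ξ p ≤ W y p + conjugate W y ξ := by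
  have hcl : IsClosed {p : E M | inner ℝ ξ p ≤ W y p + conjugate W y ξ} :=
    isClosed_le (by fun_prop) ((hW.continuous y).add continuous_const)
  have hsub : Set.range (TopologicalSpace.denseSeq (E M)) ⊆
      {p : E M | inner ℝ ξ p ≤ W y p + conjugate W y ξ} := by
    rintro _ ⟨k, rfl⟩
    have := le_ciSup (hW.bddAbove_conjugate y ξ) k
    simp only [Set.mem_ofPred_eq, conjugate]
    linarith
  exact hcl.closure_subset_iff.2 hsub (TopologicalSpace.denseRange_denseSeq (E M) p)

/-- The supremum defining `conjugate` is taken over a countable dense sequence so that measurability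
in `y` is immediate; continuity of `W y` recovers all other points, as in `inner_le_add_conjugate`.
-/
lemma conjugate_measurable (hW : IsRegularIntegrand W) (ξ : E M) :
    Measurable fun y => conjugate W y ξ :=
  Measurable.iSup fun _ => measurable_const.sub (hW.measurable _)

lemma conjugate_periodic (hW : IsRegularIntegrand W) (ξ : E M) :
    IsCubePeriodic fun y => conjugate W y ξ := by
  intro x z
  have h : ∀ p, W (x + latticePoint z) p = W x p := fun p => hW.periodic p x z
  simp only [conjugate, h]

lemma exists_conjugate_bound (hW : IsRegularIntegrand W) (ξ : E M) :
    ∃ C, ∀ y, |conjugate W y ξ| ≤ C := by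
  obtain ⟨C, hC⟩ := hW.exists_inner_sub_le ξ
  obtain ⟨B, hB⟩ := hW.exists_bound 0
  refine ⟨max C B, fun y => abs_le.2 ⟨?_, ?_⟩⟩
  · have h1 := hW.inner_le_add_conjugate y ξ 0
    have h2 := hB y 0 (by simp)
    rw [inner_zero_right] at h1
    linarith [le_abs_self (W y 0), le_max_right C B]
  · exact (ciSup_le fun k => hC _ _).trans (le_max_left _ _)

lemma integrable_conjugate (hW : IsRegularIntegrand W) (ξ : E M) (μ : Measure (E N))
    [IsFiniteMeasure μ] : Integrable (fun y => conjugate W y ξ) μ := by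
  obtain ⟨C, hC⟩ := hW.exists_conjugate_bound ξ
  exact Integrable.of_bound (hW.conjugate_measurable ξ).aestronglyMeasurable C
    (Eventually.of_forall hC)

/-- Weak duality: integrate the Fenchel–Young inequality along a near-optimal cell function of mean
`p`. -/
lemma inner_sub_meanConjugate_le (hW : IsRegularIntegrand W) (ξ p : E M) :
    inner ℝ ξ p - meanConjugate W ξ ≤ relaxedPotential W p := by
  refine le_of_forall_pos_le_add fun η hη => ?_
  obtain ⟨ψ, hψ, rfl, hE⟩ := exists_cellEnergy_lt W p hη
  refine le_trans ?_ hE.le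
  rw [cellMean, ← integral_inner (hψ.integrable _), meanConjugate,
    ← integral_sub ((hψ.integrable _).const_inner _) (hW.integrable_conjugate ξ _)]
  refine integral_mono (((hψ.integrable _).const_inner _).sub (hW.integrable_conjugate ξ _))
    (hW.integrable_cell hψ _) fun y => ?_
  have := hW.inner_le_add_conjugate y ξ (ψ y)
  simp only
  linarith

/-- Piecewise constant periodic functions along which `⟪ξ, ·⟫ - W y ·` increases to the
conjugate. -/
lemma exists_maximizing_sequence (hW : IsRegularIntegrand W) (ξ : E M) :
    ∃ ψ : ℕ → E N → E M, (∀ n, IsCellFunction (ψ n)) ∧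
      (∀ y, Monotone fun n => inner ℝ ξ (ψ n y) - W y (ψ n y)) ∧
      ∀ y, Tendsto (fun n => inner ℝ ξ (ψ n y) - W y (ψ n y)) atTop (𝓝 (conjugate W y ξ)) := by
  classical
  let q := TopologicalSpace.denseSeq (E M)
  let v : E N → E M → ℝ := fun y p => inner ℝ ξ p - W y p
  -- `ψ n y` is a best choice among the first n + 1 dense points, replaced only by a strictly better
  -- one. It takes finitely many values, hence is bounded, and the selection is measurable by
  -- construction.
  let ψ : ℕ → E N → E M := fun n => Nat.rec (fun _ => q 0)
    (fun k φ y => if v y (φ y) < v y (q (k + 1)) then q (k + 1) else φ y) n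
  have hs : ∀ k y, ψ (k + 1) y = if v y (ψ k y) < v y (q (k + 1)) then q (k + 1) else ψ k y :=
    fun _ _ => rfl
  have hvm : ∀ φ : E N → E M, Measurable φ → Measurable fun y => v y (φ y) := fun φ hφ =>
    (measurable_const.inner hφ).sub (hW.measurable_comp measurable_id hφ)
  have hcell : ∀ n, IsCellFunction (ψ n) := by
    intro n
    induction n with
    | zero => exact IsCellFunction.const (q 0)
    | succ k ih =>
      obtain ⟨R, hR⟩ := ih.bounded
      refine ⟨Measurable.ite (measurableSet_lt (hvm _ ih.measurable) (hvm _ measurable_const))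
        measurable_const ih.measurable, fun x z => ?_, max R ‖q (k + 1)‖, fun y => ?_⟩
      · have h : ∀ p, v (x + latticePoint z) p = v x p := fun p => by
          have := hW.periodic p x z
          simp only at this
          simp only [v, this]
        rw [hs, hs, ih.periodic x z, h, h]
      · rw [hs]
        split_ifs
        · exact le_max_right _ _
        · exact (hR y).trans (le_max_left _ _)
  have hmono : ∀ y, Monotone fun n => v y (ψ n y) := by
    refine fun y => monotone_nat_of_le_succ fun n => ?_
    rw [hs]
    split_ifs with h
    · exact h.le
    · exact le_rfl
  have hge : ∀ y k, v y (q k) ≤ v y (ψ k y) := by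
    intro y k
    cases k with
    | zero => exact le_rfl
    | succ k =>
      rw [hs]
      split_ifs with h
      · exact le_rfl
      · exact not_lt.1 h
  have hlub : ∀ y, IsLUB (Set.range fun n => v y (ψ n y)) (conjugate W y ξ) := by
    refine fun y => ⟨?_, fun b hb => ciSup_le fun k => (hge y k).trans (hb ⟨k, rfl⟩)⟩
    rintro _ ⟨n, rfl⟩
    have := hW.inner_le_add_conjugate y ξ (ψ n y)
    simp only [v]
    linarith
  exact ⟨ψ, hcell, hmono, fun y => tendsto_atTop_isLUB (hmono y) (hlub y)⟩

/-- The relaxed potential is the conjugate of the averaged conjugate. -/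
theorem exists_slope (hN : 1 ≤ N) (hW : IsRegularIntegrand W) (p : E M) {η : ℝ} (hη : 0 < η) :
    ∃ ξ : E M, relaxedPotential W p - η ≤ inner ℝ ξ p - meanConjugate W ξ := by
  obtain ⟨l, c, hle, heq⟩ := ConvexOn.exists_affine_le_of_lt (𝕜 := ℝ) (Set.mem_univ p)
    (sub_lt_self (relaxedPotential W p) hη) isClosed_univ
    ((hW.continuous_relaxedPotential hN).lowerSemicontinuous.lowerSemicontinuousOn _)
    (hW.convexOn_relaxedPotential hN)
  have hle' : ∀ q, l q + c ≤ relaxedPotential W q := fun q => hle ⟨q, Set.mem_univ q⟩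
  have heq' : l p + c = relaxedPotential W p - η := heq
  set ξ := (InnerProductSpace.toDual ℝ (E M)).symm l with hξ
  have hl : ∀ q, inner ℝ ξ q = l q := fun q => InnerProductSpace.toDual_symm_apply
  refine ⟨ξ, ?_⟩
  obtain ⟨ψ, hψ, hmono, hlim⟩ := hW.exists_maximizing_sequence ξ
  -- The affine function `l + c` lies below the relaxed potential. Tested on the mean of each cell
  -- function of the maximizing sequence, this bounds the integrals of ξ·ψ_n − W(y, ψ_n) by −c, and
  -- monotone convergence passes to the integral of the conjugate.
  suffices meanConjugate W ξ ≤ -c by rw [hl]; linarith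
  have hint : ∀ n, Integrable (fun y => inner ℝ ξ (ψ n y) - W y (ψ n y))
      (volume.restrict (unitCube N)) := fun n =>
    (((hψ n).integrable _).const_inner _).sub (hW.integrable_cell (hψ n) _)
  have hle : ∀ n, ∫ y in unitCube N, (inner ℝ ξ (ψ n y) - W y (ψ n y)) ≤ -c := by
    intro n
    rw [integral_sub (((hψ n).integrable _).const_inner _) (hW.integrable_cell (hψ n) _),
      integral_inner ((hψ n).integrable _)]
    have h1 := hW.relaxedPotential_le (hψ n)
    have h2 := hle' (cellMean (ψ n))
    rw [← hl] at h2
    simp only [cellMean, cellEnergy] at h1 h2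
    linarith
  exact le_of_tendsto' (integral_tendsto_of_tendsto_of_monotone hint
    (hW.integrable_conjugate ξ _) (Eventually.of_forall hmono) (Eventually.of_forall hlim)) hle

end IsRegularIntegrand

/-! ### Convex envelopes, and the identification of W^hom with the relaxed potential. -/

lemma convexEnvelope_le {f : E M → ℝ} (hf : ∀ q, 0 ≤ f q) (p : E M) : convexEnvelope f p ≤ f p := by
  have : Nonempty {h : E M → ℝ // ConvexOn ℝ Set.univ h ∧ ∀ q, h q ≤ f q} :=
    ⟨⟨fun _ => 0, convexOn_const 0 convex_univ, hf⟩⟩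
  exact ciSup_le fun h => h.2.2 p

lemma le_convexEnvelope {f h : E M → ℝ} (hh : ConvexOn ℝ Set.univ h) (hle : ∀ q, h q ≤ f q)
    (p : E M) : h p ≤ convexEnvelope f p :=
  le_ciSup (f := fun h : {h : E M → ℝ // ConvexOn ℝ Set.univ h ∧ ∀ q, h q ≤ f q} => h.1 p)
    ⟨f p, by rintro _ ⟨k, rfl⟩; exact k.2.2 p⟩ ⟨h, hh, hle⟩

/-- The homogenized potential coincides with the relaxed potential. -/
theorem IsRegularIntegrand.homogenizedPotential_eq (hN : 1 ≤ N) (hW : IsRegularIntegrand W)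
    (p : E M) : homogenizedPotential W p = ENNReal.ofReal (relaxedPotential W p) := by
  apply le_antisymm
  · refine ENNReal.le_of_forall_pos_le_add fun η hη _ => ?_
    obtain ⟨ψ, hψ, rfl, hE⟩ := exists_cellEnergy_lt W p (NNReal.coe_pos.2 hη)
    have hφ := hψ.add_const (-cellMean ψ)
    obtain ⟨R, hR⟩ := hφ.bounded
    have hL : MemLp (fun y => ψ y + -cellMean ψ) 2 (volume.restrict (unitCube N)) :=
      MemLp.of_bound hφ.measurable.aestronglyMeasurable R (Eventually.of_forall hR)
    have hae := hL.coeFn_toLp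
    have h0 : ∫ y in unitCube N, hL.toLp _ y = 0 := by
      rw [integral_congr_ae hae, integral_add (hψ.integrable _) (integrable_const _)]
      simp [cellMean]
    refine (iInf₂_le (hL.toLp _) h0).trans ?_
    calc ∫⁻ y in unitCube N, ENNReal.ofReal (convexEnvelope (W y) (cellMean ψ + hL.toLp _ y))
        ≤ ∫⁻ y in unitCube N, ENNReal.ofReal (W y (ψ y)) := by
          refine lintegral_mono_ae ?_
          filter_upwards [hae] with y hy
          rw [hy, add_comm (ψ y), add_neg_cancel_left]
          exact ENNReal.ofReal_le_ofReal (convexEnvelope_le (hW.nonneg y) _)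
      _ = ENNReal.ofReal (cellEnergy W ψ) :=
          (ofReal_integral_eq_lintegral_ofReal (hW.integrable_cell hψ _)
            (Eventually.of_forall fun y => hW.nonneg _ _)).symm
      _ ≤ ENNReal.ofReal (relaxedPotential W (cellMean ψ) + η) := ENNReal.ofReal_le_ofReal hE.le
      _ = _ := by
          rw [ENNReal.ofReal_add (hW.relaxedPotential_nonneg _) (NNReal.coe_nonneg η),
            ENNReal.ofReal_coe_nnreal]
  · refine le_iInf₂ fun φ hφ => ?_
    refine ENNReal.le_of_forall_pos_le_add fun η hη _ => ?_
    obtain ⟨ξ, hξ⟩ := hW.exists_slope hN p (NNReal.coe_pos.2 hη)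
    have hφi : Integrable φ (volume.restrict (unitCube N)) :=
      (Lp.memLp φ).integrable (by norm_num)
    have hi : Integrable (fun y => p + φ y) (volume.restrict (unitCube N)) :=
      (integrable_const p).add hφi
    have h1 : inner ℝ ξ p - meanConjugate W ξ =
        ∫ y in unitCube N, (inner ℝ ξ (p + φ y) - conjugate W y ξ) := by
      rw [integral_sub (hi.const_inner ξ) (hW.integrable_conjugate ξ _), integral_inner hi,
        integral_add (integrable_const p) hφi, hφ]
      simp [meanConjugate]
    have h2 : ENNReal.ofReal (inner ℝ ξ p - meanConjugate W ξ) ≤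
        ∫⁻ y in unitCube N, ENNReal.ofReal (convexEnvelope (W y) (p + φ y)) := by
      rw [h1]
      refine (ofReal_integral_le_lintegral ((hi.const_inner ξ).sub
        (hW.integrable_conjugate ξ _))).trans (lintegral_mono fun y => ENNReal.ofReal_le_ofReal ?_)
      -- This affine function is a convex minorant of `W y` by Fenchel–Young, hence lies below the
      -- envelope; `φ` has zero mean and disappears from the integral of the linear part.
      refine le_convexEnvelope (h := fun q => inner ℝ ξ q - conjugate W y ξ) ?_ (fun q => ?_) _
      · exact ((innerSL ℝ ξ).toLinearMap.convexOn convex_univ).sub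
          (concaveOn_const _ convex_univ)
      · have := hW.inner_le_add_conjugate y ξ q
        linarith
    calc ENNReal.ofReal (relaxedPotential W p)
        ≤ ENNReal.ofReal ((inner ℝ ξ p - meanConjugate W ξ) + η) :=
          ENNReal.ofReal_le_ofReal (by linarith)
      _ ≤ ENNReal.ofReal (inner ℝ ξ p - meanConjugate W ξ) + ENNReal.ofReal η :=
          ENNReal.ofReal_add_le
      _ ≤ _ := by rw [ENNReal.ofReal_coe_nnreal]; gcongr

end Duality

section LowerBound

variable {N M : ℕ} {W : E N → E M → ℝ}

/-! ### Weak convergence -/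

/-- Bounded sequences in a separable Hilbert space have weakly convergent subsequences. -/
lemma exists_weaklyConverges_subseq {H : Type*} [NormedAddCommGroup H] [InnerProductSpace ℝ H]
    [CompleteSpace H] [TopologicalSpace.SeparableSpace H] {u : ℕ → H} {R : ℝ}
    (hu : ∀ n, ‖u n‖ ≤ R) :
    ∃ (v : H) (s : ℕ → ℕ), StrictMono s ∧ WeaklyConverges (fun j => u (s j)) v := by
  have hmem : ∀ n, StrongDual.toWeakDual (InnerProductSpace.toDual ℝ H (u n)) ∈
      WeakDual.toStrongDual ⁻¹' Metric.closedBall (0 : StrongDual ℝ H) R := fun n => by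
    rw [Set.mem_preimage, mem_closedBall_zero_iff]
    exact ((InnerProductSpace.toDual ℝ H).norm_map (u n)).trans_le (hu n)
  obtain ⟨φ, -, s, hs, hlim⟩ := WeakDual.isSeqCompact_closedBall ℝ H (0 : StrongDual ℝ H) R hmem
  refine ⟨(InnerProductSpace.toDual ℝ H).symm (WeakDual.toStrongDual φ), s, hs, fun w => ?_⟩
  rw [InnerProductSpace.toDual_symm_apply]
  exact ((WeakDual.eval_continuous w).tendsto φ).comp hlim

lemma integrable_inner_of_memLp {X F : Type*} [MeasurableSpace X] {μ : Measure X}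
    [NormedAddCommGroup F] [InnerProductSpace ℝ F] {f g : X → F} (hf : MemLp f 2 μ)
    (hg : MemLp g 2 μ) : Integrable (fun x => inner ℝ (f x) (g x)) μ := by
  refine (L2.integrable_inner (𝕜 := ℝ) (hf.toLp f) (hg.toLp g)).congr ?_
  filter_upwards [hf.coeFn_toLp, hg.coeFn_toLp] with x h1 h2
  rw [h1, h2]

lemma inner_integral_eq_inner_const {Ω : Set (E N)} [IsFiniteMeasure ((volume : Measure (E N)).restrict Ω)]
    (u : VecL2 Ω M) (v : E M) :
    inner ℝ v (∫ x in Ω, u x) = inner ℝ u ((memLp_const v).toLp (fun _ : E N => v) : VecL2 Ω M) := by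
  have hu : Integrable u (volume.restrict Ω) := (Lp.memLp u).integrable (by norm_num)
  rw [← integral_inner hu, L2.inner_def]
  refine integral_congr_ae ?_
  filter_upwards [(memLp_const v : MemLp (fun _ : E N => v) 2 (volume.restrict Ω)).coeFn_toLp]
    with x hx
  rw [hx, real_inner_comm]

/-- Constants belong to L² because the measure is finite, so masses are pairings with fixed elements
of L² and the mass constraint is weakly closed. -/
lemma WeaklyConverges.tendsto_integral {Ω : Set (E N)}
    [IsFiniteMeasure ((volume : Measure (E N)).restrict Ω)] {u : ℕ → VecL2 Ω M} {v : VecL2 Ω M}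
    (h : WeaklyConverges u v) :
    Tendsto (fun n => ∫ x in Ω, u n x) atTop (𝓝 (∫ x in Ω, v x)) := by
  refine tendsto_of_forall_inner fun w => ?_
  simp only [inner_integral_eq_inner_const]
  exact h _

/-! ### Approximation by simple functions -/

/-- Approximation of square integrable functions by simple functions with the same integral. -/
lemma exists_simpleFunc_approx {X : Type*} [MeasurableSpace X] {μ : Measure X} [IsFiniteMeasure μ]
    {u : X → E M} (hu : MemLp u 2 μ) :
    ∃ s : ℕ → SimpleFunc X (E M), (∀ n, ∫ x, s n x ∂μ = ∫ x, u x ∂μ) ∧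
      (∃ C, ∀ᵐ x ∂μ, ∀ n, ‖s n x‖ ≤ 2 * ‖u x‖ + C) ∧
      ∀ᵐ x ∂μ, Tendsto (fun n => s n x) atTop (𝓝 (u x)) := by
  have hm : Measurable (hu.1.mk u) := hu.1.stronglyMeasurable_mk.measurable
  let t : ℕ → SimpleFunc X (E M) := SimpleFunc.approxOn (hu.1.mk u) hm Set.univ 0 (Set.mem_univ 0)
  have htb : ∀ᵐ x ∂μ, ∀ n, ‖t n x‖ ≤ 2 * ‖u x‖ := by
    filter_upwards [hu.1.ae_eq_mk] with x hx n
    rw [hx, two_mul]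
    exact SimpleFunc.norm_approxOn_zero_le hm (Set.mem_univ 0) x n
  have htl : ∀ᵐ x ∂μ, Tendsto (fun n => t n x) atTop (𝓝 (u x)) := by
    filter_upwards [hu.1.ae_eq_mk] with x hx
    rw [hx]
    exact SimpleFunc.tendsto_approxOn hm (Set.mem_univ 0) (by simp)
  have hui : Integrable u μ := hu.integrable (by norm_num)
  have hti : ∀ n, Integrable (t n) μ := fun n => SimpleFunc.integrable_of_isFiniteMeasure _
  have hint : Tendsto (fun n => ∫ x, t n x ∂μ) atTop (𝓝 (∫ x, u x ∂μ)) :=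
    tendsto_integral_of_dominated_convergence (fun x => 2 * ‖u x‖)
      (fun n => (t n).aestronglyMeasurable) (hui.norm.const_mul 2)
      (fun n => htb.mono fun x hx => hx n) htl
  -- The constant that restores the integral exactly. If the measure is zero, the inverse is 0 by
  -- convention and all integrals vanish.
  let c : ℕ → E M := fun n => (μ.real Set.univ)⁻¹ • (∫ x, u x ∂μ - ∫ x, t n x ∂μ)
  have hc : Tendsto c atTop (𝓝 0) := by
    have := ((tendsto_const_nhds (x := ∫ x, u x ∂μ)).sub hint).const_smul (μ.real Set.univ)⁻¹
    simpa using this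
  obtain ⟨C, hC⟩ := hc.norm.bddAbove_range
  refine ⟨fun n => t n + SimpleFunc.const X (c n), fun n => ?_, ⟨C, ?_⟩, ?_⟩
  · simp only [SimpleFunc.coe_add, SimpleFunc.coe_const, Pi.add_apply, Function.const_apply]
    rw [integral_add (hti n) (integrable_const _), integral_const]
    by_cases h0 : μ.real Set.univ = 0
    · have : μ = 0 := by
        rwa [measureReal_eq_zero_iff, Measure.measure_univ_eq_zero] at h0
      simp [this]
    · simp only [c, smul_inv_smul₀ h0]
      abel
  · filter_upwards [htb] with x hx n
    refine (norm_add_le _ _).trans (add_le_add (hx n) ?_)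
    exact hC ⟨n, rfl⟩
  · filter_upwards [htl] with x hx
    simpa using hx.add hc

/-- Convergence of integrals of functions of quadratic growth. -/
lemma tendsto_integral_of_quadratic_growth {X : Type*} [MeasurableSpace X] {μ : Measure X}
    [IsFiniteMeasure μ] {H : E M → ℝ} (hH : Continuous H) {C : ℝ}
    (hHC : ∀ p, |H p| ≤ C * (1 + ‖p‖ ^ 2)) {s : ℕ → X → E M} {u : X → E M} {g : X → ℝ}
    (hs : ∀ n, AEStronglyMeasurable (s n) μ) (hg : MemLp g 2 μ)
    (hb : ∀ᵐ x ∂μ, ∀ n, ‖s n x‖ ≤ g x)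
    (hl : ∀ᵐ x ∂μ, Tendsto (fun n => s n x) atTop (𝓝 (u x))) :
    Tendsto (fun n => ∫ x, H (s n x) ∂μ) atTop (𝓝 (∫ x, H (u x) ∂μ)) := by
  have hC0 : 0 ≤ C := by
    have := (abs_nonneg _).trans (hHC 0)
    simpa using this
  refine tendsto_integral_of_dominated_convergence (fun x => C * (1 + g x ^ 2))
    (fun n => hH.comp_aestronglyMeasurable (hs n))
    (((integrable_const 1).add hg.integrable_sq).const_mul C) (fun n => ?_) ?_
  · filter_upwards [hb] with x hx
    refine (hHC _).trans (mul_le_mul_of_nonneg_left ?_ hC0)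
    gcongr
    exact hx n
  · filter_upwards [hl] with x hx using (hH.tendsto _).comp hx

/-- Weak convergence of rescaled periodic functions depending on a parameter that takes finitely
many values. -/
theorem tendsto_integral_inner_simpleFunc {F α : Type*} [NormedAddCommGroup F]
    [InnerProductSpace ℝ F] [CompleteSpace F] {h : α → E N → F}
    (hm : ∀ v, StronglyMeasurable (h v)) (hp : ∀ v, IsCubePeriodic (h v))
    (hC : ∀ v, ∃ C, ∀ y, ‖h v y‖ ≤ C) {f : E N → F} (hf : Integrable f) (s : SimpleFunc (E N) α)
    {δ : ℕ → ℝ} (hδ : ∀ n, 0 < δ n) (hδ0 : Tendsto δ atTop (𝓝 0)) :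
    Tendsto (fun n => ∫ x, inner ℝ (f x) (h (s x) ((δ n)⁻¹ • x))) atTop
      (𝓝 (∫ x, inner ℝ (f x) (∫ y in unitCube N, h (s x) y))) := by
  classical
  have hfi : ∀ v, Integrable ((s ⁻¹' {v}).indicator f) := fun v =>
    hf.indicator (s.measurableSet_fiber v)
  -- On each fibre of `s` the parameter is constant, so the unparametrized limit applies with `f`
  -- cut off to that fibre.
  have hsum : ∀ k : α → E N → F, (∀ v, StronglyMeasurable (k v)) → (∀ v, ∃ C, ∀ y, ‖k v y‖ ≤ C) →
      ∫ x, inner ℝ (f x) (k (s x) x) =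
        ∑ v ∈ s.range, ∫ x, inner ℝ ((s ⁻¹' {v}).indicator f x) (k v x) := by
    intro k hk hkC
    rw [← integral_finsetSum]
    · refine integral_congr_ae (Eventually.of_forall fun x => ?_)
      simp only
      rw [Finset.sum_eq_single (s x)]
      · rw [Set.indicator_of_mem (show x ∈ s ⁻¹' {s x} from rfl)]
      · intro v _ hv
        rw [Set.indicator_of_notMem (fun hx => hv hx.symm), inner_zero_left]
      · exact fun hx => absurd (s.mem_range_self x) hx
    · intro v _
      obtain ⟨C, hC⟩ := hkC v
      refine ((hfi v).norm.mul_const C).mono'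
        ((hfi v).aestronglyMeasurable.inner (hk v).aestronglyMeasurable) ?_
      filter_upwards with x
      exact (norm_inner_le_norm _ _).trans (mul_le_mul_of_nonneg_left (hC x) (norm_nonneg _))
  have h1 : ∀ n, ∫ x, inner ℝ (f x) (h (s x) ((δ n)⁻¹ • x)) =
      ∑ v ∈ s.range, ∫ x, inner ℝ ((s ⁻¹' {v}).indicator f x) (h v ((δ n)⁻¹ • x)) := fun n =>
    hsum (fun v x => h v ((δ n)⁻¹ • x))
      (fun v => (hm v).comp_measurable (measurable_const_smul _)) fun v => by
        obtain ⟨C, hC⟩ := hC v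
        exact ⟨C, fun _ => hC _⟩
  simp only [h1]
  rw [hsum (fun v _ => ∫ y in unitCube N, h v y) (fun _ => stronglyMeasurable_const)
    (fun v => ⟨_, fun _ => le_rfl⟩)]
  refine tendsto_finsetSum _ fun v _ => ?_
  obtain ⟨C, hC⟩ := hC v
  exact tendsto_integral_inner_periodic (hm v) (hp v) hC (hfi v) hδ hδ0

lemma tendsto_setIntegral_simpleFunc {α : Type*} {h : α → E N → ℝ}
    (hm : ∀ v, Measurable (h v)) (hp : ∀ v, IsCubePeriodic (h v))
    (hC : ∀ v, ∃ C, ∀ y, |h v y| ≤ C) {A : Set (E N)} (hA : MeasurableSet A)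
    (hAfin : volume A ≠ ⊤) (s : SimpleFunc (E N) α)
    {δ : ℕ → ℝ} (hδ : ∀ n, 0 < δ n) (hδ0 : Tendsto δ atTop (𝓝 0)) :
    Tendsto (fun n => ∫ x in A, h (s x) ((δ n)⁻¹ • x)) atTop
      (𝓝 (∫ x in A, ∫ y in unitCube N, h (s x) y)) := by
  have hf : Integrable (A.indicator fun _ => (1 : ℝ)) (volume : Measure (E N)) :=
    (integrable_indicator_iff hA).2 (integrableOn_const hAfin)
  have := tendsto_integral_inner_simpleFunc (fun v => (hm v).stronglyMeasurable) hp hC hf s hδ hδ0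
  have hind : ∀ k : E N → ℝ, ∫ x, inner ℝ (A.indicator (fun _ => (1 : ℝ)) x) (k x) =
      ∫ x in A, k x := by
    intro k
    rw [← integral_indicator hA]
    congr 1 with x
    by_cases hx : x ∈ A <;> simp [hx]
  simpa only [hind] using this

/-! ### The lower bound -/

/-- The lower bound for the energy without gradient term, along weakly converging sequences. -/
theorem IsRegularIntegrand.le_liminf_lintegral (hN : 1 ≤ N) (hW : IsRegularIntegrand W)
    {Ω : Set (E N)} (hΩ : MeasurableSet Ω) (hΩfin : volume Ω ≠ ⊤) {δ : ℕ → ℝ}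
    (hδ : ∀ n, 0 < δ n) (hδ0 : Tendsto δ atTop (𝓝 0)) {u : ℕ → VecL2 Ω M} {v : VecL2 Ω M}
    (huv : WeaklyConverges u v) :
    ENNReal.ofReal (∫ x in Ω, relaxedPotential W (v x)) ≤
      liminf (fun n => ∫⁻ x in Ω, ENNReal.ofReal (W ((δ n)⁻¹ • x) (u n x))) atTop := by
  have hfin : IsFiniteMeasure ((volume : Measure (E N)).restrict Ω) :=
    isFiniteMeasure_restrict.2 hΩfin
  set H := relaxedPotential W with hH
  set μ := (volume : Measure (E N)).restrict Ω with hμ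
  obtain ⟨C, hC, hHC⟩ := hW.exists_relaxedPotential_le
  have hHabs : ∀ p, |H p| ≤ C * (1 + ‖p‖ ^ 2) := fun p => by
    rw [abs_of_nonneg (hW.relaxedPotential_nonneg p)]; exact hHC p
  have hHc : Continuous H := hW.continuous_relaxedPotential hN
  have hv := Lp.memLp v
  have hHint : ∀ {w : E N → E M}, MemLp w 2 μ → Integrable (fun x => H (w x)) μ := fun {w} hw =>
    (((integrable_const (1 : ℝ)).add hw.norm.integrable_sq).const_mul C).mono'
      (hHc.comp_aestronglyMeasurable hw.1) (Eventually.of_forall fun x => hHabs _)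
  -- the bound given by a simple function
  have key : ∀ (s : SimpleFunc (E N) (E M)) (η : ℝ), 0 < η →
      ENNReal.ofReal (2 * ∫ x, H (s x) ∂μ - ∫ x, H ((2 : ℝ) • s x - v x) ∂μ -
        2 * η * μ.real Set.univ) ≤
      liminf (fun n => ∫⁻ x, ENNReal.ofReal (W ((δ n)⁻¹ • x) (u n x)) ∂μ) atTop := by
    intro s η hη
    choose ξ hξ using fun p => hW.exists_slope hN p hη
    -- A field of slopes, almost optimal at the values of `s`. Being simple, it is an admissible
    -- test function, and its conjugate term is a finite sum of rescaled periodic functions.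
    let Ξ : SimpleFunc (E N) (E M) := s.map ξ
    have hΞ : MemLp Ξ 2 μ := SimpleFunc.memLp_of_isFiniteMeasure Ξ 2 μ
    have hs : MemLp s 2 μ := SimpleFunc.memLp_of_isFiniteMeasure s 2 μ
    have hinner : ∀ w : VecL2 Ω M, Integrable (fun x => inner ℝ (Ξ x) (w x)) μ := fun w =>
      integrable_inner_of_memLp hΞ (Lp.memLp w)
    have hsimple : ∀ {β : Type} (k : E M → ℝ), Integrable (fun x => k (Ξ x)) μ := fun k =>
      SimpleFunc.integrable_of_isFiniteMeasure (Ξ.map k)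
    have hcm : ∀ n, Measurable fun x => conjugate W ((δ n)⁻¹ • x) (Ξ x) := by
      intro n
      exact Ξ.measurable_bind (fun p x => conjugate W ((δ n)⁻¹ • x) p) fun p =>
        (hW.conjugate_measurable p).comp (measurable_const_smul _)
    have hci : ∀ n, Integrable (fun x => conjugate W ((δ n)⁻¹ • x) (Ξ x)) μ := by
      intro n
      choose B hB using fun p => hW.exists_conjugate_bound p
      refine (SimpleFunc.integrable_of_isFiniteMeasure (μ := μ) (Ξ.map B)).mono'
        (hcm n).aestronglyMeasurable (Eventually.of_forall fun x => ?_)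
      exact hB _ _
    have h1 : Tendsto (fun n => ∫ x, inner ℝ (Ξ x) (u n x) ∂μ) atTop
        (𝓝 (∫ x, inner ℝ (Ξ x) (v x) ∂μ)) := by
      have heq : ∀ w : VecL2 Ω M, ∫ x, inner ℝ (Ξ x) (w x) ∂μ = inner ℝ w (hΞ.toLp Ξ) := by
        intro w
        rw [L2.inner_def]
        refine integral_congr_ae ?_
        filter_upwards [hΞ.coeFn_toLp] with x hx
        rw [hx, real_inner_comm]
      simp only [heq]
      exact huv _
    have h2 : Tendsto (fun n => ∫ x, conjugate W ((δ n)⁻¹ • x) (Ξ x) ∂μ) atTop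
        (𝓝 (∫ x, meanConjugate W (Ξ x) ∂μ)) :=
      tendsto_setIntegral_simpleFunc (h := fun p y => conjugate W y p) hW.conjugate_measurable
        hW.conjugate_periodic hW.exists_conjugate_bound hΩ hΩfin Ξ hδ hδ0
    have h3 : ∀ n, ENNReal.ofReal (∫ x, inner ℝ (Ξ x) (u n x) ∂μ -
        ∫ x, conjugate W ((δ n)⁻¹ • x) (Ξ x) ∂μ) ≤
        ∫⁻ x, ENNReal.ofReal (W ((δ n)⁻¹ • x) (u n x)) ∂μ := by
      intro n
      rw [← integral_sub (hinner _) (hci n)]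
      refine (ofReal_integral_le_lintegral ((hinner _).sub (hci n))).trans
        (lintegral_mono fun x => ENNReal.ofReal_le_ofReal ?_)
      have := hW.inner_le_add_conjugate ((δ n)⁻¹ • x) (Ξ x) (u n x)
      simp only [Pi.sub_apply]
      linarith
    have h4 : Tendsto (fun n => ENNReal.ofReal (∫ x, inner ℝ (Ξ x) (u n x) ∂μ -
        ∫ x, conjugate W ((δ n)⁻¹ • x) (Ξ x) ∂μ)) atTop
        (𝓝 (ENNReal.ofReal (∫ x, inner ℝ (Ξ x) (v x) ∂μ - ∫ x, meanConjugate W (Ξ x) ∂μ))) :=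
      ENNReal.tendsto_ofReal (h1.sub h2)
    refine le_trans ?_ (h4.liminf_eq.ge.trans (liminf_le_liminf (Eventually.of_forall h3)))
    refine ENNReal.ofReal_le_ofReal ?_
    have hGi : Integrable (fun x => meanConjugate W (Ξ x)) μ := hsimple (β := ℝ) _
    have hi2 : Integrable (fun x => H ((2 : ℝ) • s x - v x)) μ :=
      hHint ((hs.const_smul (2 : ℝ)).sub hv)
    have e : 2 * ∫ x, H (s x) ∂μ - ∫ x, H ((2 : ℝ) • s x - v x) ∂μ - 2 * η * μ.real Set.univ =
        ∫ x, (2 * H (s x) - H ((2 : ℝ) • s x - v x) - 2 * η) ∂μ := by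
      rw [integral_sub (f := fun x => 2 * H (s x) - H ((2 : ℝ) • s x - v x))
        (((hHint hs).const_mul 2).sub hi2) (integrable_const _),
        integral_sub ((hHint hs).const_mul 2) hi2, integral_const_mul, integral_const, smul_eq_mul,
        mul_comm (μ.real Set.univ)]
    rw [e, ← integral_sub (hinner _) hGi]
    refine integral_mono ((((hHint hs).const_mul 2).sub hi2).sub (integrable_const _))
      ((hinner _).sub hGi) fun x => ?_
    -- The slopes are optimal at `s`, but the limit involves `v`. Since v = 2s − (2s − v),
    -- near-optimality at `s` and weak duality at the reflected point 2s − v give Ξ·v − W* ≥ 2H(s) −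
    -- 2η − H(2s − v), with W* averaged over the cell. No bound on Ξ is needed, and the right side
    -- tends to H(v) as s → v and η → 0.
    have a1 : H (s x) - η ≤ inner ℝ (Ξ x) (s x) - meanConjugate W (Ξ x) := hξ (s x)
    have a2 := hW.inner_sub_meanConjugate_le (Ξ x) ((2 : ℝ) • s x - v x)
    rw [inner_sub_right, inner_smul_right] at a2
    simp only
    linarith
  -- approximation
  obtain ⟨s, -, ⟨B, hB⟩, hsl⟩ := exists_simpleFunc_approx hv
  have hl1 : Tendsto (fun j => ∫ x, H (s j x) ∂μ) atTop (𝓝 (∫ x, H (v x) ∂μ)) :=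
    tendsto_integral_of_quadratic_growth hHc hHabs (fun n => (s n).aestronglyMeasurable)
      ((hv.norm.const_mul 2).add (memLp_const B)) hB hsl
  have hl2 : Tendsto (fun j => ∫ x, H ((2 : ℝ) • s j x - v x) ∂μ) atTop (𝓝 (∫ x, H (v x) ∂μ)) := by
    refine tendsto_integral_of_quadratic_growth (g := fun x => 2 * (2 * ‖v x‖ + B) + ‖v x‖) hHc hHabs
      (fun n => ((s n).aestronglyMeasurable.const_smul (2 : ℝ)).sub hv.1)
      ((((hv.norm.const_mul 2).add (memLp_const B)).const_mul 2).add hv.norm) ?_ ?_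
    · filter_upwards [hB] with x hx n
      refine (norm_sub_le _ _).trans (add_le_add_left ?_ _)
      rw [norm_smul, Real.norm_ofNat]
      exact mul_le_mul_of_nonneg_left (hx n) zero_le_two
    · filter_upwards [hsl] with x hx
      have := (hx.const_smul (2 : ℝ)).sub_const (v x)
      rwa [two_smul, add_sub_cancel_right] at this
  have hl3 : Tendsto (fun j : ℕ => 2 * ∫ x, H (s j x) ∂μ - ∫ x, H ((2 : ℝ) • s j x - v x) ∂μ -
      2 * (1 / ((j : ℝ) + 1)) * μ.real Set.univ) atTop (𝓝 (∫ x, H (v x) ∂μ)) := by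
    have := ((hl1.const_mul 2).sub hl2).sub
      ((tendsto_one_div_add_atTop_nhds_zero_nat (𝕜 := ℝ).const_mul 2).mul_const (μ.real Set.univ))
    convert this using 2
    ring
  exact le_of_tendsto' (ENNReal.tendsto_ofReal hl3) fun j => key (s j) _ (by positivity)

end LowerBound

section Smoothing

variable {N M : ℕ} {W : E N → E M → ℝ}

/-! ### Smooth approximation -/

/-- Subtracting the nearest lattice point brings any point into a fixed compact ball, where
continuity bounds the function. -/
lemma IsCubePeriodic.exists_bound_of_continuous {F : Type*} [NormedAddCommGroup F] {f : E N → F}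
    (hf : IsCubePeriodic f) (hc : Continuous f) : ∃ L, ∀ x, ‖f x‖ ≤ L := by
  obtain ⟨L, hL⟩ := (isCompact_closedBall (0 : E N) N).exists_bound_of_continuousOn hc.continuousOn
  refine ⟨L, fun x => ?_⟩
  let z : Fin N → ℤ := fun i => -round (x i)
  rw [← hf x z]
  refine hL _ (mem_closedBall_zero_iff.2 ?_)
  calc ‖x + latticePoint z‖ ≤ ∑ i, ‖(x + latticePoint z) i‖ := by
        rw [EuclideanSpace.norm_eq]
        refine Real.sqrt_le_iff.2 ⟨by positivity, ?_⟩
        exact Finset.sum_sq_le_sq_sum_of_nonneg fun i _ => norm_nonneg _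
    _ ≤ ∑ _i : Fin N, (1 : ℝ) := by
        refine Finset.sum_le_sum fun i _ => ?_
        have := abs_sub_round (x i)
        rw [PiLp.add_apply, latticePoint_apply, Real.norm_eq_abs]
        simp only [z, Int.cast_neg, ← sub_eq_add_neg]
        linarith
    _ = N := by simp

/-- Mollification of a bounded function. -/
lemma exists_contDiff_tendsto {F : Type*} [NormedAddCommGroup F] [NormedSpace ℝ F]
    [CompleteSpace F] {f : E N → F} (hf : StronglyMeasurable f) {R : ℝ} (hR : ∀ x, ‖f x‖ ≤ R) :
    ∃ g : ℕ → E N → F, (∀ n, ContDiff ℝ ∞ (g n)) ∧ (∀ n x, ‖g n x‖ ≤ R) ∧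
      (IsCubePeriodic f → ∀ n, IsCubePeriodic (g n)) ∧
      ∀ᵐ x, Tendsto (fun n => g n x) atTop (𝓝 (f x)) := by
  let φ : ℕ → ContDiffBump (0 : E N) := fun n =>
    -- The ratio of outer to inner radius stays equal to 2; a bounded ratio is what gives
    -- convergence at Lebesgue points.
    ⟨1 / ((n : ℝ) + 1) / 2, 1 / ((n : ℝ) + 1), by positivity, half_lt_self (by positivity)⟩
  have hfl : LocallyIntegrable f (volume : Measure (E N)) := by
    refine (locallyIntegrable_const R).mono hf.aestronglyMeasurable (Eventually.of_forall fun x => ?_)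
    exact (hR x).trans (le_abs_self R)
  refine ⟨fun n => convolution ((φ n).normed volume) f (ContinuousLinearMap.lsmul ℝ ℝ) volume,
    fun n => ?_, fun n x => ?_, fun hp n x z => ?_, ?_⟩
  · exact (φ n).hasCompactSupport_normed.contDiff_convolution_left _ (φ n).contDiff_normed hfl
  · have hint : Integrable ((φ n).normed (volume : Measure (E N))) :=
      (φ n).integrable_normed
    calc ‖∫ t, (φ n).normed volume t • f (x - t)‖ ≤ ∫ t, (φ n).normed volume t * R := by
          refine norm_integral_le_of_norm_le (hint.mul_const R) (Eventually.of_forall fun t => ?_)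
          rw [norm_smul, Real.norm_of_nonneg ((φ n).nonneg_normed t)]
          exact mul_le_mul_of_nonneg_left (hR _) ((φ n).nonneg_normed t)
      _ = R := by rw [integral_mul_const, (φ n).integral_normed, one_mul]
  · simp only [convolution, add_sub_right_comm x (latticePoint z)]
    refine integral_congr_ae (Eventually.of_forall fun t => ?_)
    simp only [hp (x - t) z]
  · refine ContDiffBump.ae_convolution_tendsto_right_of_locallyIntegrable (K := 2) ?_
      (Eventually.of_forall fun n => ?_) hfl
    · exact tendsto_one_div_add_atTop_nhds_zero_nat
    · change 1 / ((n : ℝ) + 1) ≤ 2 * (1 / ((n : ℝ) + 1) / 2)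
      linarith

lemma exists_contDiff_integral_le {F : Type*} [NormedAddCommGroup F] [NormedSpace ℝ F]
    [CompleteSpace F] {f : E N → F} (hf : StronglyMeasurable f) {R : ℝ} (hR : ∀ x, ‖f x‖ ≤ R)
    {A : Set (E N)} (hA : volume A ≠ ⊤) {η : ℝ} (hη : 0 < η) :
    ∃ g : E N → F, ContDiff ℝ ∞ g ∧ (∀ x, ‖g x‖ ≤ R) ∧ (IsCubePeriodic f → IsCubePeriodic g) ∧
      ∫ x in A, ‖g x - f x‖ ≤ η := by
  have hfin : IsFiniteMeasure ((volume : Measure (E N)).restrict A) := isFiniteMeasure_restrict.2 hA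
  obtain ⟨g, hg, hgR, hgp, hlim⟩ := exists_contDiff_tendsto hf hR
  have h : Tendsto (fun n => ∫ x in A, ‖g n x - f x‖) atTop (𝓝 (∫ _x in A, (0 : ℝ))) := by
    refine tendsto_integral_of_dominated_convergence (fun _ => R + R) (fun n => ?_)
      (integrable_const _) (fun n => Eventually.of_forall fun x => ?_) ?_
    · exact ((hg n).continuous.aestronglyMeasurable.sub hf.aestronglyMeasurable).norm
    · rw [norm_norm]
      exact (norm_sub_le _ _).trans (add_le_add (hgR n x) (hR x))
    · filter_upwards [ae_restrict_of_ae hlim] with x hx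
      simpa using (hx.sub_const (f x)).norm
  rw [integral_zero] at h
  obtain ⟨n, hn⟩ := (h.eventually (ge_mem_nhds hη)).exists
  exact ⟨g n, hg n, hgR n, fun hp => hgp hp n, hn⟩

/-- Smooth approximation of a rescaled periodic function cut off by a measurable set. -/
lemma exists_smooth_indicator_cell {Ω : Set (E N)} (hΩ : MeasurableSet Ω)
    (hΩb : Bornology.IsBounded Ω) {A : Set (E N)} (hA : MeasurableSet A) {ψ : E N → E M}
    (hψ : IsCellFunction ψ) {R : ℝ} (hR : ∀ y, ‖ψ y‖ ≤ R) {δ : ℕ → ℝ} (hδ : ∀ n, 0 < δ n)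
    (hδ0 : Tendsto δ atTop (𝓝 0)) {η : ℝ} (hη : 0 < η) :
    ∃ L ≥ 0, ∀ᶠ n in atTop, ∃ v : E N → E M, ContDiff ℝ ∞ v ∧ (∀ x, ‖v x‖ ≤ R) ∧
      (∀ x ∈ Ω, ‖fderiv ℝ v x‖ ≤ L / δ n) ∧
      ∫ x in Ω, ‖v x - A.indicator (fun x => ψ ((δ n)⁻¹ • x)) x‖ ≤ η := by
  have hΩfin : volume Ω ≠ ⊤ := hΩb.measure_lt_top.ne
  have hfin : IsFiniteMeasure ((volume : Measure (E N)).restrict Ω) :=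
    isFiniteMeasure_restrict.2 hΩfin
  have hR0 : 0 ≤ R := (norm_nonneg _).trans (hR 0)
  have hχm : StronglyMeasurable (A.indicator fun _ => (1 : ℝ)) :=
    stronglyMeasurable_const.indicator hA
  have hχ1 : ∀ x, ‖A.indicator (fun _ => (1 : ℝ)) x‖ ≤ 1 := fun x => by
    by_cases hx : x ∈ A <;> simp [hx]
  obtain ⟨χ, hχ, hχb, -, hχi⟩ := exists_contDiff_integral_le hχm hχ1 hΩfin
    (η := η / (2 * (R + 1))) (by positivity)
  obtain ⟨φ, hφ, hφR, hφp, hφi⟩ := exists_contDiff_integral_le hψ.measurable.stronglyMeasurable hR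
    (A := unitCube N) (by simp [volume_unitCube]) (η := η / (4 * (volume.real Ω + 1))) (by positivity)
  have hφp := hφp hψ.periodic
  have hdp : IsCubePeriodic (fderiv ℝ φ) := by
    intro x z
    rw [← fderiv_comp_add_right]
    congr 1
    exact funext fun y => hφp y z
  obtain ⟨L₁, hL₁⟩ := hdp.exists_bound_of_continuous (hφ.continuous_fderiv (by simp))
  obtain ⟨L₀, hL₀⟩ := hΩb.isCompact_closure.exists_bound_of_continuousOn
    (hχ.continuous_fderiv (by simp)).continuousOn
  -- The mollification `φ` is chosen once, in the cell. The error after rescaling converges to |Ω|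
  -- times the cell error, so it is small for all large `n` while the bounds on the derivatives of
  -- `φ` and `χ` do not depend on `n`.
  have hRL : Tendsto (fun n => ∫ x in Ω, ‖φ ((δ n)⁻¹ • x) - ψ ((δ n)⁻¹ • x)‖) atTop
      (𝓝 (volume.real Ω * ∫ y in unitCube N, ‖φ y - ψ y‖)) := by
    refine tendsto_setIntegral_periodic (h := fun y => ‖φ y - ψ y‖) (C := R + R)
      (hφ.continuous.measurable.sub hψ.measurable).norm (fun x z => ?_) (fun y => ?_) hΩ hΩfin hδ hδ0
    · simp only [hφp x z, hψ.periodic x z]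
    · rw [abs_norm]
      exact (norm_sub_le _ _).trans (add_le_add (hφR y) (hR y))
  have hlt : volume.real Ω * ∫ y in unitCube N, ‖φ y - ψ y‖ < η / 2 := by
    have h1 : volume.real Ω * ∫ y in unitCube N, ‖φ y - ψ y‖ ≤
        volume.real Ω * (η / (4 * (volume.real Ω + 1))) :=
      mul_le_mul_of_nonneg_left hφi measureReal_nonneg
    refine h1.trans_lt ?_
    rw [mul_div_assoc', div_lt_div_iff₀ (by positivity) (by positivity)]
    nlinarith [measureReal_nonneg (μ := (volume : Measure (E N))) (s := Ω)]
  refine ⟨|L₁| + R * |L₀|, by positivity, ?_⟩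
  filter_upwards [hRL.eventually (gt_mem_nhds hlt), hδ0.eventually (gt_mem_nhds zero_lt_one)]
    with n hn hn1
  have hφd : ContDiff ℝ ∞ fun x => φ ((δ n)⁻¹ • x) := hφ.comp (contDiff_const_smul _)
  -- The factor `φ` contributes |L₁|/δ to the gradient; the cutoff contributes R|L₀|, which is
  -- absorbed in R|L₀|/δ because δ < 1.
  refine ⟨fun x => χ x • φ ((δ n)⁻¹ • x), hχ.smul hφd, fun x => ?_, fun x hx => ?_, ?_⟩
  · rw [norm_smul]
    calc ‖χ x‖ * ‖φ ((δ n)⁻¹ • x)‖ ≤ 1 * R :=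
          mul_le_mul (hχb x) (hφR _) (norm_nonneg _) zero_le_one
      _ = R := one_mul R
  · rw [fderiv_fun_smul ((hχ.differentiable (by simp)) x) ((hφd.differentiable (by simp)) x),
      fderiv_comp_smul]
    refine (norm_add_le _ _).trans ?_
    rw [norm_smul, norm_smul, ContinuousLinearMap.norm_smulRight_apply, Real.norm_of_nonneg
      (inv_nonneg.2 (hδ n).le), add_div]
    refine add_le_add ?_ ?_
    · calc ‖χ x‖ * ((δ n)⁻¹ * ‖fderiv ℝ φ ((δ n)⁻¹ • x)‖)
          ≤ 1 * ((δ n)⁻¹ * |L₁|) := by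
            refine mul_le_mul (hχb x) ?_ (mul_nonneg (inv_nonneg.2 (hδ n).le) (norm_nonneg _))
              zero_le_one
            exact mul_le_mul_of_nonneg_left ((hL₁ _).trans (le_abs_self _)) (inv_nonneg.2 (hδ n).le)
        _ = |L₁| / δ n := by rw [one_mul, div_eq_inv_mul]
    · calc ‖fderiv ℝ χ x‖ * ‖φ ((δ n)⁻¹ • x)‖ ≤ |L₀| * R :=
            mul_le_mul ((hL₀ x (subset_closure hx)).trans (le_abs_self _)) (hφR _) (norm_nonneg _)
              (abs_nonneg _)
        _ = R * |L₀| := mul_comm _ _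
        _ ≤ R * |L₀| / δ n := le_div_self (by positivity) (hδ n) hn1.le
  · have hi1 : Integrable (fun x => ‖χ x - A.indicator (fun _ => (1 : ℝ)) x‖)
        (volume.restrict Ω) :=
      Integrable.of_bound (hχ.continuous.aestronglyMeasurable.sub
        hχm.aestronglyMeasurable).norm (1 + 1) (Eventually.of_forall fun x => by
          rw [norm_norm]; exact (norm_sub_le _ _).trans (add_le_add (hχb x) (hχ1 x)))
    have hi2 : Integrable (fun x => ‖φ ((δ n)⁻¹ • x) - ψ ((δ n)⁻¹ • x)‖) (volume.restrict Ω) :=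
      Integrable.of_bound (((hφ.continuous.measurable.sub hψ.measurable).comp
        (measurable_const_smul _)).norm.aestronglyMeasurable) (R + R) (Eventually.of_forall fun x => by
          rw [norm_norm]; exact (norm_sub_le _ _).trans (add_le_add (hφR _) (hR _)))
    calc ∫ x in Ω, ‖χ x • φ ((δ n)⁻¹ • x) - A.indicator (fun x => ψ ((δ n)⁻¹ • x)) x‖
        ≤ ∫ x in Ω, (R * ‖χ x - A.indicator (fun _ => (1 : ℝ)) x‖ +
            ‖φ ((δ n)⁻¹ • x) - ψ ((δ n)⁻¹ • x)‖) := by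
          refine integral_mono_of_nonneg (Eventually.of_forall fun x => norm_nonneg _)
            ((hi1.const_mul R).add hi2) (Eventually.of_forall fun x => ?_)
          have e : A.indicator (fun x => ψ ((δ n)⁻¹ • x)) x =
              A.indicator (fun _ => (1 : ℝ)) x • ψ ((δ n)⁻¹ • x) := by
            by_cases hx : x ∈ A <;> simp [hx]
          have e2 : χ x • φ ((δ n)⁻¹ • x) - A.indicator (fun _ => (1 : ℝ)) x • ψ ((δ n)⁻¹ • x) =
              (χ x - A.indicator (fun _ => (1 : ℝ)) x) • φ ((δ n)⁻¹ • x) +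
              A.indicator (fun _ => (1 : ℝ)) x • (φ ((δ n)⁻¹ • x) - ψ ((δ n)⁻¹ • x)) := by
            rw [sub_smul, smul_sub]; abel
          simp only
          rw [e, e2]
          refine (norm_add_le _ _).trans (add_le_add ?_ ?_)
          · rw [norm_smul, mul_comm]
            exact mul_le_mul_of_nonneg_right (hφR _) (norm_nonneg _)
          · rw [norm_smul]
            exact mul_le_of_le_one_left (norm_nonneg _) (hχ1 x)
      _ = R * (∫ x in Ω, ‖χ x - A.indicator (fun _ => (1 : ℝ)) x‖) +
            ∫ x in Ω, ‖φ ((δ n)⁻¹ • x) - ψ ((δ n)⁻¹ • x)‖ := by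
          rw [integral_add (hi1.const_mul R) hi2, integral_const_mul]
      _ ≤ R * (η / (2 * (R + 1))) + η / 2 :=
          add_le_add (mul_le_mul_of_nonneg_left hχi hR0) hn.le
      _ ≤ η := by
          have : R * (η / (2 * (R + 1))) ≤ η / 2 := by
            rw [mul_div_assoc', div_le_div_iff₀ (by positivity) (by positivity)]
            nlinarith
          linarith

/-- Smooth approximation of `ψ_{s(x)}(x/δ)`, for a simple function `s` and periodic functions
`ψ_p`. -/
lemma exists_smooth_simpleFunc_cell {Ω : Set (E N)} (hΩ : MeasurableSet Ω)
    (hΩb : Bornology.IsBounded Ω) {α : Type*} (s : SimpleFunc (E N) α) {ψ : α → E N → E M}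
    (hψ : ∀ p, IsCellFunction (ψ p)) {δ : ℕ → ℝ} (hδ : ∀ n, 0 < δ n)
    (hδ0 : Tendsto δ atTop (𝓝 0)) :
    ∃ R, (∀ x y, ‖ψ (s x) y‖ ≤ R) ∧ ∀ η > 0, ∃ L ≥ 0, ∀ᶠ n in atTop, ∃ v : E N → E M,
      ContDiff ℝ ∞ v ∧ (∀ x, ‖v x‖ ≤ R) ∧ (∀ x ∈ Ω, ‖fderiv ℝ v x‖ ≤ L / δ n) ∧
      ∫ x in Ω, ‖v x - ψ (s x) ((δ n)⁻¹ • x)‖ ≤ η := by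
  classical
  have hfin : IsFiniteMeasure ((volume : Measure (E N)).restrict Ω) :=
    isFiniteMeasure_restrict.2 hΩb.measure_lt_top.ne
  choose R hR using fun p => (hψ p).bounded
  have hR0 : ∀ p, 0 ≤ R p := fun p => (norm_nonneg _).trans (hR p 0)
  -- A sum and not a maximum, since the smoothed pieces overlap. The bound is fixed before `η`: only
  -- the Lipschitz constant `L` depends on the accuracy of the smoothing.
  refine ⟨∑ p ∈ s.range, R p, fun x y => (hR _ _).trans
    (Finset.single_le_sum (f := R) (fun p _ => hR0 p) (s.mem_range_self x)), fun η hη => ?_⟩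
  have hη' : 0 < η / (s.range.card + 1) := by positivity
  choose L hL0 hL using fun p => exists_smooth_indicator_cell hΩ hΩb (s.measurableSet_fiber p)
    (hψ p) (hR p) hδ hδ0 hη'
  refine ⟨∑ p ∈ s.range, L p, Finset.sum_nonneg fun p _ => hL0 p, ?_⟩
  filter_upwards [(Finset.eventually_all s.range).2 fun p _ => hL p] with n hn
  choose! v hv hvR hvL hvi using hn
  refine ⟨fun x => ∑ p ∈ s.range, v p x, ContDiff.sum fun p hp => hv p hp, fun x =>
    (norm_sum_le _ _).trans (Finset.sum_le_sum fun p hp => hvR p hp x), fun x hx => ?_, ?_⟩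
  · rw [fderiv_fun_sum fun p hp => ((hv p hp).differentiable (by simp)) x, Finset.sum_div]
    exact (norm_sum_le _ _).trans (Finset.sum_le_sum fun p hp => hvL p hp x hx)
  · have hsum : ∀ x, ψ (s x) ((δ n)⁻¹ • x) =
        ∑ p ∈ s.range, (s ⁻¹' {p}).indicator (fun x => ψ p ((δ n)⁻¹ • x)) x := by
      intro x
      rw [Finset.sum_eq_single (s x)]
      · rw [Set.indicator_of_mem (show x ∈ s ⁻¹' {s x} from rfl)]
      · exact fun p _ hp => Set.indicator_of_notMem (fun hx => hp hx.symm) _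
      · exact fun hx => absurd (s.mem_range_self x) hx
    have hi : ∀ p ∈ s.range, Integrable (fun x => ‖v p x -
        (s ⁻¹' {p}).indicator (fun x => ψ p ((δ n)⁻¹ • x)) x‖) (volume.restrict Ω) := by
      intro p hp
      refine Integrable.norm (Integrable.of_bound ?_ (R p + R p) (Eventually.of_forall fun x => ?_))
      · exact (hv p hp).continuous.aestronglyMeasurable.sub
          ((((hψ p).measurable.comp (measurable_const_smul _)).indicator
            (s.measurableSet_fiber p)).aestronglyMeasurable)
      · refine (norm_sub_le _ _).trans (add_le_add (hvR p hp x) ?_)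
        exact (norm_indicator_le_norm_self _ _).trans (hR _ _)
    calc ∫ x in Ω, ‖∑ p ∈ s.range, v p x - ψ (s x) ((δ n)⁻¹ • x)‖
        ≤ ∫ x in Ω, ∑ p ∈ s.range, ‖v p x -
            (s ⁻¹' {p}).indicator (fun x => ψ p ((δ n)⁻¹ • x)) x‖ := by
          refine integral_mono_of_nonneg (Eventually.of_forall fun x => norm_nonneg _)
            (integrable_finsetSum _ hi) (Eventually.of_forall fun x => ?_)
          simp only
          rw [hsum, ← Finset.sum_sub_distrib]
          exact norm_sum_le _ _
      _ = ∑ p ∈ s.range, ∫ x in Ω, ‖v p x -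
            (s ⁻¹' {p}).indicator (fun x => ψ p ((δ n)⁻¹ • x)) x‖ := integral_finsetSum _ hi
      _ ≤ ∑ _p ∈ s.range, η / (s.range.card + 1) := Finset.sum_le_sum fun p hp => hvi p hp
      _ ≤ η := by
          rw [Finset.sum_const, nsmul_eq_mul, mul_div_assoc', div_le_iff₀ (by positivity)]
          nlinarith

/-! ### The energy of smooth functions -/

/-- An upper bound for the energy of a smooth function. -/
lemma IsRegularIntegrand.exists_energy_le (hW : IsRegularIntegrand W) {Ω : Set (E N)}
    (hΩ : IsOpen Ω) (hΩfin : volume Ω ≠ ⊤) {v : E N → E M} (hv : ContDiff ℝ ∞ v) {R L : ℝ}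
    (hR : ∀ x, ‖v x‖ ≤ R) (hL : ∀ x ∈ Ω, ‖fderiv ℝ v x‖ ≤ L) (ε δ : ℝ) :
    ∃ u : VecL2 Ω M, u =ᵐ[volume.restrict Ω] v ∧ energy W Ω ε δ u ≤
      ENNReal.ofReal ((∫ x in Ω, W (δ⁻¹ • x) (v x)) + ε ^ 2 * (N * L ^ 2) * volume.real Ω) := by
  have hfin : IsFiniteMeasure ((volume : Measure (E N)).restrict Ω) :=
    isFiniteMeasure_restrict.2 hΩfin
  have hvm : MemLp v 2 (volume.restrict Ω) :=
    MemLp.of_bound hv.continuous.aestronglyMeasurable R (Eventually.of_forall hR)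
  have hdv : ∀ e : E N, Continuous fun x => fderiv ℝ v x e := fun e =>
    (hv.continuous_fderiv (by simp)).clm_apply continuous_const
  have hdb : ∀ j : Fin N, ∀ᵐ x ∂(volume.restrict Ω),
      ‖fderiv ℝ v x (EuclideanSpace.single j 1)‖ ≤ L := by
    intro j
    filter_upwards [ae_restrict_mem hΩ.measurableSet] with x hx
    refine (ContinuousLinearMap.le_opNorm _ _).trans ?_
    simpa using hL x hx
  have hgm : ∀ j : Fin N, MemLp (fun x => fderiv ℝ v x (EuclideanSpace.single j 1)) 2
      (volume.restrict Ω) := fun j => MemLp.of_bound (hdv _).aestronglyMeasurable L (hdb j)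
  have hgrad : IsWeakGradient (hvm.toLp v) fun j => (hgm j).toLp _ := by
    intro φ hφ hφc hφΩ j
    have hφz : ∀ x, x ∉ Ω → φ x = 0 := fun x hx => image_eq_zero_of_notMem_tsupport
      fun h => hx (hφΩ h)
    have hdφz : ∀ x, x ∉ Ω → fderiv ℝ φ x (EuclideanSpace.single j 1) = 0 := fun x hx => by
      rw [image_eq_zero_of_notMem_tsupport (f := fderiv ℝ φ)
        fun h => hx (hφΩ (tsupport_fderiv_subset ℝ h)), zero_apply]
    have hdφ : Continuous fun x => fderiv ℝ φ x (EuclideanSpace.single j 1) :=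
      (hφ.continuous_fderiv (by simp)).clm_apply continuous_const
    have hdφc : HasCompactSupport fun x => fderiv ℝ φ x (EuclideanSpace.single j 1) :=
      hφc.fderiv_apply ℝ _
    -- The test function is supported in Ω and `v` is smooth on the whole space, so the integration
    -- by parts takes place in ℝ^N and no boundary term of Ω appears.
    have e1 : ∫ x in Ω, fderiv ℝ φ x (EuclideanSpace.single j 1) • hvm.toLp v x =
        ∫ x, fderiv ℝ φ x (EuclideanSpace.single j 1) • v x := by
      refine Eq.trans (integral_congr_ae ?_) (setIntegral_eq_integral_of_forall_compl_eq_zero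
        (s := Ω) fun x hx => by rw [hdφz x hx, zero_smul])
      filter_upwards [hvm.coeFn_toLp] with x hx
      rw [hx]
    have e2 : ∫ x in Ω, φ x • (hgm j).toLp _ x =
        ∫ x, φ x • fderiv ℝ v x (EuclideanSpace.single j 1) := by
      refine Eq.trans (integral_congr_ae ?_) (setIntegral_eq_integral_of_forall_compl_eq_zero
        (s := Ω) fun x hx => by rw [hφz x hx, zero_smul])
      filter_upwards [(hgm j).coeFn_toLp] with x hx
      rw [hx]
    rw [e1, e2, integral_smul_fderiv_eq_neg_fderiv_smul_of_integrable, neg_neg]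
    · exact (hdφ.smul hv.continuous).integrable_of_hasCompactSupport hdφc.smul_right
    · exact (hφ.continuous.smul (hdv _)).integrable_of_hasCompactSupport hφc.smul_right
    · exact (hφ.continuous.smul hv.continuous).integrable_of_hasCompactSupport hφc.smul_right
    · exact fun x _ => (hφ.differentiable (by simp)) x
    · exact fun x _ => (hv.differentiable (by simp)) x
  refine ⟨hvm.toLp v, hvm.coeFn_toLp, (iInf₂_le _ hgrad).trans ?_⟩
  have hWi : Integrable (fun x => W (δ⁻¹ • x) (v x)) (volume.restrict Ω) :=
    hW.integrable_comp (measurable_const_smul _) hv.continuous.aemeasurable (Eventually.of_forall hR)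
  have e : (∫ x in Ω, W (δ⁻¹ • x) (v x)) + ε ^ 2 * (N * L ^ 2) * volume.real Ω =
      ∫ x in Ω, (W (δ⁻¹ • x) (v x) + ε ^ 2 * (N * L ^ 2)) := by
    rw [integral_add hWi (integrable_const _), setIntegral_const, smul_eq_mul, mul_comm (volume.real Ω)]
  rw [e, ofReal_integral_eq_lintegral_ofReal (f := fun x => W (δ⁻¹ • x) (v x) + ε ^ 2 * (N * L ^ 2))
    (hWi.add (integrable_const _))
    (Eventually.of_forall fun x => add_nonneg (hW.nonneg _ _) (by positivity))]
  refine lintegral_mono_ae ?_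
  have hall : ∀ᵐ x ∂(volume.restrict Ω), ∀ j, ‖(hgm j).toLp _ x‖ ≤ L := by
    rw [ae_all_iff]
    intro j
    filter_upwards [(hgm j).coeFn_toLp, hdb j] with x h1 h2
    rwa [h1]
  filter_upwards [hvm.coeFn_toLp, hall] with x hx hx2
  rw [hx]
  refine ENNReal.ofReal_le_ofReal (add_le_add_right (mul_le_mul_of_nonneg_left ?_ (sq_nonneg ε)) _)
  calc ∑ j, ‖(hgm j).toLp _ x‖ ^ 2 ≤ ∑ _j : Fin N, L ^ 2 :=
        Finset.sum_le_sum fun j _ => pow_le_pow_left₀ (norm_nonneg _) (hx2 j) 2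
    _ = N * L ^ 2 := by simp

end Smoothing

section UpperBound

variable {N M : ℕ} {W : E N → E M → ℝ}

/-! ### The upper bound -/

lemma norm_sq_eq_integral {Ω : Set (E N)} (u : VecL2 Ω M) : ‖u‖ ^ 2 = ∫ x in Ω, ‖u x‖ ^ 2 := by
  rw [← real_inner_self_eq_norm_sq, L2.inner_def]
  simp only [real_inner_self_eq_norm_sq]

/-- The pairing of a bounded function with a square integrable one is small if the bounded function
is small in `L¹`. -/
lemma abs_integral_inner_le {Ω : Set (E N)} [IsFiniteMeasure ((volume : Measure (E N)).restrict Ω)]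
    {f : E N → E M} (hf : AEStronglyMeasurable f (volume.restrict Ω)) {B : ℝ}
    (hB : ∀ᵐ x ∂(volume.restrict Ω), ‖f x‖ ≤ B) (w : VecL2 Ω M) {η : ℝ} (hη : 0 ≤ η)
    (h : (B * ∫ x in Ω, ‖f x‖) * ‖w‖ ^ 2 ≤ η ^ 2) :
    |∫ x in Ω, inner ℝ (f x) (w x)| ≤ η := by
  have hfm : MemLp f 2 (volume.restrict Ω) := MemLp.of_bound hf B hB
  have h1 : ∫ x in Ω, inner ℝ (f x) (w x) = inner ℝ (hfm.toLp f) w := by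
    rw [L2.inner_def]
    refine integral_congr_ae ?_
    filter_upwards [hfm.coeFn_toLp] with x hx
    rw [hx]
  -- Interpolation: the squared L² norm is at most the L^∞ bound times the L¹ norm.
  have h2 : ‖hfm.toLp f‖ ^ 2 ≤ B * ∫ x in Ω, ‖f x‖ := by
    rw [norm_sq_eq_integral, ← integral_const_mul]
    refine integral_mono_of_nonneg (Eventually.of_forall fun x => sq_nonneg _)
      ((hfm.integrable (by norm_num)).norm.const_mul B) ?_
    filter_upwards [hfm.coeFn_toLp, hB] with x hx hx2
    rw [hx, sq]
    exact mul_le_mul_of_nonneg_right hx2 (norm_nonneg _)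
  rw [h1]
  refine (abs_real_inner_le_norm _ _).trans (abs_le_of_sq_le_sq' ?_ hη).2
  rw [mul_pow]
  exact (mul_le_mul_of_nonneg_right h2 (sq_nonneg _)).trans h

/-- Recovery of a simple function, up to a small error. -/
theorem IsRegularIntegrand.exists_recovery_simpleFunc (hW : IsRegularIntegrand W)
    {Ω : Set (E N)} (hΩ : IsOpen Ω) (hΩb : Bornology.IsBounded Ω) {ε δ : ℕ → ℝ}
    (hδ : ∀ n, 0 < δ n) (hδ0 : Tendsto δ atTop (𝓝 0))
    (hεδ : Tendsto (fun n => ε n / δ n) atTop (𝓝 0)) (s : SimpleFunc (E N) (E M))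
    (hHi : IntegrableOn (fun x => relaxedPotential W (s x)) Ω)
    (S : Finset (VecL2 Ω M)) {η : ℝ} (hη : 0 < η) :
    ∀ᶠ n in atTop, ∃ v : VecL2 Ω M, ∫ x in Ω, v x = ∫ x in Ω, s x ∧
      energy W Ω (ε n) (δ n) v ≤ ENNReal.ofReal ((∫ x in Ω, relaxedPotential W (s x)) + η) ∧
      ∀ w ∈ S, |inner ℝ v w - ∫ x in Ω, inner ℝ (s x) (w x)| ≤ η := by
  have hΩfin : volume Ω ≠ ⊤ := hΩb.measure_lt_top.ne
  have hfin : IsFiniteMeasure ((volume : Measure (E N)).restrict Ω) :=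
    isFiniteMeasure_restrict.2 hΩfin
  have hΩm := hΩ.measurableSet
  set V := volume.real Ω with hV
  have hV0 : 0 ≤ V := measureReal_nonneg
  -- The energy budget is η/4 for the cell problems, η/4 for the additive term of the modulus, η/8
  -- for its linear term, η/8 for the convergence of the oscillating energy and η/4 for the
  -- gradient. The `+ 1` covers V = 0.
  set η₀ := η / (4 * (V + 1)) with hη₀
  have hη₀pos : 0 < η₀ := by positivity
  have hη₀V : η₀ * V ≤ η / 4 := by
    rw [hη₀, div_mul_eq_mul_div, div_le_div_iff₀ (by positivity) (by positivity)]
    nlinarith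
  have hη₀le : η₀ ≤ η / 4 := by
    rw [hη₀]
    exact div_le_div_of_nonneg_left hη.le (by positivity) (by linarith)
  choose ψ hψ hψm hψE using fun p => exists_cellEnergy_lt W p hη₀pos
  obtain ⟨R, hR, hsm⟩ := exists_smooth_simpleFunc_cell hΩm hΩb s hψ hδ hδ0
  have hR0 : 0 ≤ R := (norm_nonneg _).trans (hR 0 0)
  obtain ⟨K, hK, hcomp⟩ := hW.integral_comp_le (R + 1) hη₀pos
  set B := R + 1 + R with hB
  -- the limits of the piecewise periodic functions
  set v₀ : ℕ → E N → E M := fun n x => ψ (s x) ((δ n)⁻¹ • x) with hv₀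
  have hv₀m : ∀ n, Measurable (v₀ n) := fun n =>
    s.measurable_bind (fun p x => ψ p ((δ n)⁻¹ • x)) fun p =>
      (hψ p).measurable.comp (measurable_const_smul _)
  have hv₀R : ∀ n x, ‖v₀ n x‖ ≤ R := fun n x => hR _ _
  have hv₀i : ∀ n, Integrable (v₀ n) (volume.restrict Ω) := fun n =>
    Integrable.of_bound (hv₀m n).aestronglyMeasurable R (Eventually.of_forall (hv₀R n))
  have hpair : ∀ f : E N → E M, IntegrableOn f Ω →
      Tendsto (fun n => ∫ x in Ω, inner ℝ (f x) (v₀ n x)) atTop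
        (𝓝 (∫ x in Ω, inner ℝ (f x) (s x))) := by
    intro f hf
    have h := tendsto_integral_inner_simpleFunc (fun p => (hψ p).measurable.stronglyMeasurable)
      (fun p => (hψ p).periodic) (fun p => (hψ p).bounded) (hf.integrable_indicator hΩm) s hδ hδ0
    have hind : ∀ k : E N → E M, ∫ x, inner ℝ (Ω.indicator f x) (k x) =
        ∫ x in Ω, inner ℝ (f x) (k x) := by
      intro k
      rw [← integral_indicator hΩm]
      congr 1 with x
      by_cases hx : x ∈ Ω <;> simp [hx]
    have hψm' : ∀ p, ∫ y in unitCube N, ψ p y = p := hψm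
    simpa only [hind, hψm'] using h
  have hmean : Tendsto (fun n => ∫ x in Ω, v₀ n x) atTop (𝓝 (∫ x in Ω, s x)) := by
    refine tendsto_of_forall_inner fun w => ?_
    have h := hpair (fun _ => w) (integrableOn_const hΩfin)
    have hsi : Integrable s (volume.restrict Ω) := SimpleFunc.integrable_of_isFiniteMeasure s
    simpa only [integral_inner (hv₀i _), integral_inner hsi] using h
  have hen : Tendsto (fun n => ∫ x in Ω, W ((δ n)⁻¹ • x) (v₀ n x)) atTop
      (𝓝 (∫ x in Ω, cellEnergy W (ψ (s x)))) := by
    have h := tendsto_setIntegral_simpleFunc (h := fun p y => W y (ψ p y))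
      (fun p => hW.measurable_comp measurable_id (hψ p).measurable)
      (fun p => hW.periodic_comp (hψ p).periodic)
      (fun p => by
        obtain ⟨R', hR'⟩ := (hψ p).bounded
        obtain ⟨C, hC⟩ := hW.exists_bound R'
        exact ⟨C, fun y => hC y _ (hR' y)⟩) hΩm hΩfin s hδ hδ0
    exact h
  have hcell : ∫ x in Ω, cellEnergy W (ψ (s x)) ≤
      (∫ x in Ω, relaxedPotential W (s x)) + η₀ * V := by
    have hi : Integrable (fun x => cellEnergy W (ψ (s x))) (volume.restrict Ω) :=
      SimpleFunc.integrable_of_isFiniteMeasure (s.map fun p => cellEnergy W (ψ p))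
    calc ∫ x in Ω, cellEnergy W (ψ (s x)) ≤ ∫ x in Ω, (relaxedPotential W (s x) + η₀) :=
          integral_mono hi (hHi.add (integrable_const _)) fun x => (hψE (s x)).le
      _ = _ := by
          rw [integral_add hHi (integrable_const _), setIntegral_const, smul_eq_mul, mul_comm V]
  -- the choice of the smoothing parameter
  obtain ⟨Λ, hΛ0, hΛ⟩ : ∃ Λ ≥ 0, ∀ w ∈ S, ‖w‖ ^ 2 ≤ Λ :=
    ⟨∑ w ∈ S, ‖w‖ ^ 2, Finset.sum_nonneg fun w _ => sq_nonneg _, fun w hw =>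
      Finset.single_le_sum (f := fun w : VecL2 Ω M => ‖w‖ ^ 2) (fun w _ => sq_nonneg _) hw⟩
  -- Three demands on the L¹ error of the smoothing: the mass correction has norm at most 1, the
  -- change of energy is at most η/8, and the change of the pairings with `S` is at most η/2. The
  -- factor 3 counts one η₁ for the smoothing and two for the correction.
  obtain ⟨η₁, hη₁, hη₁V, hη₁K, hη₁Λ⟩ : ∃ η₁ > 0, 2 * η₁ * V⁻¹ ≤ 1 ∧ K * (3 * η₁) ≤ η / 8 ∧
      (B * (3 * η₁)) * Λ ≤ (η / 2) ^ 2 := by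
    refine ⟨min (1 / (2 * (V⁻¹ + 1))) (min (η / (24 * (K + 1))) ((η / 2) ^ 2 / (3 * B * Λ + 1))),
      by positivity, ?_, ?_, ?_⟩
    · have h := min_le_left (1 / (2 * (V⁻¹ + 1)))
        (min (η / (24 * (K + 1))) ((η / 2) ^ 2 / (3 * B * Λ + 1)))
      set t := min (1 / (2 * (V⁻¹ + 1))) (min (η / (24 * (K + 1))) ((η / 2) ^ 2 / (3 * B * Λ + 1)))
      have ht : 0 ≤ t := by positivity
      rw [le_div_iff₀ (by positivity)] at h
      nlinarith
    · have h := (min_le_right (1 / (2 * (V⁻¹ + 1))) _).trans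
        (min_le_left (η / (24 * (K + 1))) ((η / 2) ^ 2 / (3 * B * Λ + 1)))
      set t := min (1 / (2 * (V⁻¹ + 1))) (min (η / (24 * (K + 1))) ((η / 2) ^ 2 / (3 * B * Λ + 1)))
      have ht : 0 ≤ t := by positivity
      rw [le_div_iff₀ (by positivity)] at h
      nlinarith
    · have h := (min_le_right (1 / (2 * (V⁻¹ + 1))) _).trans
        (min_le_right (η / (24 * (K + 1))) ((η / 2) ^ 2 / (3 * B * Λ + 1)))
      set t := min (1 / (2 * (V⁻¹ + 1))) (min (η / (24 * (K + 1))) ((η / 2) ^ 2 / (3 * B * Λ + 1)))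
      have ht : 0 ≤ t := by positivity
      rw [le_div_iff₀ (by positivity)] at h
      nlinarith
  obtain ⟨L, hL0, hL⟩ := hsm η₁ hη₁
  -- With `L` fixed, the singular term is a constant times (ε/δ)²; this is where ε is required to be
  -- small compared with δ.
  have hgrad : Tendsto (fun n => ε n ^ 2 * (N * (L / δ n) ^ 2) * V) atTop (𝓝 0) := by
    have h := ((hεδ.pow 2).const_mul (N * L ^ 2 * V))
    rw [zero_pow two_ne_zero, mul_zero] at h
    refine h.congr fun n => ?_
    rw [div_pow, div_pow]
    ring
  have hev : ∀ᶠ n in atTop, ∀ w ∈ S, |(∫ x in Ω, inner ℝ (w x) (v₀ n x)) -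
      ∫ x in Ω, inner ℝ (w x) (s x)| ≤ η / 2 := by
    refine (Finset.eventually_all S).2 fun w _ => ?_
    have h := hpair w ((Lp.memLp w).integrable (by norm_num))
    have := (h.sub_const (∫ x in Ω, inner ℝ (w x) (s x))).abs
    rw [sub_self, abs_zero] at this
    exact this.eventually (ge_mem_nhds (by positivity))
  have hev2 : ∀ᶠ n in atTop, ‖(∫ x in Ω, s x) - ∫ x in Ω, v₀ n x‖ ≤ η₁ := by
    have h := ((tendsto_const_nhds (x := ∫ x in Ω, s x)).sub hmean).norm
    rw [sub_self, norm_zero] at h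
    exact h.eventually (ge_mem_nhds hη₁)
  have hev3 : ∀ᶠ n in atTop, ∫ x in Ω, W ((δ n)⁻¹ • x) (v₀ n x) ≤
      (∫ x in Ω, cellEnergy W (ψ (s x))) + η / 8 :=
    hen.eventually (ge_mem_nhds (by linarith))
  filter_upwards [hL, hev, hev2, hev3, hgrad.eventually (ge_mem_nhds (show 0 < η / 4 by positivity))]
    with n ⟨v, hv, hvR, hvL, hvi⟩ h1 h2 h3 h4
  have hvint : Integrable v (volume.restrict Ω) :=
    Integrable.of_bound hv.continuous.aestronglyMeasurable R (Eventually.of_forall hvR)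
  -- An additive constant restores the mass exactly and leaves the gradient unchanged.
  set c : E M := V⁻¹ • ((∫ x in Ω, s x) - ∫ x in Ω, v x) with hc
  have hdiff : ‖(∫ x in Ω, s x) - ∫ x in Ω, v x‖ ≤ 2 * η₁ := by
    have e : (∫ x in Ω, s x) - ∫ x in Ω, v x =
        ((∫ x in Ω, s x) - ∫ x in Ω, v₀ n x) - ∫ x in Ω, (v x - v₀ n x) := by
      rw [integral_sub hvint (hv₀i n)]; abel
    rw [e, two_mul]
    exact (norm_sub_le _ _).trans (add_le_add h2 ((norm_integral_le_integral_norm _).trans hvi))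
  have hc1 : ‖c‖ ≤ 1 := by
    rw [hc, norm_smul, Real.norm_of_nonneg (inv_nonneg.2 hV0)]
    calc V⁻¹ * _ ≤ V⁻¹ * (2 * η₁) := mul_le_mul_of_nonneg_left hdiff (inv_nonneg.2 hV0)
      _ ≤ 1 := by rw [mul_comm]; exact hη₁V
  have hVc : V • c = (∫ x in Ω, s x) - ∫ x in Ω, v x := by
    by_cases h0 : V = 0
    · have hz : (volume : Measure (E N)).restrict Ω = 0 := by
        rw [Measure.restrict_eq_zero]
        exact (measureReal_eq_zero_iff hΩfin).1 h0
      simp [h0, hz]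
    · rw [hc, smul_inv_smul₀ h0]
  have hvc : ContDiff ℝ ∞ fun x => v x + c := hv.add contDiff_const
  have hvcR : ∀ x, ‖v x + c‖ ≤ R + 1 := fun x => (norm_add_le _ _).trans (add_le_add (hvR x) hc1)
  have hvcL : ∀ x ∈ Ω, ‖fderiv ℝ (fun x => v x + c) x‖ ≤ L / δ n := by
    intro x hx
    rw [fderiv_add_const]
    exact hvL x hx
  obtain ⟨u, hu, huE⟩ := hW.exists_energy_le hΩ hΩfin hvc hvcR hvcL (ε n) (δ n)
  have hdist : ∫ x in Ω, ‖v x + c - v₀ n x‖ ≤ 3 * η₁ := by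
    have hi : Integrable (fun x => ‖v x - v₀ n x‖) (volume.restrict Ω) :=
      (hvint.sub (hv₀i n)).norm
    calc ∫ x in Ω, ‖v x + c - v₀ n x‖ ≤ ∫ x in Ω, (‖v x - v₀ n x‖ + ‖c‖) := by
          refine integral_mono_of_nonneg (Eventually.of_forall fun x => norm_nonneg _)
            (hi.add (integrable_const _)) (Eventually.of_forall fun x => ?_)
          simp only
          rw [add_sub_right_comm]
          exact norm_add_le _ _
      _ = (∫ x in Ω, ‖v x - v₀ n x‖) + ‖V • c‖ := by
          rw [integral_add hi (integrable_const _), setIntegral_const, norm_smul V c,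
            Real.norm_of_nonneg hV0, smul_eq_mul]
      _ ≤ η₁ + 2 * η₁ := by
          rw [hVc]
          exact add_le_add hvi hdiff
      _ = 3 * η₁ := by ring
  refine ⟨u, ?_, huE.trans (ENNReal.ofReal_le_ofReal ?_), fun w hw => ?_⟩
  · rw [integral_congr_ae hu, integral_add hvint (integrable_const _), setIntegral_const, hVc]
    abel
  · have h5 := hcomp (volume.restrict Ω) (fun x => (δ n)⁻¹ • x) (fun x => v x + c) (v₀ n)
      (measurable_const_smul _) hvc.continuous.aemeasurable (hv₀m n).aemeasurable
      (Eventually.of_forall hvcR) (Eventually.of_forall fun x => (hv₀R n x).trans (by linarith))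
    have h6 : K * ∫ x in Ω, ‖v x + c - v₀ n x‖ ≤ η / 8 :=
      (mul_le_mul_of_nonneg_left hdist hK).trans hη₁K
    have h7 : (volume.restrict Ω).real Set.univ = V := by
      rw [measureReal_restrict_apply_univ]
    rw [h7] at h5
    linarith
  · have h8 : |∫ x in Ω, inner ℝ (v x + c - v₀ n x) (w x)| ≤ η / 2 := by
      refine abs_integral_inner_le (B := B) ?_ (Eventually.of_forall fun x => ?_) w (by positivity) ?_
      · exact hvc.continuous.aestronglyMeasurable.sub (hv₀m n).aestronglyMeasurable
      · exact (norm_sub_le _ _).trans (add_le_add (hvcR x) (hv₀R n x))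
      · refine le_trans ?_ hη₁Λ
        exact mul_le_mul (mul_le_mul_of_nonneg_left hdist (by positivity)) (hΛ w hw) (sq_nonneg _)
          (by positivity)
    have hw2 := Lp.memLp w
    have i1 : Integrable (fun x => inner ℝ (v x + c) (w x)) (volume.restrict Ω) :=
      integrable_inner_of_memLp (MemLp.of_bound hvc.continuous.aestronglyMeasurable (R + 1)
        (Eventually.of_forall hvcR)) hw2
    have i2 : Integrable (fun x => inner ℝ (v₀ n x) (w x)) (volume.restrict Ω) :=
      integrable_inner_of_memLp (MemLp.of_bound (hv₀m n).aestronglyMeasurable R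
        (Eventually.of_forall (hv₀R n))) hw2
    have e1 : inner ℝ u w = ∫ x in Ω, inner ℝ (v x + c) (w x) := by
      rw [L2.inner_def]
      refine integral_congr_ae ?_
      filter_upwards [hu] with x hx
      rw [hx]
    have e2 : inner ℝ u w - ∫ x in Ω, inner ℝ (s x) (w x) =
        (∫ x in Ω, inner ℝ (v x + c - v₀ n x) (w x)) +
        ((∫ x in Ω, inner ℝ (w x) (v₀ n x)) - ∫ x in Ω, inner ℝ (w x) (s x)) := by
      simp only [real_inner_comm _ (w _)]
      rw [e1]
      simp only [inner_sub_left]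
      rw [integral_sub i1 i2]
      ring
    rw [e2]
    calc _ ≤ η / 2 + η / 2 := (abs_add_le _ _).trans (add_le_add h8 (h1 w hw))
      _ = η := by ring

end UpperBound

section GammaConvergence

variable {N M : ℕ} {W : E N → E M → ℝ}

/-! ### Gamma-convergence and compactness -/

instance separableSpace_vecL2 (Ω : Set (E N)) : TopologicalSpace.SeparableSpace (VecL2 Ω M) := by
  have : Fact ((2 : ℝ≥0∞) ≠ ⊤) := ⟨by simp⟩
  infer_instance

lemma lintegral_le_energy (W : E N → E M → ℝ) (Ω : Set (E N)) (ε δ : ℝ) (u : VecL2 Ω M) :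
    ∫⁻ x in Ω, ENNReal.ofReal (W (δ⁻¹ • x) (u x)) ≤ energy W Ω ε δ u := by
  refine le_iInf₂ fun g _ => lintegral_mono fun x => ENNReal.ofReal_le_ofReal ?_
  have : 0 ≤ ε ^ 2 * ∑ j, ‖g j x‖ ^ 2 := by positivity
  linarith

/-- The energy controls the `L²` norm. -/
lemma IsRegularIntegrand.exists_norm_sq_le (hW : IsRegularIntegrand W) {Ω : Set (E N)}
    (hΩfin : volume Ω ≠ ⊤) :
    ∃ C ≥ 0, ∀ (ε δ : ℝ) (u : VecL2 Ω M) (T : ℝ), 0 ≤ T → energy W Ω ε δ u ≤ ENNReal.ofReal T →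
      ‖u‖ ^ 2 ≤ C * (volume.real Ω + T) := by
  have hfin : IsFiniteMeasure ((volume : Measure (E N)).restrict Ω) :=
    isFiniteMeasure_restrict.2 hΩfin
  obtain ⟨C, hC, h⟩ := hW.growth
  refine ⟨C, hC.le, fun ε δ u T hT hE => ?_⟩
  have hu : AEMeasurable u (volume.restrict Ω) := (Lp.aestronglyMeasurable u).aemeasurable
  have hWm : AEStronglyMeasurable (fun x => W (δ⁻¹ • x) (u x)) (volume.restrict Ω) :=
    hW.aestronglyMeasurable_comp (measurable_const_smul _) hu
  have hle := (lintegral_le_energy W Ω ε δ u).trans hE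
  have hWi : Integrable (fun x => W (δ⁻¹ • x) (u x)) (volume.restrict Ω) := by
    refine ⟨hWm, ?_⟩
    rw [hasFiniteIntegral_iff_ofReal (Eventually.of_forall fun x => hW.nonneg _ _)]
    exact hle.trans_lt ENNReal.ofReal_lt_top
  have hWT : ∫ x in Ω, W (δ⁻¹ • x) (u x) ≤ T := by
    rw [integral_eq_lintegral_of_nonneg_ae (Eventually.of_forall fun x => hW.nonneg _ _) hWm]
    exact ENNReal.toReal_le_of_le_ofReal hT hle
  rw [norm_sq_eq_integral]
  calc ∫ x in Ω, ‖u x‖ ^ 2 ≤ ∫ x in Ω, C * (1 + W (δ⁻¹ • x) (u x)) :=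
        integral_mono_of_nonneg (Eventually.of_forall fun x => sq_nonneg _)
          (((integrable_const 1).add hWi).const_mul C) (Eventually.of_forall fun x => (h _ _).1)
    _ = C * (volume.real Ω + ∫ x in Ω, W (δ⁻¹ • x) (u x)) := by
        rw [integral_const_mul, integral_add (integrable_const 1) hWi, setIntegral_const,
          smul_eq_mul, mul_one]
    _ ≤ C * (volume.real Ω + T) := by gcongr

lemma IsRegularIntegrand.integrable_relaxedPotential (hN : 1 ≤ N) (hW : IsRegularIntegrand W)
    {X : Type*} [MeasurableSpace X] {μ : Measure X} [IsFiniteMeasure μ] {u : X → E M}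
    (hu : MemLp u 2 μ) : Integrable (fun x => relaxedPotential W (u x)) μ := by
  obtain ⟨C, hC, hHC⟩ := hW.exists_relaxedPotential_le
  refine (((integrable_const (1 : ℝ)).add hu.norm.integrable_sq).const_mul C).mono'
    ((hW.continuous_relaxedPotential hN).comp_aestronglyMeasurable hu.1)
    (Eventually.of_forall fun x => ?_)
  rw [Real.norm_of_nonneg (hW.relaxedPotential_nonneg _)]
  exact hHC _

lemma IsRegularIntegrand.limitEnergy_eq (hN : 1 ≤ N) (hW : IsRegularIntegrand W) {Ω : Set (E N)}
    (hΩfin : volume Ω ≠ ⊤) (u : VecL2 Ω M) :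
    limitEnergy W Ω u = ENNReal.ofReal (∫ x in Ω, relaxedPotential W (u x)) := by
  have hfin : IsFiniteMeasure ((volume : Measure (E N)).restrict Ω) :=
    isFiniteMeasure_restrict.2 hΩfin
  simp only [limitEnergy, hW.homogenizedPotential_eq hN]
  exact (ofReal_integral_eq_lintegral_ofReal (hW.integrable_relaxedPotential hN (Lp.memLp u))
    (Eventually.of_forall fun x => hW.relaxedPotential_nonneg _)).symm

/-- Recovery of a square integrable function, up to a small error. -/
theorem IsRegularIntegrand.exists_recovery (hN : 1 ≤ N) (hW : IsRegularIntegrand W)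
    {Ω : Set (E N)} (hΩ : IsOpen Ω) (hΩb : Bornology.IsBounded Ω) {ε δ : ℕ → ℝ}
    (hδ : ∀ n, 0 < δ n) (hδ0 : Tendsto δ atTop (𝓝 0))
    (hεδ : Tendsto (fun n => ε n / δ n) atTop (𝓝 0)) (u : VecL2 Ω M)
    (S : Finset (VecL2 Ω M)) {η : ℝ} (hη : 0 < η) :
    ∀ᶠ n in atTop, ∃ v : VecL2 Ω M, ∫ x in Ω, v x = ∫ x in Ω, u x ∧
      energy W Ω (ε n) (δ n) v ≤ ENNReal.ofReal ((∫ x in Ω, relaxedPotential W (u x)) + η) ∧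
      ∀ w ∈ S, |inner ℝ v w - inner ℝ u w| ≤ η := by
  have hfin : IsFiniteMeasure ((volume : Measure (E N)).restrict Ω) :=
    isFiniteMeasure_restrict.2 hΩb.measure_lt_top.ne
  have hu := Lp.memLp u
  obtain ⟨C, hC, hHC⟩ := hW.exists_relaxedPotential_le
  obtain ⟨s, hsm, ⟨B, hB⟩, hsl⟩ := exists_simpleFunc_approx hu
  have hg : MemLp (fun x => 2 * ‖u x‖ + B) 2 (volume.restrict Ω) :=
    (hu.norm.const_mul 2).add (memLp_const B)
  have h1 : Tendsto (fun j => ∫ x in Ω, relaxedPotential W (s j x)) atTop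
      (𝓝 (∫ x in Ω, relaxedPotential W (u x))) :=
    tendsto_integral_of_quadratic_growth (hW.continuous_relaxedPotential hN) (C := C)
      (fun p => by rw [abs_of_nonneg (hW.relaxedPotential_nonneg p)]; exact hHC p)
      (fun n => (s n).aestronglyMeasurable) hg hB hsl
  have h2 : ∀ w : VecL2 Ω M, Tendsto (fun j => ∫ x in Ω, inner ℝ (s j x) (w x)) atTop
      (𝓝 (inner ℝ u w)) := by
    intro w
    rw [L2.inner_def]
    refine tendsto_integral_of_dominated_convergence (fun x => (2 * ‖u x‖ + B) * ‖w x‖)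
      (fun n => (s n).aestronglyMeasurable.inner (Lp.aestronglyMeasurable w))
      (hg.integrable_mul (Lp.memLp w).norm) (fun n => ?_) ?_
    · filter_upwards [hB] with x hx
      exact (norm_inner_le_norm _ _).trans (mul_le_mul_of_nonneg_right (hx n) (norm_nonneg _))
    · filter_upwards [hsl] with x hx using hx.inner tendsto_const_nhds
  have h2' : ∀ᶠ j in atTop, ∀ w ∈ S, |(∫ x in Ω, inner ℝ (s j x) (w x)) - inner ℝ u w| ≤ η / 2 := by
    refine (Finset.eventually_all S).2 fun w _ => ?_
    have := ((h2 w).sub_const (inner ℝ u w)).abs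
    rw [sub_self, abs_zero] at this
    exact this.eventually (ge_mem_nhds (by positivity))
  obtain ⟨j, hj1, hj2⟩ := ((h1.eventually (ge_mem_nhds
    (show _ < (∫ x in Ω, relaxedPotential W (u x)) + η / 2 by linarith))).and h2').exists
  filter_upwards [hW.exists_recovery_simpleFunc hΩ hΩb hδ hδ0 hεδ (s j)
    (hW.integrable_relaxedPotential hN (SimpleFunc.memLp_of_isFiniteMeasure (s j) 2 _)) S
    (half_pos hη)] with n ⟨v, hv1, hv2, hv3⟩
  refine ⟨v, hv1.trans (hsm j), hv2.trans (ENNReal.ofReal_le_ofReal (by linarith)), fun w hw => ?_⟩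
  calc |inner ℝ v w - inner ℝ u w|
      ≤ |inner ℝ v w - ∫ x in Ω, inner ℝ (s j x) (w x)| +
        |(∫ x in Ω, inner ℝ (s j x) (w x)) - inner ℝ u w| := abs_sub_le _ _ _
    _ ≤ η / 2 + η / 2 := add_le_add (hv3 w hw) (hj2 w hw)
    _ = η := by ring

/-! ### Diagonal argument and the Γ-limit under the mass constraint. -/

/-- A diagonal sequence of indices. -/
lemma exists_tendsto_diagonal {P : ℕ → ℕ → Prop} (h : ∀ j, ∀ᶠ n in atTop, P j n) :
    ∃ k : ℕ → ℕ, Tendsto k atTop atTop ∧ ∀ᶠ n in atTop, P (k n) n := by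
  classical
  choose T hT using fun j => eventually_atTop.1 (h j)
  -- `T j` is the index from which `P j` holds, and k(n) is the largest j ≤ n whose threshold has
  -- been passed. The default value 0 is harmless once n ≥ T 0.
  refine ⟨fun n => Nat.findGreatest (fun j => T j ≤ n) n, ?_, ?_⟩
  · refine tendsto_atTop.2 fun j => ?_
    filter_upwards [eventually_ge_atTop (max j (T j))] with n hn
    exact Nat.le_findGreatest ((le_max_left _ _).trans hn) ((le_max_right _ _).trans hn)
  · filter_upwards [eventually_ge_atTop (T 0)] with n hn
    exact hT _ n (Nat.findGreatest_spec (P := fun j => T j ≤ n) (Nat.zero_le n) hn)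

/-- On bounded sequences, pairings with a dense sequence test weak convergence. The diagonal
construction thus has only finitely many pairings to control at each stage. -/
lemma weaklyConverges_of_denseRange {H : Type*} [NormedAddCommGroup H] [InnerProductSpace ℝ H]
    {u : ℕ → H} {v : H} {R : ℝ} (hR : ∀ᶠ n in atTop, ‖u n‖ ≤ R) {d : ℕ → H} (hd : DenseRange d)
    (h : ∀ i, Tendsto (fun n => inner ℝ (u n) (d i)) atTop (𝓝 (inner ℝ v (d i)))) :
    WeaklyConverges u v := by
  intro w
  rw [Metric.tendsto_nhds]
  intro η hη
  obtain ⟨n₀, hn₀⟩ := hR.exists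
  have hR0 : 0 ≤ R := (norm_nonneg _).trans hn₀
  obtain ⟨i, hi⟩ := hd.exists_dist_lt w (show 0 < η / (2 * (R + ‖v‖ + 1)) by positivity)
  rw [dist_eq_norm, lt_div_iff₀ (by positivity)] at hi
  filter_upwards [hR, Metric.tendsto_nhds.1 (h i) (η / 2) (half_pos hη)] with n hn hni
  rw [Real.dist_eq] at hni ⊢
  have e : inner ℝ (u n) w - inner ℝ v w =
      inner ℝ (u n - v) (w - d i) + (inner ℝ (u n) (d i) - inner ℝ v (d i)) := by
    simp only [inner_sub_left, inner_sub_right]; ring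
  rw [e]
  refine (abs_add_le _ _).trans_lt ?_
  have h1 : |inner ℝ (u n - v) (w - d i)| ≤ (R + ‖v‖) * ‖w - d i‖ :=
    (abs_real_inner_le_norm _ _).trans (mul_le_mul_of_nonneg_right
      ((norm_sub_le _ _).trans (add_le_add_left hn _)) (norm_nonneg _))
  nlinarith [norm_nonneg (w - d i)]

/-- `Γ`-convergence of the functionals with a mass constraint. -/
theorem IsRegularIntegrand.weaklyGammaConverges (hN : 1 ≤ N) (hW : IsRegularIntegrand W)
    {Ω : Set (E N)} (hΩ : IsOpen Ω) (hΩb : Bornology.IsBounded Ω) {ε δ : ℕ → ℝ}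
    (hδ : ∀ n, 0 < δ n) (hδ0 : Tendsto δ atTop (𝓝 0))
    (hεδ : Tendsto (fun n => ε n / δ n) atTop (𝓝 0)) (m : E M) :
    WeaklyGammaConverges (fun n => massConstrained (energy W Ω (ε n) (δ n)) m)
      (massConstrained (limitEnergy W Ω) m) := by
  have hΩfin : volume Ω ≠ ⊤ := hΩb.measure_lt_top.ne
  have hfin : IsFiniteMeasure ((volume : Measure (E N)).restrict Ω) :=
    isFiniteMeasure_restrict.2 hΩfin
  refine ⟨fun v u huv => ?_, fun u => ?_⟩
  · by_cases hm : ∫ x in Ω, v x = m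
    · rw [massConstrained, if_pos hm, hW.limitEnergy_eq hN hΩfin]
      refine (hW.le_liminf_lintegral hN hΩ.measurableSet hΩfin hδ hδ0 huv).trans
        (liminf_le_liminf (Eventually.of_forall fun n => ?_))
      refine (lintegral_le_energy W Ω (ε n) (δ n) (u n)).trans ?_
      change _ ≤ massConstrained (energy W Ω (ε n) (δ n)) m (u n)
      rw [massConstrained]
      split_ifs
      · exact le_rfl
      · exact le_top
    -- Masses pass to weak limits, so a limit of the wrong mass forces the sequence to have the
    -- wrong mass, hence infinite energy, from some index on.
    · have hne : ∀ᶠ n in atTop, ∫ x in Ω, u n x ≠ m := huv.tendsto_integral.eventually_ne hm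
      have : (fun n => massConstrained (energy W Ω (ε n) (δ n)) m (u n)) =ᶠ[atTop] fun _ => ⊤ := by
        filter_upwards [hne] with n hn
        rw [massConstrained, if_neg hn]
      rw [liminf_congr this, liminf_const]
      exact le_top
  · by_cases hm : ∫ x in Ω, u x = m
    swap
    · refine ⟨fun _ => u, fun w => tendsto_const_nhds, ?_⟩
      have htop : massConstrained (limitEnergy W Ω) m u = ⊤ := if_neg hm
      rw [htop]
      exact le_top
    set t := ∫ x in Ω, relaxedPotential W (u x) with ht
    have ht0 : 0 ≤ t := integral_nonneg fun x => hW.relaxedPotential_nonneg _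
    let d := TopologicalSpace.denseSeq (VecL2 Ω M)
    classical
    let Q : ℕ → ℕ → VecL2 Ω M → Prop := fun j n v => ∫ x in Ω, v x = m ∧
      energy W Ω (ε n) (δ n) v ≤ ENNReal.ofReal (t + 1 / ((j : ℝ) + 1)) ∧
      ∀ i ≤ j, |inner ℝ v (d i) - inner ℝ u (d i)| ≤ 1 / ((j : ℝ) + 1)
    have hQ : ∀ j, ∀ᶠ n in atTop, ∃ v, Q j n v := by
      intro j
      filter_upwards [hW.exists_recovery hN hΩ hΩb hδ hδ0 hεδ u ((Finset.range (j + 1)).image d)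
        (show 0 < 1 / ((j : ℝ) + 1) by positivity)] with n ⟨v, h1, h2, h3⟩
      exact ⟨v, h1.trans hm, h2, fun i hi => h3 _ (Finset.mem_image_of_mem _
        (Finset.mem_range.2 (Nat.lt_succ_of_le hi)))⟩
    obtain ⟨k, hk, hkP⟩ := exists_tendsto_diagonal hQ
    have hex : ∀ n, ∃ v, (∃ v, Q (k n) n v) → Q (k n) n v := fun n => by
      by_cases h : ∃ v, Q (k n) n v
      · exact ⟨h.choose, fun _ => h.choose_spec⟩
      · exact ⟨0, fun h' => absurd h' h⟩
    choose v hv using hex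
    have hvQ : ∀ᶠ n in atTop, Q (k n) n (v n) := hkP.mono fun n hn => hv n hn
    have hk1 : Tendsto (fun n => 1 / ((k n : ℝ) + 1)) atTop (𝓝 0) :=
      (tendsto_one_div_add_atTop_nhds_zero_nat (𝕜 := ℝ)).comp hk
    refine ⟨v, ?_, ?_⟩
    -- The L² bound required by the density criterion comes from the energy bound itself, through
    -- coercivity.
    · obtain ⟨C, hC, hCb⟩ := hW.exists_norm_sq_le (M := M) hΩfin
      refine weaklyConverges_of_denseRange (R := √(C * (volume.real Ω + (t + 1)))) ?_
        (TopologicalSpace.denseRange_denseSeq (VecL2 Ω M)) fun i => ?_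
      · filter_upwards [hvQ] with n hn
        refine Real.le_sqrt_of_sq_le (hCb (ε n) (δ n) _ _ (by linarith) (hn.2.1.trans
          (ENNReal.ofReal_le_ofReal (add_le_add_right ?_ _))))
        rw [div_le_one (by positivity)]
        linarith [(Nat.cast_nonneg (k n) : (0 : ℝ) ≤ k n)]
      · rw [tendsto_iff_norm_sub_tendsto_zero]
        refine squeeze_zero' (Eventually.of_forall fun n => norm_nonneg _) ?_ hk1
        filter_upwards [hvQ, hk.eventually_ge_atTop i] with n hn hki using hn.2.2 i hki
    · have hpos : massConstrained (limitEnergy W Ω) m u = limitEnergy W Ω u := if_pos hm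
      rw [hpos, hW.limitEnergy_eq hN hΩfin]
      have hlim : Tendsto (fun n => ENNReal.ofReal (t + 1 / ((k n : ℝ) + 1))) atTop
          (𝓝 (ENNReal.ofReal t)) := by
        have := ENNReal.tendsto_ofReal ((tendsto_const_nhds (x := t)).add hk1)
        rwa [add_zero] at this
      refine (limsup_le_limsup ?_).trans hlim.limsup_eq.le
      filter_upwards [hvQ] with n hn
      rw [massConstrained, if_pos hn.1]
      exact hn.2.1

/-- Compactness of sequences with bounded energy. -/
theorem IsRegularIntegrand.exists_weaklyConverges_of_bounded_energy (hN : 1 ≤ N)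
    (hW : IsRegularIntegrand W) {Ω : Set (E N)} (hΩfin : volume Ω ≠ ⊤) {ε δ : ℕ → ℝ} (m : E M)
    (u : ℕ → VecL2 Ω M)
    (hu : (⨆ n, massConstrained (energy W Ω (ε n) (δ n)) m (u n)) < ⊤) :
    ∃ (v : VecL2 Ω M) (s : ℕ → ℕ), StrictMono s ∧ WeaklyConverges (fun j => u (s j)) v ∧
      massConstrained (limitEnergy W Ω) m v < ⊤ := by
  have hfin : IsFiniteMeasure ((volume : Measure (E N)).restrict Ω) :=
    isFiniteMeasure_restrict.2 hΩfin
  set T := ⨆ n, massConstrained (energy W Ω (ε n) (δ n)) m (u n) with hT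
  have hle : ∀ n, massConstrained (energy W Ω (ε n) (δ n)) m (u n) ≤ T := fun n =>
    le_iSup (fun n => massConstrained (energy W Ω (ε n) (δ n)) m (u n)) n
  have hmass : ∀ n, ∫ x in Ω, u n x = m := fun n => by
    by_contra h
    have := hle n
    rw [massConstrained, if_neg h] at this
    exact (this.trans_lt hu).ne rfl
  have hen : ∀ n, energy W Ω (ε n) (δ n) (u n) ≤ ENNReal.ofReal T.toReal := fun n => by
    have := hle n
    rwa [massConstrained, if_pos (hmass n), ← ENNReal.ofReal_toReal hu.ne] at this
  obtain ⟨C, -, hC⟩ := hW.exists_norm_sq_le (M := M) hΩfin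
  obtain ⟨v, s, hs, hsv⟩ := exists_weaklyConverges_subseq (u := u) fun n =>
    Real.le_sqrt_of_sq_le (hC _ _ (u n) _ ENNReal.toReal_nonneg (hen n))
  refine ⟨v, s, hs, hsv, ?_⟩
  have hv : ∫ x in Ω, v x = m :=
    tendsto_nhds_unique hsv.tendsto_integral (by simp only [hmass]; exact tendsto_const_nhds)
  rw [massConstrained, if_pos hv, hW.limitEnergy_eq hN hΩfin]
  exact ENNReal.ofReal_lt_top

/-- Among the functions with a given mass, the constant one has least limit energy. -/
theorem IsRegularIntegrand.limitEnergy_const_le (hN : 1 ≤ N) (hW : IsRegularIntegrand W)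
    {Ω : Set (E N)} [IsFiniteMeasure ((volume : Measure (E N)).restrict Ω)]
    (h0 : volume.real Ω ≠ 0) (v : VecL2 Ω M) :
    limitEnergy W Ω ((memLp_const ((volume.real Ω)⁻¹ • ∫ x in Ω, v x)).toLp _ : VecL2 Ω M) ≤
      limitEnergy W Ω v := by
  have hΩfin : volume Ω ≠ ⊤ := isFiniteMeasure_restrict.1 inferInstance
  set V := volume.real Ω with hV
  have hV0 : 0 < V := lt_of_le_of_ne measureReal_nonneg (Ne.symm h0)
  set p : E M := V⁻¹ • ∫ x in Ω, v x with hpdef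
  have hp : MemLp (fun _ : E N => p) 2 (volume.restrict Ω) := memLp_const p
  have hVp : ∫ x in Ω, v x = V • p := (smul_inv_smul₀ h0 _).symm
  have hpE : ∫ x in Ω, relaxedPotential W (hp.toLp _ x) = V * relaxedPotential W p := by
    have : (fun x => relaxedPotential W (hp.toLp _ x)) =ᵐ[volume.restrict Ω]
        fun _ => relaxedPotential W p := by
      filter_upwards [hp.coeFn_toLp] with x hx
      rw [hx]
    rw [integral_congr_ae this, setIntegral_const, smul_eq_mul]
  rw [hW.limitEnergy_eq hN hΩfin, hW.limitEnergy_eq hN hΩfin, hpE]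
  refine ENNReal.ofReal_le_ofReal (le_of_forall_pos_le_add fun η hη => ?_)
  -- Jensen's inequality through an affine minorant that is η/V-exact at the mean `p`; integration
  -- over Ω turns this error into η.
  obtain ⟨ξ, hξ⟩ := hW.exists_slope hN p (η := η / V) (by positivity)
  have hvi : Integrable v (volume.restrict Ω) := (Lp.memLp v).integrable (by norm_num)
  have h1 : ∫ x in Ω, (inner ℝ ξ (v x) - meanConjugate W ξ) ≤
      ∫ x in Ω, relaxedPotential W (v x) :=
    integral_mono ((hvi.const_inner ξ).sub (integrable_const _))
      (hW.integrable_relaxedPotential hN (Lp.memLp v)) fun x => hW.inner_sub_meanConjugate_le ξ _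
  rw [integral_sub (hvi.const_inner ξ) (integrable_const _), integral_inner hvi, hVp,
    setIntegral_const, smul_eq_mul, inner_smul_right] at h1
  have h2 := mul_le_mul_of_nonneg_left hξ hV0.le
  rw [mul_sub, mul_sub, mul_div_cancel₀ _ h0] at h2
  linarith

lemma setIntegral_toLp_const {Ω : Set (E N)}
    [IsFiniteMeasure ((volume : Measure (E N)).restrict Ω)] (p : E M) :
    ∫ x in Ω, ((memLp_const p).toLp _ : VecL2 Ω M) x = volume.real Ω • p := by
  rw [integral_congr_ae (memLp_const p).coeFn_toLp, setIntegral_const]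

/-- The limit functional with a mass constraint attains its minimum. -/
theorem IsRegularIntegrand.exists_isMin_limitEnergy (hN : 1 ≤ N) (hW : IsRegularIntegrand W)
    {Ω : Set (E N)} (hΩfin : volume Ω ≠ ⊤) (m : E M) :
    ∃ u : VecL2 Ω M, ∀ v : VecL2 Ω M,
      massConstrained (limitEnergy W Ω) m u ≤ massConstrained (limitEnergy W Ω) m v := by
  have hfin : IsFiniteMeasure ((volume : Measure (E N)).restrict Ω) :=
    isFiniteMeasure_restrict.2 hΩfin
  -- When Ω is null, every function has mass and energy zero, so the constrained functional is
  -- constant.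
  by_cases h0 : volume.real Ω = 0
  · have hz : (volume : Measure (E N)).restrict Ω = 0 := by
      rw [Measure.restrict_eq_zero]
      exact (measureReal_eq_zero_iff hΩfin).1 h0
    exact ⟨0, fun v => le_of_eq (by simp [massConstrained, limitEnergy, hz])⟩
  · refine ⟨(memLp_const ((volume.real Ω)⁻¹ • m)).toLp _, fun v => ?_⟩
    by_cases hv : ∫ x in Ω, v x = m
    · rw [massConstrained, massConstrained, if_pos hv, if_pos, ← hv]
      · exact hW.limitEnergy_const_le hN h0 v
      · rw [setIntegral_toLp_const, smul_inv_smul₀ h0]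
    · rw [massConstrained, massConstrained, if_neg hv]
      exact le_top

end GammaConvergence

section Regularization

variable {N M : ℕ}

/-! ### Double well potentials are almost everywhere equal to regular integrands -/

lemma neg_latticePoint (z : Fin N → ℤ) : -(latticePoint z) = latticePoint (-z) := by
  ext i; simp [latticePoint_apply]

lemma latticePoint_add (z w : Fin N → ℤ) :
    latticePoint (z + w) = latticePoint z + latticePoint w := by
  ext i; simp [latticePoint_apply]

lemma latticePoint_zero : latticePoint (0 : Fin N → ℤ) = 0 := by
  ext i; simp [latticePoint_apply]

/-- The smallest periodic set containing `S`. -/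
def periodicHull (S : Set (E N)) : Set (E N) := {y | ∃ z, y + latticePoint z ∈ S}

lemma periodicHull_periodic (S : Set (E N)) : IsCubePeriodic fun y => y ∈ periodicHull S := by
  intro y z
  refine propext ⟨fun ⟨w, hw⟩ => ⟨z + w, ?_⟩, fun ⟨w, hw⟩ => ⟨-z + w, ?_⟩⟩
  · rwa [latticePoint_add, ← add_assoc]
  · rwa [latticePoint_add, ← neg_latticePoint, ← add_assoc, add_neg_cancel_right]

lemma measurableSet_periodicHull {S : Set (E N)} (hS : MeasurableSet S) :
    MeasurableSet (periodicHull S) := by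
  have : periodicHull S = ⋃ z, (fun y => y + latticePoint z) ⁻¹' S := by
    ext y; simp [periodicHull]
  rw [this]
  exact MeasurableSet.iUnion fun z => (measurable_add_const _) hS

lemma subset_periodicHull (S : Set (E N)) : S ⊆ periodicHull S := fun y hy =>
  ⟨0, by rwa [latticePoint_zero, add_zero]⟩

namespace PeriodicDoubleWell

variable (D : PeriodicDoubleWell N M)

/-- Away from a null set of the unit cube, the potential coincides with one of its regular
parts. -/
lemma exists_W_eq_Wi (hM : 1 ≤ M) : ∃ c > 0, ∀ᵐ y ∂(volume.restrict (unitCube N)),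
    (∀ p, D.W y p = ∑ i, (D.piece i).indicator (fun y' => D.Wi i y' p) y) ∧
    (∃ i, y ∈ D.piece i ∧ ∀ p, D.W y p = D.Wi i y p) ∧
    ∀ p, (c ≤ ‖p‖ → 1 / c * ‖p‖ ^ 2 ≤ D.W y p) ∧ D.W y p ≤ c * (1 + ‖p‖ ^ 2) := by
  obtain ⟨c, hc, hgr⟩ := D.quadratic_growth
  refine ⟨c, hc, ?_⟩
  filter_upwards [D.W_eq, hgr] with y hy hg
  refine ⟨hy, ?_, hg⟩
  have hex : ∃ i, y ∈ D.piece i := by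
    by_contra! hno
    -- At a point belonging to no piece the representation would give W(y, p) = 0 for every `p`,
    -- against the growth condition at a vector of norm `c`. Almost every point therefore lies in a
    -- piece.
    let p : E M := EuclideanSpace.single ⟨0, hM⟩ c
    have hp : ‖p‖ = c := by simp [p, abs_of_pos hc]
    have h1 := (hg p).1 hp.ge
    rw [hy p, Finset.sum_eq_zero fun i _ => Set.indicator_of_notMem (hno i) _, hp] at h1
    have : 0 < 1 / c * c ^ 2 := by positivity
    linarith
  obtain ⟨i, hi⟩ := hex
  refine ⟨i, hi, fun p => ?_⟩
  rw [hy p, Finset.sum_eq_single i, Set.indicator_of_mem hi]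
  · exact fun j _ hj => Set.indicator_of_notMem
      (fun h => Set.disjoint_left.1 (D.piece_disjoint hj) h hi) _
  · simp

lemma measurable_indicator_Wi (i : Fin D.k) (p : E M) :
    Measurable ((D.piece i).indicator fun y => D.Wi i y p) := by
  classical
  have hc : ContinuousOn (fun y => D.Wi i y p) (D.piece i) :=
    (D.Wi_locallyLipschitz i).continuousOn.comp (f := fun y => (y, p)) (by fun_prop)
      fun y hy => ⟨subset_closure hy, Set.mem_univ _⟩
  rw [← Set.piecewise_eq_indicator]
  exact hc.measurable_piecewise continuousOn_const (D.piece_open i).measurableSet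

/-- A locally Lipschitz function is Lipschitz on the compact product of the closed piece and a ball.
The constant is uniform in `y`, as `modulus` demands. -/
lemma exists_lipschitz_Wi (i : Fin D.k) (R : ℝ) : ∃ K : ℝ, 0 ≤ K ∧ ∀ y ∈ D.piece i, ∀ p q,
    ‖p‖ ≤ R → ‖q‖ ≤ R → D.Wi i y p ≤ D.Wi i y q + K * ‖p - q‖ := by
  have hb : Bornology.IsBounded (D.piece i) := by
    refine (Metric.isBounded_closedBall (x := (0 : E N)) (r := N)).subset fun y hy => ?_
    rw [mem_closedBall_zero_iff]
    exact norm_le_of_mem_unitCube (D.piece_subset i hy)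
  have hcomp : IsCompact (closure (D.piece i) ×ˢ Metric.closedBall (0 : E M) R) :=
    hb.isCompact_closure.prod (isCompact_closedBall _ _)
  obtain ⟨K, hK⟩ := ((D.Wi_locallyLipschitz i).mono
    (Set.prod_mono_right (Set.subset_univ _))).exists_lipschitzOnWith_of_compact hcomp
  refine ⟨K, K.2, fun y hy p q hp hq => ?_⟩
  have h := hK.dist_le_mul (y, p) ⟨subset_closure hy, mem_closedBall_zero_iff.2 hp⟩ (y, q)
    ⟨subset_closure hy, mem_closedBall_zero_iff.2 hq⟩
  rw [Real.dist_eq, Prod.dist_eq, dist_self, max_eq_right dist_nonneg, dist_eq_norm] at h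
  linarith [le_abs_self (D.Wi i y p - D.Wi i y q)]

open Classical in
/-- A double well potential is almost everywhere equal to a regular integrand. -/
theorem exists_isRegularIntegrand (hM : 1 ≤ M) :
    ∃ W : E N → E M → ℝ, IsRegularIntegrand W ∧ ∀ᵐ y : E N, ∀ p, D.W y p = W y p := by
  obtain ⟨c, hc, hae⟩ := D.exists_W_eq_Wi hM
  obtain ⟨S, hSae, hS, hprop⟩ := hae.exists_measurable_mem
  -- All good properties hold at each point of `S` and, by periodicity, on its periodic hull. On the
  -- complement, a periodic null set, ‖p‖² is a regular substitute.
  let W : E N → E M → ℝ := fun y p => if y ∈ periodicHull S then D.W y p else ‖p‖ ^ 2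
  have hpos : ∀ {y}, y ∈ periodicHull S → ∃ y' ∈ S, ∀ p, W y p = D.W y' p := by
    rintro y ⟨z, hz⟩
    refine ⟨_, hz, fun p => ?_⟩
    have : y ∈ periodicHull S := ⟨z, hz⟩
    simp only [W, if_pos this]
    exact (D.W_periodic p y z).symm
  have hneg : ∀ {y}, y ∉ periodicHull S → ∀ p, W y p = ‖p‖ ^ 2 := fun hy p => if_neg hy
  refine ⟨W, ⟨fun p => ?_, fun p y z => ?_, fun y p => ?_, ?_, fun R η hη => ?_⟩, ?_⟩
  · intro t ht
    -- On `S` the potential is given by its piecewise representation, which is Borel in `y`; the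
    -- countable union over the lattice carries this to the hull.
    have : (fun y => W y p) ⁻¹' t = (⋃ z, (fun y => y + latticePoint z) ⁻¹'
        (S ∩ (fun y => ∑ i, (D.piece i).indicator (fun y' => D.Wi i y' p) y) ⁻¹' t)) ∪
        ((periodicHull S)ᶜ ∩ (fun _ => ‖p‖ ^ 2) ⁻¹' t) := by
      ext y
      by_cases hy : y ∈ periodicHull S
      · have hval : ∀ z, y + latticePoint z ∈ S →
            ∑ i, (D.piece i).indicator (fun y' => D.Wi i y' p) (y + latticePoint z) = D.W y p := by
          intro z hz
          rw [← (hprop _ hz).1 p]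
          exact D.W_periodic p y z
        have hWy : W y p = D.W y p := if_pos hy
        simp only [Set.mem_preimage, Set.mem_union, Set.mem_iUnion, Set.mem_inter_iff,
          Set.mem_compl_iff, hy, not_true_eq_false, false_and, or_false, hWy]
        constructor
        · intro h
          obtain ⟨z, hz⟩ := hy
          exact ⟨z, hz, by rwa [hval z hz]⟩
        · rintro ⟨z, hz, h⟩
          rwa [hval z hz] at h
      · have hno : ∀ z, y + latticePoint z ∉ S := fun z hz => hy ⟨z, hz⟩
        simp [hneg hy, hy, hno]
    rw [this]
    refine (MeasurableSet.iUnion fun z => (measurable_add_const _) (hS.inter ?_)).union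
      ((measurableSet_periodicHull hS).compl.inter (measurable_const ht))
    exact Finset.measurable_fun_sum _ (fun i _ => D.measurable_indicator_Wi i p) ht
  · have h1 : (y + latticePoint z ∈ periodicHull S) = (y ∈ periodicHull S) :=
      periodicHull_periodic S y z
    have h2 : D.W (y + latticePoint z) p = D.W y p := D.W_periodic p y z
    simp only [W, h1, h2]
  · by_cases hy : y ∈ periodicHull S
    · obtain ⟨y', -, h⟩ := hpos hy
      rw [h]; exact D.W_nonneg _ _
    · rw [hneg hy]; positivity
  -- The term `c` handles ‖p‖ ≥ c, the term c² handles ‖p‖ ≤ c, and 1 handles the substitute ‖p‖².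
  · refine ⟨c + c ^ 2 + 1, by positivity, fun y p => ?_⟩
    by_cases hy : y ∈ periodicHull S
    · obtain ⟨y', hy', h⟩ := hpos hy
      rw [h]
      obtain ⟨h1, h2⟩ := (hprop y' hy').2.2 p
      have h0 := D.W_nonneg y' p
      constructor
      · rcases le_total c ‖p‖ with hp | hp
        · have := h1 hp
          rw [one_div, inv_mul_le_iff₀ hc] at this
          nlinarith [sq_nonneg c]
        · have : ‖p‖ ^ 2 ≤ c ^ 2 := by gcongr
          nlinarith [sq_nonneg c]
      · nlinarith [sq_nonneg c, sq_nonneg ‖p‖]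
    · rw [hneg hy]
      constructor <;> nlinarith [sq_nonneg c, sq_nonneg ‖p‖]
  · choose K hK0 hK using fun i => D.exists_lipschitz_Wi i R
    have hsum : 0 ≤ ∑ i, K i := Finset.sum_nonneg fun i _ => hK0 i
    -- 2|R| is a Lipschitz constant of ‖p‖² on the ball of radius R.
    refine ⟨∑ i, K i + 2 * |R|, by positivity, fun y p q hp hq => ?_⟩
    by_cases hy : y ∈ periodicHull S
    · obtain ⟨y', hy', h⟩ := hpos hy
      obtain ⟨i, hi, hi'⟩ := (hprop y' hy').2.1
      rw [h, h, hi', hi']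
      have h1 := hK i y' hi p q hp hq
      have h2 : K i ≤ ∑ i, K i := Finset.single_le_sum (fun i _ => hK0 i) (Finset.mem_univ i)
      have h3 : K i * ‖p - q‖ ≤ (∑ i, K i + 2 * |R|) * ‖p - q‖ := by
        gcongr
        linarith [abs_nonneg R]
      linarith
    · rw [hneg hy, hneg hy]
      have h1 : ‖p‖ - ‖q‖ ≤ ‖p - q‖ := norm_sub_norm_le p q
      have h2 : ‖p‖ + ‖q‖ ≤ 2 * |R| := by linarith [le_abs_self R]
      have h3 : 0 ≤ (∑ i, K i) * ‖p - q‖ := by positivity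
      have h4 : (‖p‖ + ‖q‖) * (‖p‖ - ‖q‖) ≤ 2 * |R| * ‖p - q‖ := by
        refine (mul_le_mul_of_nonneg_left h1 (by positivity)).trans ?_
        gcongr
      nlinarith
  · have h : ∀ᵐ y : E N, y ∈ periodicHull S := by
      refine ae_of_ae_unitCube (periodicHull_periodic S) ?_
      filter_upwards [hSae] with y hy using subset_periodicHull S hy
    filter_upwards [h] with y hy p
    exact (if_pos hy).symm

end PeriodicDoubleWell

variable {W W' : E N → E M → ℝ}

/-- The dilation x ↦ x/δ pulls null sets back to null sets, so changing `W` on a null set of `y` is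
not seen at any scale. -/
lemma energy_congr (h : ∀ᵐ y : E N, ∀ p, W y p = W' y p) (Ω : Set (E N)) (ε : ℝ) {δ : ℝ}
    (hδ : 0 < δ) : energy (M := M) W Ω ε δ = energy W' Ω ε δ := by
  ext u
  have hq : Measure.QuasiMeasurePreserving (fun x : E N => δ⁻¹ • x) volume volume := by
    refine ⟨measurable_const_smul _, ?_⟩
    rw [Measure.map_addHaar_smul _ (inv_ne_zero hδ.ne')]
    exact Measure.smul_absolutelyContinuous
  have h' : ∀ᵐ x : E N, ∀ p, W (δ⁻¹ • x) p = W' (δ⁻¹ • x) p := hq.ae h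
  refine iInf_congr fun g => iInf_congr fun _ => lintegral_congr_ae ?_
  filter_upwards [ae_restrict_of_ae h'] with x hx
  rw [hx]

lemma limitEnergy_congr (h : ∀ᵐ y : E N, ∀ p, W y p = W' y p) (Ω : Set (E N)) :
    limitEnergy (M := M) W Ω = limitEnergy W' Ω := by
  ext u
  refine lintegral_congr fun x => iInf_congr fun φ => iInf_congr fun _ => lintegral_congr_ae ?_
  filter_upwards [ae_restrict_of_ae h] with y hy
  rw [funext hy]

end Regularization

section Wells

variable {N M : ℕ} {W : E N → E M → ℝ}

/-! ### Mixtures of the wells and zeros of the homogenized potential -/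

/-- The average of the mixture of `a` and `b` with volume fraction `θ`. -/
def mixtureMean (a b : E N → E M) (θ : E N → ℝ) : E M :=
  (∫ y in unitCube N, θ y • a y) + ∫ y in unitCube N, (1 - θ y) • b y

/-- The set of averages of mixtures of `a` and `b`. -/
def mixtureSet (a b : E N → E M) : Set (E M) :=
  {p | ∃ θ : E N → ℝ, Measurable θ ∧ (∀ y, θ y ∈ Set.Icc (0 : ℝ) 1) ∧ p = mixtureMean a b θ}

/-- The functions `a`, `b` are bounded measurable, and are the wells of `W`. -/
structure IsWells (W : E N → E M → ℝ) (a b : E N → E M) : Prop where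
  measurable_left : Measurable a
  measurable_right : Measurable b
  bounded : ∃ C, 0 ≤ C ∧ ∀ y, ‖a y‖ ≤ C ∧ ‖b y‖ ≤ C
  eq_zero_iff : ∀ᵐ y ∂(volume.restrict (unitCube N)), ∀ p, W y p = 0 ↔ p = a y ∨ p = b y

variable {a b : E N → E M}

lemma norm_smul_add_smul_le {t C : ℝ} (ht : t ∈ Set.Icc (0 : ℝ) 1) {p q : E M} (hp : ‖p‖ ≤ C)
    (hq : ‖q‖ ≤ C) : ‖t • p + (1 - t) • q‖ ≤ C := by
  have h := convex_closedBall (0 : E M) C (mem_closedBall_zero_iff.2 hp)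
    (mem_closedBall_zero_iff.2 hq) ht.1 (sub_nonneg.2 ht.2) (by ring)
  exact mem_closedBall_zero_iff.1 h

lemma IsWells.mixtureMean_eq (h : IsWells W a b) {θ : E N → ℝ}
    (hθ : Integrable θ (volume.restrict (unitCube N))) :
    mixtureMean a b θ = ∫ y in unitCube N, (θ y • a y + (1 - θ y) • b y) := by
  obtain ⟨C, hC0, hC⟩ := h.bounded
  rw [mixtureMean, integral_add]
  · exact hθ.smul_bdd C h.measurable_left.aestronglyMeasurable
      (Eventually.of_forall fun y => (hC y).1)
  · exact ((integrable_const (1 : ℝ)).sub hθ).smul_bdd C h.measurable_right.aestronglyMeasurable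
      (Eventually.of_forall fun y => (hC y).2)

lemma integrable_of_mem_Icc {X : Type*} [MeasurableSpace X] {μ : Measure X} [IsFiniteMeasure μ]
    {θ : X → ℝ} (hθ : AEMeasurable θ μ) (h01 : ∀ᵐ y ∂μ, θ y ∈ Set.Icc (0 : ℝ) 1) :
    Integrable θ μ := by
  refine Integrable.of_bound hθ.aestronglyMeasurable 1 ?_
  filter_upwards [h01] with y hy
  rw [Real.norm_eq_abs, abs_of_nonneg hy.1]
  exact hy.2

/-- The homogenized potential vanishes at the averages of mixtures of the wells. -/
lemma IsWells.homogenizedPotential_eq_zero (h : IsWells W a b) {θ : E N → ℝ}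
    (hθ : AEMeasurable θ (volume.restrict (unitCube N)))
    (h01 : ∀ᵐ y ∂(volume.restrict (unitCube N)), θ y ∈ Set.Icc (0 : ℝ) 1) :
    homogenizedPotential W (mixtureMean a b θ) = 0 := by
  obtain ⟨C, hC0, hC⟩ := h.bounded
  set p := mixtureMean a b θ with hp
  have hθi := integrable_of_mem_Icc hθ h01
  have hgm : AEStronglyMeasurable (fun y => θ y • a y + (1 - θ y) • b y)
      (volume.restrict (unitCube N)) :=
    ((hθ.smul h.measurable_left.aemeasurable).add
      ((aemeasurable_const.sub hθ).smul h.measurable_right.aemeasurable)).aestronglyMeasurable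
  have hgb : ∀ᵐ y ∂(volume.restrict (unitCube N)), ‖θ y • a y + (1 - θ y) • b y‖ ≤ C := by
    filter_upwards [h01] with y hy using norm_smul_add_smul_le hy (hC y).1 (hC y).2
  have hg : MemLp (fun y => θ y • a y + (1 - θ y) • b y) 2 (volume.restrict (unitCube N)) :=
    MemLp.of_bound hgm C hgb
  have hφ : MemLp (fun y => θ y • a y + (1 - θ y) • b y - p) 2 (volume.restrict (unitCube N)) :=
    hg.sub (memLp_const p)
  have hmean : ∫ y in unitCube N, hφ.toLp _ y = 0 := by
    rw [integral_congr_ae hφ.coeFn_toLp, integral_sub (hg.integrable (by norm_num))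
      (integrable_const _), ← h.mixtureMean_eq hθi]
    simp [hp]
  refine le_antisymm (iInf₂_le_of_le (hφ.toLp _) hmean (le_of_eq ?_)) zero_le
  rw [← lintegral_zero (μ := volume.restrict (unitCube N))]
  refine lintegral_congr_ae ?_
  filter_upwards [hφ.coeFn_toLp, h01, h.eq_zero_iff] with y hy hy1 hy0
  rw [hy, add_sub_cancel, ENNReal.ofReal_eq_zero]
  -- A convex minorant of `W y` is nonpositive at both wells, hence on the segment between them.
  refine Real.iSup_nonpos fun k => ?_
  have h1 := k.2.1.2 (Set.mem_univ (a y)) (Set.mem_univ (b y)) hy1.1 (sub_nonneg.2 hy1.2)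
    (by ring)
  have h2 : k.1 (a y) ≤ 0 := (k.2.2 _).trans_eq ((hy0 _).2 (Or.inl rfl))
  have h3 : k.1 (b y) ≤ 0 := (k.2.2 _).trans_eq ((hy0 _).2 (Or.inr rfl))
  refine h1.trans ?_
  have h4 := mul_nonpos_of_nonneg_of_nonpos hy1.1 h2
  have h5 := mul_nonpos_of_nonneg_of_nonpos (sub_nonneg.2 hy1.2) h3
  simp only [smul_eq_mul]
  linarith

/-- Points where the potential is small are close to the wells. -/
lemma IsRegularIntegrand.tendsto_min_norm_sub (hW : IsRegularIntegrand W) {y : E N} {p₁ p₂ : E M}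
    (h0 : ∀ p, W y p = 0 ↔ p = p₁ ∨ p = p₂) {q : ℕ → E M}
    (hq : Tendsto (fun j => W y (q j)) atTop (𝓝 0)) :
    Tendsto (fun j => min ‖q j - p₁‖ ‖q j - p₂‖) atTop (𝓝 0) := by
  obtain ⟨C, hC, hgr⟩ := hW.growth
  rw [Metric.tendsto_atTop]
  intro η hη
  -- Where W ≤ 1, coercivity gives ‖q‖² ≤ 2C and so ‖q‖ ≤ 2C + 1. On the part of this ball at
  -- distance at least η from both wells, compactness gives `W y` a positive lower bound.
  have hcomp : IsCompact (Metric.closedBall (0 : E M) (C * 2 + 1) ∩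
      {p | η ≤ min ‖p - p₁‖ ‖p - p₂‖}) :=
    (isCompact_closedBall _ _).inter_right (isClosed_le continuous_const (by fun_prop))
  obtain ⟨ρ, hρ, hρle⟩ : ∃ ρ > 0, ∀ p ∈ Metric.closedBall (0 : E M) (C * 2 + 1) ∩
      {p | η ≤ min ‖p - p₁‖ ‖p - p₂‖}, ρ ≤ W y p := by
    rcases Set.eq_empty_or_nonempty (Metric.closedBall (0 : E M) (C * 2 + 1) ∩
      {p | η ≤ min ‖p - p₁‖ ‖p - p₂‖}) with he | hne
    · exact ⟨1, one_pos, fun p hp => by rw [he] at hp; exact hp.elim⟩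
    · obtain ⟨p, hp, hmin⟩ := hcomp.exists_isMinOn hne (hW.continuous y).continuousOn
      refine ⟨W y p, lt_of_le_of_ne (hW.nonneg y p) fun he => ?_, fun r hr => hmin hr⟩
      have hle : η ≤ min ‖p - p₁‖ ‖p - p₂‖ := hp.2
      rw [le_min_iff] at hle
      rcases (h0 p).1 he.symm with rfl | rfl
      · have := hle.1; simp at this; linarith
      · have := hle.2; simp at this; linarith
  obtain ⟨n, hn⟩ := eventually_atTop.1 ((hq.eventually_lt_const hρ).and
    (hq.eventually_lt_const one_pos))
  refine ⟨n, fun j hj => ?_⟩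
  obtain ⟨h1, h2⟩ := hn j hj
  rw [Real.dist_eq, sub_zero, abs_of_nonneg (le_min (norm_nonneg _) (norm_nonneg _))]
  by_contra! hcon
  refine absurd (hρle (q j) ⟨?_, hcon⟩) (not_le.2 h1)
  rw [mem_closedBall_zero_iff]
  have h3 := (hgr y (q j)).1
  nlinarith [norm_nonneg (q j), sq_nonneg (‖q j‖ - 1)]

/-- Zeros of the relaxed potential are limits of averages of mixtures of the wells. -/
lemma IsWells.mem_closure_mixtureSet (h : IsWells W a b) (hW : IsRegularIntegrand W) {p : E M}
    (hp : relaxedPotential W p = 0) : p ∈ closure (mixtureSet a b) := by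
  obtain ⟨C₁, hC₁0, hC₁⟩ := h.bounded
  obtain ⟨C, hC, hgr⟩ := hW.growth
  choose ψ hψ hψm hψE using fun j : ℕ => exists_cellEnergy_lt W p (η := 1 / ((j : ℝ) + 1))
    (by positivity)
  simp only [hp, zero_add] at hψE
  let μ : Measure (E N) := volume.restrict (unitCube N)
  have hE0 : Tendsto (fun j => ∫ y, W y (ψ j y) ∂μ) atTop (𝓝 0) :=
    squeeze_zero (fun j => hW.cellEnergy_nonneg _) (fun j => (hψE j).le)
      tendsto_one_div_add_atTop_nhds_zero_nat
  have hWi : ∀ j, Integrable (fun y => W y (ψ j y)) μ := fun j => hW.integrable_cell (hψ j) μ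
  obtain ⟨s, hs, hae⟩ : ∃ s : ℕ → ℕ, StrictMono s ∧
      ∀ᵐ y ∂μ, Tendsto (fun j => W y (ψ (s j) y)) atTop (𝓝 0) := by
    refine TendstoInMeasure.exists_seq_tendsto_ae (f := fun j y => W y (ψ j y))
      (g := fun _ => (0 : ℝ)) (tendstoInMeasure_of_tendsto_eLpNorm one_ne_zero
        (fun j => (hWi j).aestronglyMeasurable) aestronglyMeasurable_const ?_)
    have : ∀ j, eLpNorm ((fun y => W y (ψ j y)) - fun _ => (0 : ℝ)) 1 μ =
        ENNReal.ofReal (∫ y, W y (ψ j y) ∂μ) := fun j => by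
      rw [ofReal_integral_eq_lintegral_ofReal (hWi j) (Eventually.of_forall fun y => hW.nonneg _ _),
        eLpNorm_one_eq_lintegral_enorm]
      refine lintegral_congr fun y => ?_
      simp [Real.enorm_eq_ofReal (hW.nonneg y (ψ j y))]
    simp only [this]
    simpa using ENNReal.tendsto_ofReal hE0
  let d : ℕ → E N → ℝ := fun j y => min ‖ψ (s j) y - a y‖ ‖ψ (s j) y - b y‖
  have hd0 : ∀ j y, 0 ≤ d j y := fun j y => le_min (norm_nonneg _) (norm_nonneg _)
  have hdm : ∀ j, Measurable (d j) := fun j =>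
    ((hψ (s j)).measurable.sub h.measurable_left).norm.min
      ((hψ (s j)).measurable.sub h.measurable_right).norm
  -- Coercivity gives d² ≤ K(1 + W). With T = 2K, where d ≥ T this yields 2d ≤ 1 + W, hence d ≤
  -- min(d, T) + W everywhere. The truncation converges by dominated convergence and the remainder
  -- is the vanishing energy, so d → 0 in L¹.
  set K : ℝ := 2 * C + 2 * C₁ ^ 2 + 1 with hK
  set T : ℝ := 2 * K with hT
  have hK0 : 1 ≤ K := by nlinarith [sq_nonneg C₁]
  have hdle : ∀ j y, d j y ≤ min (d j y) T + W y (ψ (s j) y) := by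
    intro j y
    rcases le_total (d j y) T with hle | hle
    · rw [min_eq_left hle]; linarith [hW.nonneg y (ψ (s j) y)]
    rw [min_eq_right hle]
    have h1 : d j y ≤ ‖ψ (s j) y‖ + C₁ :=
      (min_le_left _ _).trans ((norm_sub_le _ _).trans (by linarith [(hC₁ y).1]))
    have h2 := (hgr y (ψ (s j) y)).1
    have h3 := hW.nonneg y (ψ (s j) y)
    have h4 : d j y ^ 2 ≤ K + K * W y (ψ (s j) y) := by
      have : d j y ^ 2 ≤ (‖ψ (s j) y‖ + C₁) ^ 2 := by gcongr
      nlinarith [sq_nonneg (‖ψ (s j) y‖ - C₁), mul_nonneg (sq_nonneg C₁) h3]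
    have h5 : T * d j y ≤ d j y ^ 2 := by nlinarith [hd0 j y]
    have h6 : 2 * d j y ≤ 1 + W y (ψ (s j) y) := by
      have : K * (2 * d j y) ≤ K * (1 + W y (ψ (s j) y)) := by linarith
      exact le_of_mul_le_mul_left this (by linarith)
    linarith
  have hdi : ∀ j, Integrable (fun y => min (d j y) T) μ := fun j => by
    refine Integrable.of_bound ((hdm j).min measurable_const).aestronglyMeasurable T
      (Eventually.of_forall fun y => ?_)
    rw [Real.norm_eq_abs, abs_of_nonneg (le_min (hd0 j y) (by linarith))]
    exact min_le_right _ _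
  have hdi' : ∀ j, Integrable (d j) μ := fun j =>
    ((hdi j).add (hWi (s j))).mono' (hdm j).aestronglyMeasurable
      (Eventually.of_forall fun y => by
        rw [Real.norm_eq_abs, abs_of_nonneg (hd0 j y)]; exact hdle j y)
  have hlim1 : Tendsto (fun j => ∫ y, min (d j y) T ∂μ) atTop (𝓝 0) := by
    have := tendsto_integral_of_dominated_convergence (μ := μ) (F := fun j y => min (d j y) T)
      (f := fun _ => (0 : ℝ)) (fun _ => T) (fun j => (hdi j).aestronglyMeasurable)
      (integrable_const _) (fun j => Eventually.of_forall fun y => by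
        rw [Real.norm_eq_abs, abs_of_nonneg (le_min (hd0 j y) (by linarith))]
        exact min_le_right _ _) (by
        filter_upwards [hae, h.eq_zero_iff] with y hy hy0
        have h1 := (hW.tendsto_min_norm_sub hy0 hy).min (tendsto_const_nhds (x := T))
        rwa [min_eq_left (by linarith)] at h1)
    simpa using this
  have hlim : Tendsto (fun j => ∫ y, d j y ∂μ) atTop (𝓝 0) := by
    have h1 := hlim1.add (hE0.comp hs.tendsto_atTop)
    rw [add_zero] at h1
    refine squeeze_zero (fun j => integral_nonneg (hd0 j)) (fun j => ?_) h1
    simp only [Function.comp_apply]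
    rw [← integral_add (hdi j) (hWi (s j))]
    exact integral_mono (hdi' j) ((hdi j).add (hWi (s j))) (hdle j)
  -- Where the well `a` is at least as close as `b`. The associated mixture is the projection of the
  -- cell function onto the nearer well, at distance exactly `d`.
  let A : ℕ → Set (E N) := fun j => {y | ‖ψ (s j) y - a y‖ ≤ ‖ψ (s j) y - b y‖}
  have hA : ∀ j, MeasurableSet (A j) := fun j =>
    measurableSet_le ((hψ (s j)).measurable.sub h.measurable_left).norm
      ((hψ (s j)).measurable.sub h.measurable_right).norm
  let θ : ℕ → E N → ℝ := fun j => (A j).indicator fun _ => 1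
  have hθm : ∀ j, Measurable (θ j) := fun j => measurable_const.indicator (hA j)
  have hθ01 : ∀ j y, θ j y ∈ Set.Icc (0 : ℝ) 1 := fun j y => by
    by_cases hy : y ∈ A j <;> simp [θ, hy]
  have hθi : ∀ j, Integrable (θ j) μ := fun j =>
    integrable_of_mem_Icc (hθm j).aemeasurable (Eventually.of_forall (hθ01 j))
  have hdθ : ∀ j y, ‖θ j y • a y + (1 - θ j y) • b y - ψ (s j) y‖ = d j y := fun j y => by
    by_cases hy : y ∈ A j
    · have : ‖ψ (s j) y - a y‖ ≤ ‖ψ (s j) y - b y‖ := hy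
      simp [θ, hy, d, min_eq_left this, norm_sub_rev (a y)]
    · have : ‖ψ (s j) y - b y‖ ≤ ‖ψ (s j) y - a y‖ := (not_le.1 hy).le
      simp [θ, hy, d, min_eq_right this, norm_sub_rev (b y)]
  refine mem_closure_of_tendsto (f := fun j => mixtureMean a b (θ j)) (b := atTop) ?_
    (Eventually.of_forall fun j => ⟨θ j, hθm j, hθ01 j, rfl⟩)
  rw [tendsto_iff_norm_sub_tendsto_zero]
  refine squeeze_zero (fun j => norm_nonneg _) (fun j => ?_) hlim
  have hgi : Integrable (fun y => θ j y • a y + (1 - θ j y) • b y) μ :=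
    Integrable.of_bound (((hθm j).smul h.measurable_left).add
      ((measurable_const.sub (hθm j)).smul h.measurable_right)).aestronglyMeasurable C₁
      (Eventually.of_forall fun y => norm_smul_add_smul_le (hθ01 j y) (hC₁ y).1 (hC₁ y).2)
  have hpj : p = ∫ y, ψ (s j) y ∂μ := (hψm (s j)).symm
  rw [h.mixtureMean_eq (hθi j), hpj, ← integral_sub hgi ((hψ (s j)).integrable μ)]
  exact (norm_integral_le_integral_norm _).trans_eq (integral_congr_ae
    (Eventually.of_forall (hdθ j)))

end Wells

section ZeroEnergy

variable {N M : ℕ} {W : E N → E M → ℝ} {a b : E N → E M}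

/-! ### Averaged mixtures of the wells -/

/-! ### Weak limits of volume fractions on Ω × Q. -/

lemma WeaklyConverges.tendsto_integral_mul {X : Type*} [MeasurableSpace X] {π : Measure X}
    {ν : ℕ → Lp ℝ 2 π} {μ : Lp ℝ 2 π} (h : WeaklyConverges ν μ) {g : X → ℝ} (hg : MemLp g 2 π) :
    Tendsto (fun j => ∫ z, ν j z * g z ∂π) atTop (𝓝 (∫ z, μ z * g z ∂π)) := by
  have hinner : ∀ f : Lp ℝ 2 π, inner ℝ f (hg.toLp g) = ∫ z, f z * g z ∂π := fun f => by
    rw [L2.inner_def]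
    refine integral_congr_ae ?_
    filter_upwards [hg.coeFn_toLp] with z hz
    rw [hz]
    simp [mul_comm]
  simpa only [hinner] using h (hg.toLp g)

lemma WeaklyConverges.tendsto_setIntegral {X : Type*} [MeasurableSpace X] {π : Measure X}
    [IsFiniteMeasure π] {ν : ℕ → Lp ℝ 2 π} {μ : Lp ℝ 2 π} (h : WeaklyConverges ν μ) {A : Set X}
    (hA : MeasurableSet A) :
    Tendsto (fun j => ∫ z in A, ν j z ∂π) atTop (𝓝 (∫ z in A, μ z ∂π)) := by
  have hg : MemLp (A.indicator fun _ => (1 : ℝ)) 2 π :=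
    memLp_indicator_const 2 hA 1 (Or.inr (measure_ne_top _ _))
  have heq : ∀ f : X → ℝ, ∫ z, f z * A.indicator (fun _ => (1 : ℝ)) z ∂π = ∫ z in A, f z ∂π :=
    fun f => by
      rw [← integral_indicator hA]
      refine integral_congr_ae (Eventually.of_forall fun z => ?_)
      by_cases hz : z ∈ A <;> simp [hz]
  simpa only [heq] using h.tendsto_integral_mul hg

/-- Functions with values in `[0, 1]` are closed under weak convergence. -/
lemma WeaklyConverges.ae_mem_Icc {X : Type*} [MeasurableSpace X] {π : Measure X}
    [IsFiniteMeasure π] {ν : ℕ → Lp ℝ 2 π} {μ : Lp ℝ 2 π} (h : WeaklyConverges ν μ)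
    (h01 : ∀ j, ∀ᵐ z ∂π, ν j z ∈ Set.Icc (0 : ℝ) 1) : ∀ᵐ z ∂π, μ z ∈ Set.Icc (0 : ℝ) 1 := by
  have hi : ∀ f : Lp ℝ 2 π, Integrable f π := fun f => (Lp.memLp f).integrable (by norm_num)
  have h0 : (fun _ => (0 : ℝ)) ≤ᵐ[π] μ :=
    ae_le_of_forall_setIntegral_le (integrable_const _) (hi μ) fun A hA _ =>
      ge_of_tendsto' (h.tendsto_setIntegral hA) fun j =>
        setIntegral_mono_ae (integrable_const _).integrableOn (hi _).integrableOn (by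
          filter_upwards [h01 j] with z hz using hz.1)
  have h1 : μ ≤ᵐ[π] fun _ => (1 : ℝ) :=
    ae_le_of_forall_setIntegral_le (hi μ) (integrable_const _) fun A hA _ =>
      le_of_tendsto' (h.tendsto_setIntegral hA) fun j =>
        setIntegral_mono_ae (hi _).integrableOn (integrable_const _).integrableOn (by
          filter_upwards [h01 j] with z hz using hz.2)
  filter_upwards [h0, h1] with z hz0 hz1 using ⟨hz0, hz1⟩

lemma mixtureMean_congr {a' b' : E N → E M} {θ θ' : E N → ℝ}
    (ha : a =ᵐ[volume.restrict (unitCube N)] a') (hb : b =ᵐ[volume.restrict (unitCube N)] b')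
    (hθ : θ =ᵐ[volume.restrict (unitCube N)] θ') : mixtureMean a b θ = mixtureMean a' b' θ' := by
  refine congrArg₂ _ (integral_congr_ae ?_) (integral_congr_ae ?_)
  · filter_upwards [ha, hθ] with y h1 h2
    rw [h1, h2]
  · filter_upwards [hb, hθ] with y h1 h2
    rw [h1, h2]

lemma IsWells.norm_mixtureMean_le (h : IsWells W a b) : ∃ C, ∀ p ∈ mixtureSet a b, ‖p‖ ≤ C := by
  obtain ⟨C, hC0, hC⟩ := h.bounded
  refine ⟨C, ?_⟩
  rintro _ ⟨θ, hθm, hθ, rfl⟩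
  rw [h.mixtureMean_eq (integrable_of_mem_Icc hθm.aemeasurable (Eventually.of_forall hθ))]
  refine (norm_integral_le_of_norm_le_const (C := C) (Eventually.of_forall fun y =>
    norm_smul_add_smul_le (hθ y) (hC y).1 (hC y).2)).trans_eq ?_
  simp

/-- The product measure on `Ω × Q`. -/
abbrev fiberMeasure (Ω : Set (E N)) : Measure (E N × E N) :=
  (volume.restrict Ω).prod (volume.restrict (unitCube N))

lemma IsWells.mixtureMean_fiber_ae_eq (h : IsWells W a b) {Ω : Set (E N)}
    {ν : E N × E N → ℝ}
    (hν : Integrable ν (fiberMeasure Ω)) :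
    (fun x => mixtureMean a b fun y => ν (x, y)) =ᵐ[volume.restrict Ω] fun x =>
      ∫ y in unitCube N, (ν (x, y) • a y + (1 - ν (x, y)) • b y) := by
  filter_upwards [hν.prod_right_ae] with x hx
  exact h.mixtureMean_eq hx

section Fibers

variable {Ω : Set (E N)} [IsFiniteMeasure ((volume : Measure (E N)).restrict Ω)]

lemma IsWells.integrable_mixture (h : IsWells W a b) {ν : E N × E N → ℝ}
    (hν : Integrable ν (fiberMeasure Ω)) :
    Integrable (fun z => ν z • a z.2 + (1 - ν z) • b z.2) (fiberMeasure Ω) := by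
  obtain ⟨C, hC0, hC⟩ := h.bounded
  refine Integrable.add ?_ ?_
  · exact hν.smul_bdd C (h.measurable_left.comp measurable_snd).aestronglyMeasurable
      (Eventually.of_forall fun y => (hC y.2).1)
  · exact ((integrable_const (1 : ℝ)).sub hν).smul_bdd C
      (h.measurable_right.comp measurable_snd).aestronglyMeasurable
      (Eventually.of_forall fun y => (hC y.2).2)

lemma IsWells.integrable_mixtureMean_fiber (h : IsWells W a b) {ν : E N × E N → ℝ}
    (hν : Integrable ν (fiberMeasure Ω)) :
    Integrable (fun x => mixtureMean a b fun y => ν (x, y)) (volume.restrict Ω) :=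
  (h.integrable_mixture hν).integral_prod_left.congr (h.mixtureMean_fiber_ae_eq hν).symm

/-- Since νa + (1 − ν)b = b + ν(a − b), the integrated mean is affine in ν: a pairing with a fixed
bounded function plus a constant. Weak continuity in ν can be read off. -/
lemma IsWells.inner_setIntegral_mixtureMean (h : IsWells W a b) {ν : E N × E N → ℝ}
    (hν : Integrable ν (fiberMeasure Ω)) {A : Set (E N)} (hA : MeasurableSet A) (e : E M) :
    inner ℝ e (∫ x in A, (mixtureMean a b fun y => ν (x, y)) ∂(volume.restrict Ω)) =
      ∫ z, ν z * (A ×ˢ Set.univ).indicator (fun z => inner ℝ e (a z.2 - b z.2)) z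
        ∂(fiberMeasure Ω) +
      ∫ z in A ×ˢ Set.univ, inner ℝ e (b z.2) ∂(fiberMeasure Ω) := by
  obtain ⟨C, hC0, hC⟩ := h.bounded
  have hAu : MeasurableSet (A ×ˢ (Set.univ : Set (E N))) := hA.prod MeasurableSet.univ
  have hG := h.integrable_mixture hν
  have hb : Integrable (fun z : E N × E N => inner ℝ e (b z.2)) (fiberMeasure Ω) :=
    (Integrable.of_bound (h.measurable_right.comp measurable_snd).aestronglyMeasurable C
      (Eventually.of_forall fun y => (hC y.2).2)).const_inner e
  have hab : Integrable (fun z : E N × E N => ν z * inner ℝ e (a z.2 - b z.2))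
      (fiberMeasure Ω) := by
    have := (hG.const_inner e).sub hb
    refine this.congr (Eventually.of_forall fun z => ?_)
    simp only [Pi.sub_apply, inner_add_right, inner_smul_right, inner_sub_right]
    ring
  rw [setIntegral_congr_ae hA ((h.mixtureMean_fiber_ae_eq hν).mono fun x hx _ => hx)]
  have h1 := setIntegral_prod (μ := volume.restrict Ω) (ν := volume.restrict (unitCube N))
    (s := A) (t := Set.univ) (fun z => ν z • a z.2 + (1 - ν z) • b z.2) hG.integrableOn
  simp only [Measure.restrict_univ] at h1
  rw [← h1, ← integral_inner hG.integrableOn]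
  have h2 : ∫ z, ν z * (A ×ˢ Set.univ).indicator (fun z => inner ℝ e (a z.2 - b z.2)) z
      ∂(fiberMeasure Ω) =
      ∫ z in A ×ˢ Set.univ, ν z * inner ℝ e (a z.2 - b z.2) ∂(fiberMeasure Ω) := by
    rw [← integral_indicator hAu]
    refine integral_congr_ae (Eventually.of_forall fun z => ?_)
    by_cases hz : z ∈ A ×ˢ (Set.univ : Set (E N)) <;> simp only [Set.indicator, hz, if_true,
      if_false, mul_zero]
  rw [h2, ← integral_add hab.integrableOn hb.integrableOn]
  refine integral_congr_ae (Eventually.of_forall fun z => ?_)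
  simp only [inner_add_right, inner_smul_right, inner_sub_right]
  ring

/-- The average of a mixture is weakly continuous. -/
lemma IsWells.tendsto_setIntegral_mixtureMean (h : IsWells W a b)
    {ν : ℕ → Lp ℝ 2 (fiberMeasure Ω)} {μ : Lp ℝ 2 (fiberMeasure Ω)} (hν : WeaklyConverges ν μ)
    {A : Set (E N)} (hA : MeasurableSet A) :
    Tendsto (fun j => ∫ x in A, (mixtureMean a b fun y => ν j (x, y)) ∂(volume.restrict Ω)) atTop
      (𝓝 (∫ x in A, (mixtureMean a b fun y => μ (x, y)) ∂(volume.restrict Ω))) := by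
  obtain ⟨C, hC0, hC⟩ := h.bounded
  have hi : ∀ f : Lp ℝ 2 (fiberMeasure Ω), Integrable f (fiberMeasure Ω) := fun f =>
    (Lp.memLp f).integrable (by norm_num)
  refine tendsto_of_forall_inner fun e => ?_
  simp only [h.inner_setIntegral_mixtureMean (hi _) hA e]
  refine (hν.tendsto_integral_mul ?_).add_const _
  refine MemLp.indicator (hA.prod MeasurableSet.univ) (MemLp.of_bound ?_ (‖e‖ * (C + C))
    (Eventually.of_forall fun z => ?_))
  · exact (measurable_const.inner ((h.measurable_left.sub h.measurable_right).comp
      measurable_snd)).aestronglyMeasurable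
  · refine (norm_inner_le_norm _ _).trans ?_
    gcongr
    exact (norm_sub_le _ _).trans (add_le_add (hC z.2).1 (hC z.2).2)

/-- Functions with values in the closure of the averages of mixtures are averaged mixtures. -/
theorem IsWells.isAveragedMixture (h : IsWells W a b) (u : VecL2 Ω M)
    (hu : ∀ᵐ x ∂(volume.restrict Ω), u x ∈ closure (mixtureSet a b)) :
    IsAveragedMixture a b u := by
  obtain ⟨C, hC⟩ := h.norm_mixtureMean_le
  have hz0 : mixtureMean a b (fun _ => 0) ∈ mixtureSet a b :=
    ⟨fun _ => 0, measurable_const, fun _ => ⟨le_rfl, zero_le_one⟩, rfl⟩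
  -- The approximations take values in the set of averages itself and converge because `u` lies in
  -- its closure. Each of the finitely many values has its own θ, so the densities below are jointly
  -- measurable without a selection theorem.
  let s : ℕ → SimpleFunc (E N) (E M) := fun n =>
    SimpleFunc.approxOn u (Lp.stronglyMeasurable u).measurable (mixtureSet a b) _ hz0 n
  have hs : ∀ n x, s n x ∈ mixtureSet a b := fun n x => SimpleFunc.approxOn_mem _ hz0 n x
  have hsu : ∀ᵐ x ∂(volume.restrict Ω), Tendsto (fun n => s n x) atTop (𝓝 (u x)) := by
    filter_upwards [hu] with x hx using SimpleFunc.tendsto_approxOn _ hz0 hx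
  have hθ : ∀ p, ∃ θ : E N → ℝ, Measurable θ ∧ (∀ y, θ y ∈ Set.Icc (0 : ℝ) 1) ∧
      (p ∈ mixtureSet a b → p = mixtureMean a b θ) := fun p => by
    by_cases hp : p ∈ mixtureSet a b
    · obtain ⟨θ, h1, h2, h3⟩ := hp
      exact ⟨θ, h1, h2, fun _ => h3⟩
    · exact ⟨fun _ => 0, measurable_const, fun _ => ⟨le_rfl, zero_le_one⟩, fun h => (hp h).elim⟩
  choose θ hθm hθ01 hθ using hθ
  let ν : ℕ → E N × E N → ℝ := fun n z => θ (s n z.1) z.2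
  have hν01 : ∀ n z, ν n z ∈ Set.Icc (0 : ℝ) 1 := fun n z => hθ01 _ _
  have hνm : ∀ n, Measurable (ν n) := fun n =>
    ((s n).comp Prod.fst measurable_fst).measurable_bind (fun p z => θ p z.2) fun p =>
      (hθm p).comp measurable_snd
  have hν1 : ∀ n z, ‖ν n z‖ ≤ 1 := fun n z => by
    rw [Real.norm_eq_abs, abs_of_nonneg (hν01 n z).1]
    exact (hν01 n z).2
  have hνL : ∀ n, MemLp (ν n) 2 (fiberMeasure Ω) := fun n =>
    MemLp.of_bound (hνm n).aestronglyMeasurable 1 (Eventually.of_forall (hν1 n))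
  have hsep : TopologicalSpace.SeparableSpace (Lp ℝ 2 (fiberMeasure Ω)) := by
    have : Fact ((2 : ℝ≥0∞) ≠ ⊤) := ⟨by simp⟩
    have : MeasurableSpace.CountablyGenerated (E N × E N) := inferInstance
    infer_instance
  obtain ⟨μ, t, ht, hμ⟩ := exists_weaklyConverges_subseq (u := fun n => (hνL n).toLp (ν n))
    (R := (measureUnivNNReal (fiberMeasure Ω) : ℝ) ^ (2 : ℝ≥0∞).toReal⁻¹ * 1) fun n =>
      Lp.norm_le_of_ae_bound zero_le_one (by
        filter_upwards [(hνL n).coeFn_toLp] with z hz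
        rw [hz]
        exact hν1 n z)
  refine ⟨μ, Lp.memLp μ, hμ.ae_mem_Icc fun j => ?_, ?_⟩
  · filter_upwards [(hνL (t j)).coeFn_toLp] with z hz
    rw [hz]
    exact hν01 _ z
  have hμi : Integrable μ (fiberMeasure Ω) := (Lp.memLp μ).integrable (by norm_num)
  -- The densities converge only weakly, so `u` and the mean of the limit density are compared
  -- through their integrals over measurable sets.
  refine Integrable.ae_eq_of_forall_setIntegral_eq u (fun x => mixtureMean a b fun y => μ (x, y))
    ((Lp.memLp u).integrable (by norm_num)) (h.integrable_mixtureMean_fiber hμi) fun A hA _ => ?_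
  have h1 := h.tendsto_setIntegral_mixtureMean hμ hA
  have h2 : ∀ j, ∫ x in A, (mixtureMean a b fun y => (hνL (t j)).toLp (ν (t j)) (x, y))
      ∂(volume.restrict Ω) = ∫ x in A, s (t j) x ∂(volume.restrict Ω) := fun j => by
    refine integral_congr_ae (ae_restrict_of_ae ?_)
    filter_upwards [Measure.ae_ae_of_ae_prod (hνL (t j)).coeFn_toLp] with x hx
    rw [mixtureMean_congr (ae_eq_refl a) (ae_eq_refl b) hx]
    exact (hθ _ (hs _ _)).symm
  simp only [h2] at h1
  refine tendsto_nhds_unique (tendsto_integral_of_dominated_convergence (fun _ => C)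
    (fun j => (s (t j)).aestronglyMeasurable) (integrable_const _)
    (fun j => Eventually.of_forall fun x => hC _ (hs _ x)) ?_) h1
  filter_upwards [ae_restrict_of_ae hsu] with x hx using hx.comp ht.tendsto_atTop

/-- The functions of zero limit energy are the averaged mixtures of the wells. -/
theorem IsWells.limitEnergy_eq_zero_iff (hN : 1 ≤ N) (hW : IsRegularIntegrand W)
    (h : IsWells W a b) (u : VecL2 Ω M) :
    limitEnergy W Ω u = 0 ↔ IsAveragedMixture a b u := by
  have hΩfin : volume Ω ≠ ⊤ := isFiniteMeasure_restrict.1 inferInstance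
  constructor
  · intro hu
    rw [hW.limitEnergy_eq hN hΩfin, ENNReal.ofReal_eq_zero] at hu
    have h0 := (integral_eq_zero_iff_of_nonneg (fun x => hW.relaxedPotential_nonneg (u x))
      (hW.integrable_relaxedPotential hN (Lp.memLp u))).1
      (le_antisymm hu (integral_nonneg fun x => hW.relaxedPotential_nonneg _))
    refine h.isAveragedMixture u ?_
    filter_upwards [h0] with x hx using h.mem_closure_mixtureSet hW hx
  · rintro ⟨μ, hμL, hμ01, hμ⟩
    rw [limitEnergy, ← lintegral_zero (μ := volume.restrict Ω)]
    refine lintegral_congr_ae ?_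
    filter_upwards [hμ, Measure.ae_ae_of_ae_prod hμ01, hμL.1.prodMk_left] with x hx h01 hm
    rw [hx]
    exact h.homogenizedPotential_eq_zero hm.aemeasurable h01

/-- The masses of the functions of zero limit energy are those compatible with the wells. -/
theorem IsWells.exists_limitEnergy_eq_zero_iff (hN : 1 ≤ N) (hW : IsRegularIntegrand W)
    (h : IsWells W a b) (m : E M) :
    (∃ u : VecL2 Ω M, limitEnergy W Ω u = 0 ∧ ∫ x in Ω, u x = m) ↔ IsCompatibleMass a b Ω m := by
  constructor
  · rintro ⟨u, hu, rfl⟩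
    by_cases h0 : volume.real Ω = 0
    · have hz : volume Ω = 0 :=
        (measureReal_eq_zero_iff (isFiniteMeasure_restrict.1 inferInstance)).1 h0
      refine ⟨fun _ => 0, measurable_const, fun _ => ⟨le_rfl, zero_le_one⟩, ?_⟩
      rw [setIntegral_measure_zero _ hz, hz, ENNReal.toReal_zero, zero_smul]
    -- By Jensen, the constant function with the same mass also has zero energy. Its value is the
    -- same at almost every point, so one generic fibre μ(x, ·) serves as θ.
    · obtain ⟨μ, hμL, hμ01, hμ⟩ := (h.limitEnergy_eq_zero_iff hN hW _).1
        (le_antisymm ((hW.limitEnergy_const_le hN h0 u).trans_eq hu) zero_le)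
      have hne : (ae ((volume : Measure (E N)).restrict Ω)).NeBot := by
        rw [ae_neBot, Ne, Measure.restrict_eq_zero]
        exact fun hz => h0 (by rw [measureReal_def, hz, ENNReal.toReal_zero])
      obtain ⟨x, hx, hx', h01, hm⟩ := (hμ.and ((memLp_const (μ := volume.restrict Ω) (p := 2)
        ((volume.real Ω)⁻¹ • ∫ x in Ω, u x)).coeFn_toLp.and
        ((Measure.ae_ae_of_ae_prod hμ01).and hμL.1.prodMk_left))).exists
      rw [hx'] at hx
      -- A Borel representative clipped to [0,1], since θ must be measurable with values in [0,1]
      -- everywhere.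
      refine ⟨fun y => max 0 (min 1 (hm.aemeasurable.mk _ y)),
        measurable_const.max (measurable_const.min hm.aemeasurable.measurable_mk),
        fun y => ⟨le_max_left _ _, max_le zero_le_one (min_le_left _ _)⟩, ?_⟩
      have hθ : (fun y => μ (x, y)) =ᵐ[volume.restrict (unitCube N)]
          fun y => max 0 (min 1 (hm.aemeasurable.mk _ y)) := by
        filter_upwards [hm.aemeasurable.ae_eq_mk, h01] with y hy hy01
        rw [← hy, min_eq_right hy01.2, max_eq_right hy01.1]
      have hmean := mixtureMean_congr (ae_eq_refl a) (ae_eq_refl b) hθ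
      rw [mixtureMean, ← hx, mixtureMean] at hmean
      rw [← hmean]
      exact (smul_inv_smul₀ h0 _).symm
  · rintro ⟨θ, hθm, hθ01, rfl⟩
    refine ⟨(memLp_const (mixtureMean a b θ)).toLp _, ?_, setIntegral_toLp_const _⟩
    rw [limitEnergy, ← lintegral_zero (μ := volume.restrict Ω)]
    refine lintegral_congr_ae ?_
    filter_upwards [(memLp_const (mixtureMean a b θ)).coeFn_toLp] with x hx
    rw [hx]
    exact h.homogenizedPotential_eq_zero hθm.aemeasurable (Eventually.of_forall hθ01)

end Fibers

lemma isAveragedMixture_congr {a' b' : E N → E M}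
    (ha : a =ᵐ[volume.restrict (unitCube N)] a') (hb : b =ᵐ[volume.restrict (unitCube N)] b')
    {Ω : Set (E N)} (u : VecL2 Ω M) : IsAveragedMixture a b u ↔ IsAveragedMixture a' b' u := by
  have h : ∀ θ, mixtureMean a b θ = mixtureMean a' b' θ := fun θ =>
    mixtureMean_congr ha hb (ae_eq_refl θ)
  simp only [mixtureMean] at h
  simp only [IsAveragedMixture, h]

lemma isCompatibleMass_congr {a' b' : E N → E M}
    (ha : a =ᵐ[volume.restrict (unitCube N)] a') (hb : b =ᵐ[volume.restrict (unitCube N)] b')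
    (Ω : Set (E N)) (m : E M) : IsCompatibleMass a b Ω m ↔ IsCompatibleMass a' b' Ω m := by
  have h : ∀ θ, mixtureMean a b θ = mixtureMean a' b' θ := fun θ =>
    mixtureMean_congr ha hb (ae_eq_refl θ)
  simp only [mixtureMean] at h
  simp only [IsCompatibleMass, h]

/-- The wells of a double well potential agree almost everywhere with bounded measurable
functions. -/
theorem PeriodicDoubleWell.exists_isWells (D : PeriodicDoubleWell N M)
    (hW : IsRegularIntegrand W) (hDW : ∀ᵐ y : E N, ∀ p, D.W y p = W y p) :
    ∃ a b : E N → E M, IsWells W a b ∧ D.a =ᵐ[volume.restrict (unitCube N)] a ∧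
      D.b =ᵐ[volume.restrict (unitCube N)] b := by
  obtain ⟨C, hC, hgr⟩ := hW.growth
  have hae : ∀ᵐ y ∂(volume.restrict (unitCube N)), ∀ p, W y p = 0 ↔ p = D.a y ∨ p = D.b y := by
    filter_upwards [ae_restrict_of_ae hDW, D.W_eq_zero_iff] with y h1 h2 p
    rw [← h1, h2]
  -- The wells are zeros of the potential, so coercivity gives ‖p‖² ≤ C; they are essentially
  -- bounded.
  have hbd : ∀ {y p}, W y p = 0 → ‖p‖ ≤ C + 1 := fun {y p} hp => by
    have := (hgr y p).1
    rw [hp] at this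
    nlinarith [norm_nonneg p]
  have hex : ∀ f : E N → E M, AEMeasurable f volume →
      (∀ᵐ y ∂(volume.restrict (unitCube N)), ‖f y‖ ≤ C + 1) →
      ∃ g : E N → E M, Measurable g ∧ (∀ y, ‖g y‖ ≤ C + 1) ∧
        f =ᵐ[volume.restrict (unitCube N)] g := by
    intro f hf hfb
    refine ⟨{y | ‖hf.mk f y‖ ≤ C + 1}.indicator (hf.mk f), hf.measurable_mk.indicator
      (measurableSet_le hf.measurable_mk.norm measurable_const), fun y => ?_, ?_⟩
    · by_cases hy : y ∈ {y | ‖hf.mk f y‖ ≤ C + 1}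
      · rw [Set.indicator_of_mem hy]; exact hy
      · rw [Set.indicator_of_notMem hy, norm_zero]; positivity
    · filter_upwards [ae_restrict_of_ae hf.ae_eq_mk, hfb] with y h1 h2
      rw [Set.indicator_of_mem, h1]
      rw [h1] at h2
      exact h2
  obtain ⟨a, ham, haC, ha⟩ := hex D.a D.a_measurable (by
    filter_upwards [hae] with y hy using hbd ((hy _).2 (Or.inl rfl)))
  obtain ⟨b, hbm, hbC, hb⟩ := hex D.b D.b_measurable (by
    filter_upwards [hae] with y hy using hbd ((hy _).2 (Or.inr rfl)))
  refine ⟨a, b, ⟨ham, hbm, ⟨C + 1, by positivity, fun y => ⟨haC y, hbC y⟩⟩, ?_⟩, ha, hb⟩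
  filter_upwards [hae, ha, hb] with y h1 h2 h3
  rwa [← h2, ← h3]

end ZeroEnergy

end PhaseHomogenization

end

/-! ### Transfer from the regular representatives to the original data. -/

theorem theorem4p3 {N M : ℕ} (hN : 1 ≤ N) (hM : 1 ≤ M)
    (D : PhaseHomogenization.PeriodicDoubleWell N M)
    (Ω : Set (PhaseHomogenization.E N)) (hΩ : IsOpen Ω) (hΩb : Bornology.IsBounded Ω)
    (ε δ : ℕ → ℝ) (hε : ∀ n, 0 < ε n) (hδ : ∀ n, 0 < δ n)
    (hε0 : Tendsto ε atTop (𝓝 0)) (hδ0 : Tendsto δ atTop (𝓝 0))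
    (hεδ : Tendsto (fun n => ε n / δ n) atTop (𝓝 0))
    (m : PhaseHomogenization.E M) :
    -- compactness of sequences with bounded energy
    (∀ u : ℕ → PhaseHomogenization.VecL2 Ω M,
      (⨆ n, PhaseHomogenization.massConstrained
        (PhaseHomogenization.energy D.W Ω (ε n) (δ n)) m (u n)) < ⊤ →
      ∃ (v : PhaseHomogenization.VecL2 Ω M) (s : ℕ → ℕ), StrictMono s ∧
        PhaseHomogenization.WeaklyConverges (fun j => u (s j)) v ∧
        PhaseHomogenization.massConstrained
          (PhaseHomogenization.limitEnergy D.W Ω) m v < ⊤) ∧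
    -- Gamma-convergence of the constrained functionals
    PhaseHomogenization.WeaklyGammaConverges
      (fun n => PhaseHomogenization.massConstrained
        (PhaseHomogenization.energy D.W Ω (ε n) (δ n)) m)
      (PhaseHomogenization.massConstrained (PhaseHomogenization.limitEnergy D.W Ω) m) ∧
    -- the constrained limit functional attains its minimum
    (∃ u : PhaseHomogenization.VecL2 Ω M, ∀ v : PhaseHomogenization.VecL2 Ω M,
      PhaseHomogenization.massConstrained (PhaseHomogenization.limitEnergy D.W Ω) m u ≤
        PhaseHomogenization.massConstrained (PhaseHomogenization.limitEnergy D.W Ω) m v) ∧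
    -- the minimum is zero exactly for the masses compatible with the wells
    (IsLeast (Set.range
        (PhaseHomogenization.massConstrained (PhaseHomogenization.limitEnergy D.W Ω) m)) 0 ↔
      PhaseHomogenization.IsCompatibleMass D.a D.b Ω m) ∧
    -- the zeros are the averaged mixtures of the wells with mass `m`
    (∀ u : PhaseHomogenization.VecL2 Ω M,
      PhaseHomogenization.massConstrained (PhaseHomogenization.limitEnergy D.W Ω) m u = 0 ↔
        PhaseHomogenization.IsAveragedMixture D.a D.b u ∧ ∫ x in Ω, u x = m) := by
  obtain ⟨W, hW, hDW⟩ := D.exists_isRegularIntegrand hM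
  obtain ⟨a, b, hab, ha, hb⟩ := D.exists_isWells hW hDW
  have hΩfin : volume Ω ≠ ⊤ := hΩb.measure_lt_top.ne
  have hfin : IsFiniteMeasure ((volume : Measure (PhaseHomogenization.E N)).restrict Ω) :=
    isFiniteMeasure_restrict.2 hΩfin
  rw [PhaseHomogenization.limitEnergy_congr hDW Ω,
    PhaseHomogenization.isCompatibleMass_congr ha hb]
  simp only [fun n => PhaseHomogenization.energy_congr (M := M) hDW Ω (ε n) (hδ n),
    PhaseHomogenization.isAveragedMixture_congr ha hb]
  have hzero : ∀ u : PhaseHomogenization.VecL2 Ω M,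
      PhaseHomogenization.massConstrained (PhaseHomogenization.limitEnergy W Ω) m u = 0 ↔
        PhaseHomogenization.limitEnergy W Ω u = 0 ∧ ∫ x in Ω, u x = m := fun u => by
    rw [PhaseHomogenization.massConstrained]
    split_ifs with h <;> simp [h]
  refine ⟨hW.exists_weaklyConverges_of_bounded_energy hN hΩfin m,
    hW.weaklyGammaConverges hN hΩ hΩb hδ hδ0 hεδ m, hW.exists_isMin_limitEnergy hN hΩfin m, ?_,
    fun u => ?_⟩
  · rw [← hab.exists_limitEnergy_eq_zero_iff hN hW]
    simp only [← hzero]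
    -- Values lie in [0, ∞], so 0 is the least value as soon as it is attained.
    exact ⟨fun h => h.1, fun h => ⟨h, fun _ _ => zero_le⟩⟩
  · rw [hzero, hab.limitEnergy_eq_zero_iff hN hW]
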